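/- **Theorem A.** *Conventions.* A surface is a smooth regular parametrized surface $z=z(u,v)$, $(u,v)\in\mathcal D$, $\mathcal D\subseteq\mathbb R^2$ open, in Euclidean $\mathbb R^3$, free of umbilical points and parametrized by principal parameters ($F=M=0$). Its normal $l$ is the unit vector in the direction $z_u\times z_v$, $K$ and $H$ are the Gauss and mean curvatures and $H'=\sqrt{H^2-K}$. Write $\nu_1=L/E$, $\nu_2=N/G$. Let $f,g$ be smooth functions with $f>g$, $f'g'\neq0$ (Weingarten functions) and suppose $\nu_1=f(\lambda)$, $\nu_2=g(\lambda)$ for a smooth function $\lambda(u,v)$. The principal parameters are *natural* if $\sqrt E\exp\int_{\lambda_0}^{\lambda}\frac{f'}{f-g}=\frac1{|\mathfrak a|}$ and $\sqrt G\exp\int_{\lambda_0}^{\lambda}\frac{g'}{g-f}=\frac1{|\mathfrak b|}$ with non-zero constants $\mathfrak a,\mathfrak b$. The *natural PDE* is $$\mathfrak b^2e^{2\int_{\lambda_0}^{\lambda}\frac{g'}{g-f}}\Big[f'\lambda_{vv}+\Big(f''-\tfrac{2f'^2}{f-g}\Big)\lambda_v^2\Big]-\mathfrak a^2e^{2\int_{\lambda_0}^{\lambda}\frac{f'}{f-g}}\Big[g'\lambda_{uu}+\Big(g''-\tfrac{2g'^2}{g-f}\Big)\lambda_u^2\Big]-fg(f-g)=0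 .$$ The parallel surface at distance $d$ is $z+d\,l$. Put $\Delta w=w_{uu}+w_{vv}$, $\bar\Delta w=w_{uu}-w_{vv}$, $\Delta^*w=w_{uu}+(w^{-1})_{vv}$, $\bar\Delta^*w=w_{uu}-(w^{-1})_{vv}$. The ten *basic classes*, with their Weingarten functions $\nu_1=f(\lambda)$, $\nu_2=g(\lambda)$, the admitted values of $\lambda$, and a PDE, are: 1. $H=0$: $\nu_1=e^\lambda$, $\nu_2=-e^{\lambda}$, $\lambda\in\mathbb R$; $\Delta\lambda=-e^\lambda$. 2. $H=\frac12$: $\nu_1=\frac{1+e^\lambda}2$, $\nu_2=\frac{1-e^\lambda}2$, $\lambda\in\mathbb R$; $\Delta\lambda=-\sinh\lambda$. 3. $H'=1$: $\nu_1=\lambda+2$, $\nu_2=\lambda$, $\lambda\in\mathbb R$; $\Delta^*(e^\lambda)=-2\lambda(\lambda+2)$. 4. $H=\beta H'$, $\beta^2>1$: $\nu_1=\frac{\beta+1}{|\beta-1|}\lambda$, $\nu_2=\frac{\beta-1}{|\beta-1|}\lambda$, $\lambda=|\nu_2|>0$; $\Delta^*(\lambda^\beta)=-2\frac{\beta(\beta+1)}{(\beta-1)^2}\lambda$.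 5. $H=\beta H'$, $\beta^2<1$, $\beta\ne0$: $\nu_1,\nu_2,\lambda$ as in 4; $\bar\Delta^*(\lambda^\beta)=-2\frac{\beta(\beta+1)}{(\beta-1)^2}\lambda$. 6. $H=\beta H'+1$, $\beta^2>1$: $\nu_1=\frac{(\beta+1)\lambda+2}2$, $\nu_2=\frac{(\beta-1)\lambda+2}2$, $\lambda>0$; $\Delta^*(\lambda^\beta)=-\frac{\beta((\beta-1)\lambda+2)((\beta+1)\lambda+2)}{2(\beta-1)\lambda}$. 7. $H=\beta H'+1$, $\beta^2<1$, $\beta\neq0$: $\nu_1,\nu_2,\lambda$ as in 6; the same PDE with $\bar\Delta^*$ in place of $\Delta^*$. 8. $K=-1$: $\nu_1=\tan\frac\lambda2$, $\nu_2=-\cot\frac\lambda2$, $0<\lambda<\pi$; $\bar\Delta\lambda=\sin\lambda$. 9. $K=2H'$: $\nu_1=\frac{\lambda-4}{\lambda-2}-1$, $\nu_2=\frac2{4-\lambda}$, $\lambda<2$ or $\lambda>4$; $\Delta^*(e^\lambda)=-2$. 10. $K=\beta H'+\gamma$, $\beta\neq0$, $\gamma<0$: $\nu_1=\lambda$, $\nu_2=\frac{\beta\lambda+2\gamma}{2\lambda+\beta}$,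 $2\lambda+\beta>0$; $\Delta^*(e^{\beta\mathcal I})=\frac{\beta\gamma}2\,\frac{\lambda(\beta\lambda+2\gamma)}{\lambda^2-\gamma}$ with $\mathcal I=\frac1{\sqrt{-\gamma}}\arctan\frac\lambda{\sqrt{-\gamma}}$. *Claim.* One can choose non-zero constants $\mathfrak a,\mathfrak b$, depending only on the basic class (with its $\beta,\gamma$) and on $\lambda_0$, such that the following holds. (i) The functions $f,g$ of each basic class are Weingarten functions, and the natural PDE of the class with these constants is equivalent to the PDE in the list. (ii) Every surface of a basic class has, near each point $p$, natural principal parameters with these constants, $\nu_1=f(\lambda)$, $\nu_2=g(\lambda)$ and $\lambda_0=\lambda(p)$; in these parameters $\lambda$ satisfies the listed PDE. (iii) Conversely, for every smooth solution $\lambda$ of a listed PDE with admitted values there is, near each point $q$ of its domain, a surface of the class with $\nu_1=f(\lambda)$, $\nu_2=g(\lambda)$ in natural principal parameters with these constants ($\lambda_0=\lambda(q)$). On a connected domain this surface is unique up to a proper motion. (iv) Let the curvatures of a surface $S$ satisfy $\delta K=\alpha H+\beta H'+\gamma$ with constants such that $\alpha^2-\beta^2+4\gamma\delta\neq0$. Then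 around each point of an open dense part $\mathcal D'$ of $\mathcal D$ (of all of $\mathcal D$ if $\alpha^2+4\gamma\delta\ge0$ or $\alpha=0$) there are parameters of $S$, possibly reversing its orientation, which are natural principal for $S$ and such that for some constants $d\in\mathbb R$, $c>0$ the surface $c\,(z+d\,l)$ is regular and belongs to one of the ten basic classes. The same parameters are natural principal for that surface, with the constants above, its function $\lambda$ satisfies the PDE of the class, and the natural PDE of $S$ itself, written for its Weingarten functions in terms of the same $\lambda$ and with suitable constants, is equivalent to that PDE. -/

import Mathlib

open scoped ContDiff

noncomputable section

namespace LinearWeingarten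

/-- Euclidean three-space. -/
abbrev E3 := EuclideanSpace ℝ (Fin 3)

/-- Partial derivative with respect to the first parameter. -/
def dU {F : Type*} [NormedAddCommGroup F] [NormedSpace ℝ F] (f : ℝ × ℝ → F) (p : ℝ × ℝ) : F :=
  fderiv ℝ f p (1, 0)

/-- Partial derivative with respect to the second parameter. -/
def dV {F : Type*} [NormedAddCommGroup F] [NormedSpace ℝ F] (f : ℝ × ℝ → F) (p : ℝ × ℝ) : F :=
  fderiv ℝ f p (0, 1)

/-- The cross product of the oriented Euclidean three-space. -/
def cross (a b : E3) : E3 :=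
  !₂[a 1 * b 2 - a 2 * b 1, a 2 * b 0 - a 0 * b 2, a 0 * b 1 - a 1 * b 0]

/-! ### Parametrized surfaces and their curvatures -/

/-- `z` is a smooth regular parametrized surface over the open set `D`. -/
structure IsRegularSurface (z : ℝ × ℝ → E3) (D : Set (ℝ × ℝ)) : Prop where
  isOpen : IsOpen D
  smooth : ContDiffOn ℝ ∞ z D
  regular : ∀ p ∈ D, LinearIndependent ℝ ![dU z p, dV z p]

/-- The unit normal making the frame `z_u`, `z_v`, `l` positively oriented. -/
def normal (z : ℝ × ℝ → E3) (p : ℝ × ℝ) : E3 :=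
  ‖cross (dU z p) (dV z p)‖⁻¹ • cross (dU z p) (dV z p)

/-- Coefficients of the first fundamental form. -/
def coefE (z : ℝ × ℝ → E3) (p : ℝ × ℝ) : ℝ := inner ℝ (dU z p) (dU z p)
def coefF (z : ℝ × ℝ → E3) (p : ℝ × ℝ) : ℝ := inner ℝ (dU z p) (dV z p)
def coefG (z : ℝ × ℝ → E3) (p : ℝ × ℝ) : ℝ := inner ℝ (dV z p) (dV z p)

/-- Coefficients of the second fundamental form. -/
def coefL (z : ℝ × ℝ → E3) (p : ℝ × ℝ) : ℝ := inner ℝ (dU (dU z) p) (normal z p)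
def coefM (z : ℝ × ℝ → E3) (p : ℝ × ℝ) : ℝ := inner ℝ (dU (dV z) p) (normal z p)
def coefN (z : ℝ × ℝ → E3) (p : ℝ × ℝ) : ℝ := inner ℝ (dV (dV z) p) (normal z p)

/-- Gauss curvature. -/
def curvK (z : ℝ × ℝ → E3) (p : ℝ × ℝ) : ℝ :=
  (coefL z p * coefN z p - coefM z p ^ 2) / (coefE z p * coefG z p - coefF z p ^ 2)

/-- Mean curvature. -/
def curvH (z : ℝ × ℝ → E3) (p : ℝ × ℝ) : ℝ :=
  (coefE z p * coefN z p - 2 * coefF z p * coefM z p + coefG z p * coefL z p) /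
    (2 * (coefE z p * coefG z p - coefF z p ^ 2))

/-- The third curvature `H'`, half of the (non-negative) difference of the principal curvatures. -/
def curvH' (z : ℝ × ℝ → E3) (p : ℝ × ℝ) : ℝ := Real.sqrt (curvH z p ^ 2 - curvK z p)

/-- `p` is an umbilical point: the second fundamental form is a multiple of the first. -/
def IsUmbilic (z : ℝ × ℝ → E3) (p : ℝ × ℝ) : Prop :=
  ∃ k : ℝ, coefL z p = k * coefE z p ∧ coefM z p = k * coefF z p ∧ coefN z p = k * coefG z p

/-- A regular surface without umbilical points whose parametric lines are principal lines. -/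
structure IsPrincipalSurface (z : ℝ × ℝ → E3) (D : Set (ℝ × ℝ)) : Prop
    extends IsRegularSurface z D where
  noUmbilic : ∀ p ∈ D, ¬ IsUmbilic z p
  orthogonal : ∀ p ∈ D, coefF z p = 0
  conjugate : ∀ p ∈ D, coefM z p = 0

/-- `φ` is an admissible change of parameters defined on `V` with values in `D`: a smooth
diffeomorphism from the open set `V` onto an open subset of `D`. -/
structure IsReparam (φ : ℝ × ℝ → ℝ × ℝ) (V D : Set (ℝ × ℝ)) : Prop where
  isOpen : IsOpen V
  smooth : ContDiffOn ℝ ∞ φ V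
  injOn : Set.InjOn φ V
  mapsTo : Set.MapsTo φ V D
  regular : ∀ q ∈ V, Function.Bijective (fderiv ℝ φ q)

/-- The parallel surface at (signed) distance `a`. -/
def parallel (a : ℝ) (z : ℝ × ℝ → E3) (p : ℝ × ℝ) : E3 := z p + a • normal z p

/-! ### Weingarten functions, natural principal parameters, natural PDE -/

/-- `f`, `g` are Weingarten functions on the set `I` (the first being the larger one). -/
structure IsWeingartenPair (f g : ℝ → ℝ) (I : Set ℝ) : Prop where
  smooth_f : ContDiffOn ℝ ∞ f I
  smooth_g : ContDiffOn ℝ ∞ g I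
  lt : ∀ t ∈ I, g t < f t
  deriv_f : ∀ t ∈ I, deriv f t ≠ 0
  deriv_g : ∀ t ∈ I, deriv g t ≠ 0

/-- The integral of `f' / (f - g)` from `t₀` to `t`. -/
def wInt (f g : ℝ → ℝ) (t₀ t : ℝ) : ℝ := ∫ s in t₀..t, deriv f s / (f s - g s)

/-- `z` is, over `V`, a surface with Weingarten functions `f`, `g` and geometric function `lam`
(so that the principal curvatures are `f ∘ lam` and `g ∘ lam`), and the parameters are natural
principal parameters, i.e. `√E exp ∫ f'/(f-g)` and `√G exp ∫ g'/(g-f)` are constants; the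
integrals start from `t₀` and the constants are `1/|a|` and `1/|b|`. -/
structure IsNaturalPatch (f g : ℝ → ℝ) (a b t₀ : ℝ) (lam : ℝ × ℝ → ℝ)
    (z : ℝ × ℝ → E3) (V : Set (ℝ × ℝ)) : Prop extends IsPrincipalSurface z V where
  nu_one : ∀ p ∈ V, coefL z p / coefE z p = f (lam p)
  nu_two : ∀ p ∈ V, coefN z p / coefG z p = g (lam p)
  constE : ∀ p ∈ V, Real.sqrt (coefE z p) * Real.exp (wInt f g t₀ (lam p)) = |a|⁻¹
  constG : ∀ p ∈ V, Real.sqrt (coefG z p) * Real.exp (wInt g f t₀ (lam p)) = |b|⁻¹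

/-- The natural PDE of the Weingarten surfaces with Weingarten functions `f`, `g`
(normalizing constants `a`, `b`, `t₀`), at the point `p`. -/
def NaturalPDE (f g : ℝ → ℝ) (a b t₀ : ℝ) (lam : ℝ × ℝ → ℝ) (p : ℝ × ℝ) : Prop :=
  b ^ 2 * Real.exp (2 * wInt g f t₀ (lam p)) *
      (deriv f (lam p) * dV (dV lam) p +
        (deriv (deriv f) (lam p) - 2 * deriv f (lam p) ^ 2 / (f (lam p) - g (lam p))) *
          dV lam p ^ 2) -
    a ^ 2 * Real.exp (2 * wInt f g t₀ (lam p)) *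
      (deriv g (lam p) * dU (dU lam) p +
        (deriv (deriv g) (lam p) - 2 * deriv g (lam p) ^ 2 / (g (lam p) - f (lam p))) *
          dU lam p ^ 2) -
    f (lam p) * g (lam p) * (f (lam p) - g (lam p)) = 0

/-! ### The four operators -/

def lap (w : ℝ × ℝ → ℝ) (p : ℝ × ℝ) : ℝ := dU (dU w) p + dV (dV w) p
def lapBar (w : ℝ × ℝ → ℝ) (p : ℝ × ℝ) : ℝ := dU (dU w) p - dV (dV w) p
def lapStar (w : ℝ × ℝ → ℝ) (p : ℝ × ℝ) : ℝ := dU (dU w) p + dV (dV fun q => (w q)⁻¹) p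
def lapStarBar (w : ℝ × ℝ → ℝ) (p : ℝ × ℝ) : ℝ := dU (dU w) p - dV (dV fun q => (w q)⁻¹) p

/-! ### The ten basic classes -/

inductive BasicClass : Type
  | c1 | c2 | c3
  | c4 (β : ℝ) | c5 (β : ℝ) | c6 (β : ℝ) | c7 (β : ℝ)
  | c8 | c9
  | c10 (β γ : ℝ)

namespace BasicClass

/-- The ranges of the constants. -/
def Admissible : BasicClass → Prop
  | c4 β => 1 < β ^ 2
  | c5 β => β ^ 2 < 1 ∧ β ≠ 0
  | c6 β => 1 < β ^ 2
  | c7 β => β ^ 2 < 1 ∧ β ≠ 0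
  | c10 β γ => β ≠ 0 ∧ γ < 0
  | _ => True

/-- The relation between the curvatures `K`, `H`, `H'` defining the class. -/
def Relation : BasicClass → ℝ → ℝ → ℝ → Prop
  | c1, _, H, _ => H = 0
  | c2, _, H, _ => H = 1 / 2
  | c3, _, _, H' => H' = 1
  | c4 β, _, H, H' => H = β * H'
  | c5 β, _, H, H' => H = β * H'
  | c6 β, _, H, H' => H = β * H' + 1
  | c7 β, _, H, H' => H = β * H' + 1
  | c8, K, _, _ => K = -1
  | c9, K, _, H' => K = 2 * H'
  | c10 β γ, K, _, H' => K = β * H' + γ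

/-- The set of values of the unknown function of the natural PDE. -/
def range : BasicClass → Set ℝ
  | c1 | c2 | c3 => Set.univ
  | c4 _ | c5 _ | c6 _ | c7 _ => Set.Ioi 0
  | c8 => Set.Ioo 0 Real.pi
  | c9 => {t | t < 2 ∨ 4 < t}
  | c10 β _ => {t | 0 < 2 * t + β}

/-- The larger principal curvature as a function of the unknown of the natural PDE. -/
def nu₁ : BasicClass → ℝ → ℝ
  | c1, t => Real.exp t
  | c2, t => (1 + Real.exp t) / 2
  | c3, t => t + 2
  | c4 β, t => (β + 1) / |β - 1| * t
  | c5 β, t => (β + 1) / |β - 1| * t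
  | c6 β, t => ((β + 1) * t + 2) / 2
  | c7 β, t => ((β + 1) * t + 2) / 2
  | c8, t => Real.tan (t / 2)
  | c9, t => (t - 4) / (t - 2) - 1
  | c10 _ _, t => t

/-- The smaller principal curvature as a function of the unknown of the natural PDE. -/
def nu₂ : BasicClass → ℝ → ℝ
  | c1, t => -Real.exp t
  | c2, t => (1 - Real.exp t) / 2
  | c3, t => t
  | c4 β, t => (β - 1) / |β - 1| * t
  | c5 β, t => (β - 1) / |β - 1| * t
  | c6 β, t => ((β - 1) * t + 2) / 2
  | c7 β, t => ((β - 1) * t + 2) / 2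
  | c8, t => -(Real.tan (t / 2))⁻¹
  | c9, t => 2 / (4 - t)
  | c10 β γ, t => (β * t + 2 * γ) / (2 * t + β)

/-- The function `arctan (t / √(-γ)) / √(-γ)` of the tenth class. -/
def arcI (γ t : ℝ) : ℝ := 1 / Real.sqrt (-γ) * Real.arctan (t / Real.sqrt (-γ))

/-- The natural PDE of the class, for the unknown function `lam`, at the point `p`. -/
def PDE : BasicClass → (ℝ × ℝ → ℝ) → ℝ × ℝ → Prop
  | c1, lam, p => lap lam p = -Real.exp (lam p)
  | c2, lam, p => lap lam p = -Real.sinh (lam p)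
  | c3, lam, p => lapStar (fun q => Real.exp (lam q)) p = -2 * lam p * (lam p + 2)
  | c4 β, lam, p =>
      lapStar (fun q => lam q ^ β) p = -2 * (β * (β + 1) / (β - 1) ^ 2) * lam p
  | c5 β, lam, p =>
      lapStarBar (fun q => lam q ^ β) p = -2 * (β * (β + 1) / (β - 1) ^ 2) * lam p
  | c6 β, lam, p =>
      lapStar (fun q => lam q ^ β) p =
        -(β * ((β - 1) * lam p + 2) * ((β + 1) * lam p + 2)) / (2 * (β - 1) * lam p)
  | c7 β, lam, p =>
      lapStarBar (fun q => lam q ^ β) p =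
        -(β * ((β - 1) * lam p + 2) * ((β + 1) * lam p + 2)) / (2 * (β - 1) * lam p)
  | c8, lam, p => lapBar lam p = Real.sin (lam p)
  | c9, lam, p => lapStar (fun q => Real.exp (lam q)) p = -2
  | c10 β γ, lam, p =>
      lapStar (fun q => Real.exp (β * arcI γ (lam q))) p =
        β * γ / 2 * (lam p * (β * lam p + 2 * γ) / (lam p ^ 2 - γ))

end BasicClass

/-- `w` is, over the domain `V` with base point `q`, a surface of the basic class `C` in natural
principal parameters, normalized at `q` with the constants `a`, `b`, and `lam` is its geometric
function. -/
structure IsBasicPatch (C : BasicClass) (a b : ℝ) (lam : ℝ × ℝ → ℝ) (w : ℝ × ℝ → E3)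
    (V : Set (ℝ × ℝ)) (q : ℝ × ℝ) : Prop
    extends IsNaturalPatch C.nu₁ C.nu₂ a b (lam q) lam w V where
  connected : IsPreconnected V
  base : q ∈ V
  relation : ∀ p ∈ V, C.Relation (curvK w p) (curvH w p) (curvH' w p)
  smooth_lam : ContDiffOn ℝ ∞ lam V
  mapsTo_lam : Set.MapsTo lam V C.range

end LinearWeingarten

end

/-! Let `e = √E`, `g = √G` be the lengths of the coordinate vectors in principal parameters and
`k₁`, `k₂` the principal curvatures. The structure equations of the orthonormal frame
(`structure_equations`) have as integrability conditions the two Codazzi equations `(k₁ e)_v = k₂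
e_v`, `(k₂ g)_u = k₁ g_u` and the Gauss equation (`codazzi_gauss`). If `k₁ = f(λ)` and `k₂ = g(λ)`,
Codazzi says that `√E exp ∫ f'/(f-g)` depends on `u` alone and `√G exp ∫ g'/(g-f)` on `v` alone
(`natural_const`). Changing `u` and `v` separately therefore produces natural parameters
(`exists_natural`). In these, `E` and `G` are functions of `λ`, the Codazzi equations hold
identically, and the Gauss equation is the natural PDE up to a non-zero factor
(`gauss_iff_naturalPDE`).

For a basic class the exponentials of the integrals are explicit functions `expA`, `expB` up to
constants. Absorbing the constants into `a`, `b` turns the natural PDE into the listed one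
(`naturalPDE_iff`). Conversely, a solution of the PDE satisfies Gauss and Codazzi, so the frame
equations form a flat connection. Integrating it gives the surface (`exists_surface`, Bonnet's
theorem), and constancy of the map between two frames gives uniqueness (`congruent`).

For a general linear relation, the parallel surface at distance `d` has the same principal lines,
and its curvatures are `k/(1 - d k)` up to a common sign. The relation stays linear, with
coefficients `δ - α d - γ d²` of `K` and `α + 2 γ d` of `H`, while `α² + 4 γ δ` is invariant. If
this discriminant is non-negative, `d` can be chosen to remove `K`, except for `δ K = β H'`, which
is class 9 after scaling. If it is negative, `d` is chosen to remove `H`. A homothety and, where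
necessary, a reversal of orientation then lead to a basic class (`hasBasicPatch_of_root`,
`hasBasicPatch_of_discrim_neg`). The only obstruction is focal points. Where they fill an open set
both curvatures are constant and another distance works (`hasBasicPatch_of_focal`), which is why the
good set is dense.

Finally, the lengths and the exponentials of the integrals change by reciprocal factors under
passage to a parallel surface. Natural parameters remain natural and the natural PDE is only
multiplied by a factor (`natLen_parFun_f`, `naturalPDE_parFun`, assembled in
`hasPatch_of_relation`). -/

open scoped ContDiff

noncomputable section

namespace LinearWeingarten

/-! ### Calculus of partial derivatives in the plane. -/

section Calculus
variable {F G : Type*} [NormedAddCommGroup F] [NormedSpace ℝ F]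
  [NormedAddCommGroup G] [NormedSpace ℝ G]

/-- `f` is differentiable at `p` with partial derivatives `a` and `b`. -/
def HasD (f : ℝ × ℝ → F) (a b : F) (p : ℝ × ℝ) : Prop :=
  HasFDerivAt f ((ContinuousLinearMap.fst ℝ ℝ ℝ).smulRight a +
    (ContinuousLinearMap.snd ℝ ℝ ℝ).smulRight b) p

theorem HasD.dU_eq {f : ℝ × ℝ → F} {a b : F} {p : ℝ × ℝ} (h : HasD f a b p) : dU f p = a := by
  simp [dU, HasFDerivAt.fderiv h]

theorem HasD.dV_eq {f : ℝ × ℝ → F} {a b : F} {p : ℝ × ℝ} (h : HasD f a b p) : dV f p = b := by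
  simp [dV, HasFDerivAt.fderiv h]

theorem HasD.differentiableAt {f : ℝ × ℝ → F} {a b : F} {p : ℝ × ℝ} (h : HasD f a b p) :
    DifferentiableAt ℝ f p := HasFDerivAt.differentiableAt h

theorem hasD_of_differentiableAt {f : ℝ × ℝ → F} {p : ℝ × ℝ} (h : DifferentiableAt ℝ f p) :
    HasD f (dU f p) (dV f p) p := by
  have := h.hasFDerivAt
  unfold HasD
  convert this using 1
  ext <;> simp [dU, dV]

theorem hasD_of_hasFDerivAt {f : ℝ × ℝ → F} {p : ℝ × ℝ} {f' : ℝ × ℝ →L[ℝ] F} {a b : F}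
    (h : HasFDerivAt f f' p) (ha : f' (1, 0) = a) (hb : f' (0, 1) = b) : HasD f a b p := by
  subst ha hb
  unfold HasD
  convert h using 1
  ext <;> simp

theorem HasD.congr {f g : ℝ × ℝ → F} {a b : F} {p : ℝ × ℝ} {D : Set (ℝ × ℝ)} (hD : IsOpen D)
    (hp : p ∈ D) (h : HasD f a b p) (hfg : ∀ x ∈ D, g x = f x) : HasD g a b p :=
  HasFDerivAt.congr_of_eventuallyEq h (Filter.eventuallyEq_of_mem (hD.mem_nhds hp) hfg)

theorem HasD.eq {f : ℝ × ℝ → F} {a b a' b' : F} {p : ℝ × ℝ} (h : HasD f a b p)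
    (ha : a = a') (hb : b = b') : HasD f a' b' p := by rwa [← ha, ← hb]

theorem hasD_const (c : F) (p : ℝ × ℝ) : HasD (fun _ => c) 0 0 p := by
  exact hasD_of_hasFDerivAt (hasFDerivAt_const c p) (by simp) (by simp)

theorem hasD_fst (p : ℝ × ℝ) : HasD Prod.fst 1 0 p := by
  exact hasD_of_hasFDerivAt ((hasFDerivAt_fst (𝕜 := ℝ) (p := p))) (by simp) (by simp)

theorem hasD_snd (p : ℝ × ℝ) : HasD Prod.snd 0 1 p := by
  exact hasD_of_hasFDerivAt ((hasFDerivAt_snd (𝕜 := ℝ) (p := p))) (by simp) (by simp)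

theorem HasD.add {f g : ℝ × ℝ → F} {a b c d : F} {p : ℝ × ℝ} (h : HasD f a b p)
    (k : HasD g c d p) : HasD (fun x => f x + g x) (a + c) (b + d) p := by
  exact hasD_of_hasFDerivAt (HasFDerivAt.add h k) (by simp) (by simp)

theorem HasD.sub {f g : ℝ × ℝ → F} {a b c d : F} {p : ℝ × ℝ} (h : HasD f a b p)
    (k : HasD g c d p) : HasD (fun x => f x - g x) (a - c) (b - d) p := by
  exact hasD_of_hasFDerivAt (HasFDerivAt.sub h k) (by simp) (by simp)

theorem HasD.neg {f : ℝ × ℝ → F} {a b : F} {p : ℝ × ℝ} (h : HasD f a b p) :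
    HasD (fun x => -f x) (-a) (-b) p := by
  exact hasD_of_hasFDerivAt (HasFDerivAt.neg h) (by simp) (by simp)

theorem HasD.clm {f : ℝ × ℝ → F} {a b : F} {p : ℝ × ℝ} (T : F →L[ℝ] G) (h : HasD f a b p) :
    HasD (fun x => T (f x)) (T a) (T b) p := by
  exact hasD_of_hasFDerivAt ((T.hasFDerivAt.comp p h : HasFDerivAt _ _ p)) (by simp) (by simp)

theorem HasD.smul {r : ℝ × ℝ → ℝ} {f : ℝ × ℝ → F} {s t : ℝ} {a b : F} {p : ℝ × ℝ}
    (k : HasD r s t p) (h : HasD f a b p) :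
    HasD (fun x => r x • f x) (r p • a + s • f p) (r p • b + t • f p) p := by
  exact hasD_of_hasFDerivAt (HasFDerivAt.smul k h) (by simp) (by simp)

theorem HasD.mul {A : Type*} [NormedRing A] [NormedAlgebra ℝ A] {f g : ℝ × ℝ → A}
    {a b c d : A} {p : ℝ × ℝ} (h : HasD f a b p) (k : HasD g c d p) :
    HasD (fun x => f x * g x) (f p * c + a * g p) (f p * d + b * g p) p := by
  exact hasD_of_hasFDerivAt (HasFDerivAt.mul' h k) (by simp) (by simp)

theorem HasD.inner {H : Type*} [NormedAddCommGroup H] [InnerProductSpace ℝ H]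
    {f g : ℝ × ℝ → H} {a b c d : H} {p : ℝ × ℝ} (h : HasD f a b p) (k : HasD g c d p) :
    HasD (fun x => inner ℝ (f x) (g x)) (inner ℝ (f p) c + inner ℝ a (g p))
      (inner ℝ (f p) d + inner ℝ b (g p)) p := by
  exact hasD_of_hasFDerivAt (HasFDerivAt.inner ℝ h k) (by simp) (by simp)

/-- Chain rule with a function of one real variable. -/
theorem HasD.scomp {r : ℝ × ℝ → ℝ} {s t : ℝ} {p : ℝ × ℝ} {φ : ℝ → F} {φ' : F}
    (hφ : HasDerivAt φ φ' (r p)) (h : HasD r s t p) :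
    HasD (fun x => φ (r x)) (s • φ') (t • φ') p := by
  exact hasD_of_hasFDerivAt ((hφ.hasFDerivAt.comp p h : HasFDerivAt _ _ p)) (by simp) (by simp)

theorem HasD.rcomp {r : ℝ × ℝ → ℝ} {s t : ℝ} {p : ℝ × ℝ} {φ : ℝ → ℝ} {φ' : ℝ}
    (hφ : HasDerivAt φ φ' (r p)) (h : HasD r s t p) :
    HasD (fun x => φ (r x)) (φ' * s) (φ' * t) p :=
  (h.scomp hφ).eq (by simp [mul_comm]) (by simp [mul_comm])

theorem HasD.inv {r : ℝ × ℝ → ℝ} {s t : ℝ} {p : ℝ × ℝ} (h : HasD r s t p) (h0 : r p ≠ 0) :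
    HasD (fun x => (r x)⁻¹) (-s / r p ^ 2) (-t / r p ^ 2) p :=
  (h.rcomp (hasDerivAt_inv h0)).eq (by ring) (by ring)

theorem HasD.div {r k : ℝ × ℝ → ℝ} {s t s' t' : ℝ} {p : ℝ × ℝ} (h : HasD r s t p)
    (h' : HasD k s' t' p) (h0 : k p ≠ 0) :
    HasD (fun x => r x / k x) ((s * k p - r p * s') / k p ^ 2)
      ((t * k p - r p * t') / k p ^ 2) p := by
  simp only [div_eq_mul_inv]
  refine (h.mul (h'.inv h0)).eq ?_ ?_ <;> field_simp <;> ring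

/-- Chain rule for a change of parameters. -/
theorem HasD.comp_param {f : ℝ × ℝ → F} {a b : F} {φ₁ φ₂ : ℝ × ℝ → ℝ} {s t s' t' : ℝ}
    {p : ℝ × ℝ} (h : HasD f a b (φ₁ p, φ₂ p)) (h₁ : HasD φ₁ s t p) (h₂ : HasD φ₂ s' t' p) :
    HasD (fun x => f (φ₁ x, φ₂ x)) (s • a + s' • b) (t • a + t' • b) p := by
  have hφ : HasFDerivAt (fun x => (φ₁ x, φ₂ x)) _ p := HasFDerivAt.prodMk h₁ h₂
  exact hasD_of_hasFDerivAt (HasFDerivAt.comp (g := f) p h hφ) (by simp) (by simp)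

theorem contDiffOn_dU {f : ℝ × ℝ → F} {D : Set (ℝ × ℝ)} (hD : IsOpen D)
    (h : ContDiffOn ℝ ∞ f D) : ContDiffOn ℝ ∞ (dU f) D :=
  ((h.fderiv_of_isOpen hD (m := ∞) le_rfl).clm_apply contDiffOn_const :)

theorem contDiffOn_dV {f : ℝ × ℝ → F} {D : Set (ℝ × ℝ)} (hD : IsOpen D)
    (h : ContDiffOn ℝ ∞ f D) : ContDiffOn ℝ ∞ (dV f) D :=
  ((h.fderiv_of_isOpen hD (m := ∞) le_rfl).clm_apply contDiffOn_const :)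

theorem differentiableAt_of_smooth {f : ℝ × ℝ → F} {D : Set (ℝ × ℝ)} (hD : IsOpen D)
    (h : ContDiffOn ℝ ∞ f D) {p : ℝ × ℝ} (hp : p ∈ D) : DifferentiableAt ℝ f p :=
  (h.contDiffAt (hD.mem_nhds hp)).differentiableAt (by simp)

theorem hasD_of_smooth {f : ℝ × ℝ → F} {D : Set (ℝ × ℝ)} (hD : IsOpen D)
    (h : ContDiffOn ℝ ∞ f D) {p : ℝ × ℝ} (hp : p ∈ D) : HasD f (dU f p) (dV f p) p :=
  hasD_of_differentiableAt (differentiableAt_of_smooth hD h hp)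

theorem dU_dV_comm {f : ℝ × ℝ → F} {D : Set (ℝ × ℝ)} (hD : IsOpen D)
    (h : ContDiffOn ℝ ∞ f D) {p : ℝ × ℝ} (hp : p ∈ D) : dU (dV f) p = dV (dU f) p := by
  have h1 := h.contDiffAt (hD.mem_nhds hp)
  have h2 : DifferentiableAt ℝ (fderiv ℝ f) p :=
    (h1.fderiv_right (m := 1) (by norm_cast)).differentiableAt (by simp)
  have hs := h1.isSymmSndFDerivAt (by simp; norm_cast)
  have e1 : dU (dV f) p = fderiv ℝ (fderiv ℝ f) p (1, 0) (0, 1) := by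
    have := (h2.hasFDerivAt.clm_apply (hasFDerivAt_const ((0, 1) : ℝ × ℝ) p)).fderiv
    change fderiv ℝ (fun q => fderiv ℝ f q (0, 1)) p (1, 0) = _
    rw [this]; simp
  have e2 : dV (dU f) p = fderiv ℝ (fderiv ℝ f) p (0, 1) (1, 0) := by
    have := (h2.hasFDerivAt.clm_apply (hasFDerivAt_const ((1, 0) : ℝ × ℝ) p)).fderiv
    change fderiv ℝ (fun q => fderiv ℝ f q (1, 0)) p (0, 1) = _
    rw [this]; simp
  rw [e1, e2]; exact hs _ _

theorem dU_congr {f g : ℝ × ℝ → F} {D : Set (ℝ × ℝ)} (hD : IsOpen D)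
    (h : ∀ x ∈ D, f x = g x) {p : ℝ × ℝ} (hp : p ∈ D) : dU f p = dU g p := by
  unfold dU
  rw [(Filter.eventuallyEq_of_mem (hD.mem_nhds hp) h).fderiv_eq]

theorem dV_congr {f g : ℝ × ℝ → F} {D : Set (ℝ × ℝ)} (hD : IsOpen D)
    (h : ∀ x ∈ D, f x = g x) {p : ℝ × ℝ} (hp : p ∈ D) : dV f p = dV g p := by
  unfold dV
  rw [(Filter.eventuallyEq_of_mem (hD.mem_nhds hp) h).fderiv_eq]

/-- A function whose partial derivatives are `C^n` is `C^(n+1)`. -/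
theorem contDiffOn_succ_of_hasD {f a b : ℝ × ℝ → F} {D : Set (ℝ × ℝ)} (hD : IsOpen D) {n : ℕ}
    (h : ∀ p ∈ D, HasD f (a p) (b p) p) (ha : ContDiffOn ℝ n a D) (hb : ContDiffOn ℝ n b D) :
    ContDiffOn ℝ (n + 1 : ℕ) f D := by
  push_cast
  rw [contDiffOn_succ_iff_fderiv_of_isOpen hD]
  refine ⟨fun p hp => (h p hp).differentiableAt.differentiableWithinAt, by simp, ?_⟩
  have : ∀ p ∈ D, fderiv ℝ f p = (ContinuousLinearMap.fst ℝ ℝ ℝ).smulRight (a p) +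
    (ContinuousLinearMap.snd ℝ ℝ ℝ).smulRight (b p) := fun p hp => HasFDerivAt.fderiv (h p hp)
  exact ((contDiffOn_const.smulRight ha).add (contDiffOn_const.smulRight hb)).congr this

theorem contDiffOn_of_hasD {f a b : ℝ × ℝ → F} {D : Set (ℝ × ℝ)} (hD : IsOpen D)
    (h : ∀ p ∈ D, HasD f (a p) (b p) p) (ha : ContDiffOn ℝ ∞ a D) (hb : ContDiffOn ℝ ∞ b D) :
    ContDiffOn ℝ ∞ f D := by
  refine contDiffOn_infty.2 fun n => ?_
  refine (contDiffOn_succ_of_hasD hD h (ha.of_le (m := n) ?_) (hb.of_le (m := n) ?_)).of_le ?_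
  all_goals norm_cast
  all_goals first | exact le_top | simp

/-- A function with vanishing partial derivatives on a connected open set is constant. -/
theorem eq_of_hasD_zero {f : ℝ × ℝ → F} {D : Set (ℝ × ℝ)} (hD : IsOpen D)
    (hc : IsPreconnected D) (h : ∀ p ∈ D, HasD f 0 0 p) {p q : ℝ × ℝ} (hp : p ∈ D) (hq : q ∈ D) :
    f p = f q := by
  refine hD.is_const_of_fderiv_eq_zero hc
    (fun x hx => (h x hx).differentiableAt.differentiableWithinAt) (fun x hx => ?_) hp hq
  rw [HasFDerivAt.fderiv (h x hx)]
  ext <;> simp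

end Calculus

/-! ### Orthonormal frames -/

theorem inner_E3 (a b : E3) : inner ℝ a b = a 0 * b 0 + a 1 * b 1 + a 2 * b 2 := by
  simp [PiLp.inner_apply, Fin.sum_univ_three, mul_comm]

theorem inner_cross_left (a b : E3) : inner ℝ a (cross a b) = 0 := by
  simp [inner_E3, cross]; ring

theorem inner_cross_right (a b : E3) : inner ℝ b (cross a b) = 0 := by
  simp [inner_E3, cross]; ring

theorem inner_cross_cross (a b : E3) :
    inner ℝ (cross a b) (cross a b) = inner ℝ a a * inner ℝ b b - inner ℝ a b ^ 2 := by
  simp only [inner_E3]; simp [cross]; ring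

theorem cross_smul_smul (s t : ℝ) (a b : E3) : cross (s • a) (t • b) = (s * t) • cross a b := by
  ext i; fin_cases i <;> simp [cross] <;> ring

theorem cross_swap (a b : E3) : cross b a = -cross a b := by
  ext i; fin_cases i <;> simp [cross] <;> ring

/-- `x`, `y`, `l` form an orthonormal frame. -/
structure IsFrame (x y l : E3) : Prop where
  xx : inner ℝ x x = 1
  yy : inner ℝ y y = 1
  ll : inner ℝ l l = 1
  xy : inner ℝ x y = 0
  xl : inner ℝ x l = 0
  yl : inner ℝ y l = 0

namespace IsFrame
variable {x y l : E3}

theorem orthonormal (h : IsFrame x y l) : Orthonormal ℝ ![x, y, l] := by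
  have n : ∀ v : E3, inner ℝ v v = 1 → ‖v‖ = 1 := fun v hv => by
    rw [real_inner_self_eq_norm_sq] at hv
    nlinarith [norm_nonneg v]
  refine ⟨fun i => ?_, fun i j hij => ?_⟩
  · fin_cases i
    exacts [n _ h.xx, n _ h.yy, n _ h.ll]
  · fin_cases i <;> fin_cases j <;>
      simp [h.xy, h.xl, h.yl, real_inner_comm x, real_inner_comm y] at hij ⊢

/-- The orthonormal basis given by a frame. -/
def basis (h : IsFrame x y l) : OrthonormalBasis (Fin 3) ℝ E3 :=
  (basisOfOrthonormalOfCardEqFinrank h.orthonormal (by simp)).toOrthonormalBasis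
    (by simpa using h.orthonormal)

theorem basis_coe (h : IsFrame x y l) : ⇑h.basis = ![x, y, l] := by
  simp [basis]

theorem expand (h : IsFrame x y l) (a : E3) :
    a = (inner ℝ x a : ℝ) • x + (inner ℝ y a : ℝ) • y + (inner ℝ l a : ℝ) • l := by
  have := h.basis.sum_repr' a
  rw [h.basis_coe, Fin.sum_univ_three] at this
  exact this.symm

theorem eq_of_inner (h : IsFrame x y l) {a : E3} {s t r : ℝ} (h1 : inner ℝ x a = s)
    (h2 : inner ℝ y a = t) (h3 : inner ℝ l a = r) : a = s • x + t • y + r • l := by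
  rw [h.expand a, h1, h2, h3]

end IsFrame

/-! ### The moving frame of a principal surface -/

theorem contDiffOn_cross {a b : ℝ × ℝ → E3} {D : Set (ℝ × ℝ)} (ha : ContDiffOn ℝ ∞ a D)
    (hb : ContDiffOn ℝ ∞ b D) : ContDiffOn ℝ ∞ (fun p => cross (a p) (b p)) D := by
  have ha' := contDiffOn_euclidean.1 ha
  have hb' := contDiffOn_euclidean.1 hb
  refine contDiffOn_euclidean.2 fun i => ?_
  fin_cases i
  exacts [((ha' 1).mul (hb' 2)).sub ((ha' 2).mul (hb' 1)),
    ((ha' 2).mul (hb' 0)).sub ((ha' 0).mul (hb' 2)),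
    ((ha' 0).mul (hb' 1)).sub ((ha' 1).mul (hb' 0))]

/-- The lengths of the coordinate vectors and the corresponding unit vectors. -/
def lenU (z : ℝ × ℝ → E3) (p : ℝ × ℝ) : ℝ := Real.sqrt (coefE z p)
def lenV (z : ℝ × ℝ → E3) (p : ℝ × ℝ) : ℝ := Real.sqrt (coefG z p)
def unitU (z : ℝ × ℝ → E3) (p : ℝ × ℝ) : E3 := (lenU z p)⁻¹ • dU z p
def unitV (z : ℝ × ℝ → E3) (p : ℝ × ℝ) : E3 := (lenV z p)⁻¹ • dV z p

namespace IsRegularSurface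
variable {z : ℝ × ℝ → E3} {D : Set (ℝ × ℝ)} (h : IsRegularSurface z D)
include h

theorem coefE_pos {p : ℝ × ℝ} (hp : p ∈ D) : 0 < coefE z p :=
  real_inner_self_pos.2 (by simpa using (h.regular p hp).ne_zero 0)

theorem coefG_pos {p : ℝ × ℝ} (hp : p ∈ D) : 0 < coefG z p :=
  real_inner_self_pos.2 (by simpa using (h.regular p hp).ne_zero 1)

theorem lenU_pos {p : ℝ × ℝ} (hp : p ∈ D) : 0 < lenU z p := Real.sqrt_pos.2 (h.coefE_pos hp)

theorem lenV_pos {p : ℝ × ℝ} (hp : p ∈ D) : 0 < lenV z p := Real.sqrt_pos.2 (h.coefG_pos hp)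

theorem lenU_sq {p : ℝ × ℝ} (hp : p ∈ D) : lenU z p ^ 2 = coefE z p :=
  Real.sq_sqrt (h.coefE_pos hp).le

theorem lenV_sq {p : ℝ × ℝ} (hp : p ∈ D) : lenV z p ^ 2 = coefG z p :=
  Real.sq_sqrt (h.coefG_pos hp).le

theorem dU_eq {p : ℝ × ℝ} (hp : p ∈ D) : dU z p = lenU z p • unitU z p := by
  rw [unitU, smul_smul, mul_inv_cancel₀ (h.lenU_pos hp).ne', one_smul]

theorem dV_eq {p : ℝ × ℝ} (hp : p ∈ D) : dV z p = lenV z p • unitV z p := by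
  rw [unitV, smul_smul, mul_inv_cancel₀ (h.lenV_pos hp).ne', one_smul]

theorem smooth_dU : ContDiffOn ℝ ∞ (dU z) D := contDiffOn_dU h.isOpen h.smooth
theorem smooth_dV : ContDiffOn ℝ ∞ (dV z) D := contDiffOn_dV h.isOpen h.smooth
theorem smooth_coefE : ContDiffOn ℝ ∞ (coefE z) D := h.smooth_dU.inner ℝ h.smooth_dU
theorem smooth_coefG : ContDiffOn ℝ ∞ (coefG z) D := h.smooth_dV.inner ℝ h.smooth_dV
theorem smooth_lenU : ContDiffOn ℝ ∞ (lenU z) D :=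
  h.smooth_coefE.sqrt fun _ hp => (h.coefE_pos hp).ne'
theorem smooth_lenV : ContDiffOn ℝ ∞ (lenV z) D :=
  h.smooth_coefG.sqrt fun _ hp => (h.coefG_pos hp).ne'
theorem smooth_unitU : ContDiffOn ℝ ∞ (unitU z) D :=
  (h.smooth_lenU.inv fun _ hp => (h.lenU_pos hp).ne').smul h.smooth_dU
theorem smooth_unitV : ContDiffOn ℝ ∞ (unitV z) D :=
  (h.smooth_lenV.inv fun _ hp => (h.lenV_pos hp).ne').smul h.smooth_dV

theorem cross_ne_zero {p : ℝ × ℝ} (hp : p ∈ D) : cross (dU z p) (dV z p) ≠ 0 := by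
  intro h0
  have h1 := inner_cross_cross (dU z p) (dV z p)
  rw [h0, inner_zero_left] at h1
  -- The vector `E z_v - F z_u` has squared norm `E (E G - F²)`, which vanishes with the cross
  -- product.
  have h2 : (inner ℝ (dU z p) (dU z p) : ℝ) • dV z p - (inner ℝ (dU z p) (dV z p) : ℝ) • dU z p
      = 0 := by
    refine inner_self_eq_zero (𝕜 := ℝ).1 ?_
    simp only [inner_sub_left, inner_sub_right, real_inner_smul_left, real_inner_smul_right,
      real_inner_comm (dU z p) (dV z p)]
    linear_combination (-inner ℝ (dU z p) (dU z p)) * h1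
  have h3 := LinearIndependent.pair_iff.1 (h.regular p hp) (-inner ℝ (dU z p) (dV z p))
    (inner ℝ (dU z p) (dU z p)) (by rw [← h2]; module)
  exact (h.coefE_pos hp).ne' h3.2

theorem smooth_normal : ContDiffOn ℝ ∞ (normal z) D := by
  have hc := contDiffOn_cross h.smooth_dU h.smooth_dV
  exact ((hc.norm ℝ fun p hp => h.cross_ne_zero hp).inv
    fun p hp => norm_ne_zero_iff.2 (h.cross_ne_zero hp)).smul hc

end IsRegularSurface

namespace IsPrincipalSurface
variable {z : ℝ × ℝ → E3} {D : Set (ℝ × ℝ)} (h : IsPrincipalSurface z D)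
include h

theorem isFrame {p : ℝ × ℝ} (hp : p ∈ D) : IsFrame (unitU z p) (unitV z p) (normal z p) := by
  have e0 := h.lenU_pos hp
  have g0 := h.lenV_pos hp
  have n0 : ‖cross (dU z p) (dV z p)‖ ≠ 0 := norm_ne_zero_iff.2 (h.cross_ne_zero hp)
  have F0 := h.orthogonal p hp
  have E1 := h.lenU_sq hp
  have G1 := h.lenV_sq hp
  unfold coefE at E1; unfold coefG at G1; unfold coefF at F0
  constructor
  · simp only [unitU, real_inner_smul_left, real_inner_smul_right, ← E1]; field_simp
  · simp only [unitV, real_inner_smul_left, real_inner_smul_right, ← G1]; field_simp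
  · rw [real_inner_self_eq_norm_sq, normal, norm_smul, norm_inv, norm_norm]
    field_simp
  · simp only [unitU, unitV, real_inner_smul_left, real_inner_smul_right, F0]; simp
  · simp only [unitU, normal, real_inner_smul_left, real_inner_smul_right, inner_cross_left]; simp
  · simp only [unitV, normal, real_inner_smul_left, real_inner_smul_right, inner_cross_right]; simp

theorem normal_eq {p : ℝ × ℝ} (hp : p ∈ D) : normal z p = cross (unitU z p) (unitV z p) := by
  have e0 := h.lenU_pos hp
  have g0 := h.lenV_pos hp
  have h1 := inner_cross_cross (dU z p) (dV z p)
  have F0 := h.orthogonal p hp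
  have E1 := h.lenU_sq hp
  have G1 := h.lenV_sq hp
  unfold coefE at E1; unfold coefG at G1; unfold coefF at F0
  rw [F0, ← E1, ← G1, real_inner_self_eq_norm_sq] at h1
  have h2 : ‖cross (dU z p) (dV z p)‖ = lenU z p * lenV z p := by
    refine (sq_eq_sq₀ (norm_nonneg _) (by positivity)).1 ?_
    rw [h1]; ring
  rw [normal, h2, unitU, unitV, cross_smul_smul, mul_inv]

/-- The structure equations of the moving frame. -/
theorem structure_equations {p : ℝ × ℝ} (hp : p ∈ D) :
    HasD (unitU z)
      (-(dV (lenU z) p / lenV z p) • unitV z p + (coefL z p / lenU z p) • normal z p)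
      ((dU (lenV z) p / lenU z p) • unitV z p) p ∧
    HasD (unitV z) ((dV (lenU z) p / lenV z p) • unitU z p)
      (-(dU (lenV z) p / lenU z p) • unitU z p + (coefN z p / lenV z p) • normal z p) p ∧
    HasD (normal z) (-(coefL z p / lenU z p) • unitU z p) (-(coefN z p / lenV z p) • unitV z p)
      p := by
  have hD := h.isOpen
  have e0 := (h.lenU_pos hp).ne'
  have g0 := (h.lenV_pos hp).ne'
  have fr := h.isFrame hp
  have hzu := hasD_of_smooth hD h.smooth_dU hp
  have hzv := hasD_of_smooth hD h.smooth_dV hp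
  rw [dU_dV_comm hD h.smooth hp] at hzv
  have he := hasD_of_smooth hD h.smooth_lenU hp
  have hg := hasD_of_smooth hD h.smooth_lenV hp
  have hx := hasD_of_smooth hD h.smooth_unitU hp
  have hy := hasD_of_smooth hD h.smooth_unitV hp
  have hl := hasD_of_smooth hD h.smooth_normal hp
  -- second derivatives of the surface in terms of the frame
  have hzu' := (he.smul hx).congr hD hp fun q hq => h.dU_eq hq
  have hzv' := (hg.smul hy).congr hD hp fun q hq => h.dV_eq hq
  have uu := hzu.dU_eq.symm.trans hzu'.dU_eq
  have uv := hzu.dV_eq.symm.trans hzu'.dV_eq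
  have vu := hzv.dU_eq.symm.trans hzv'.dU_eq
  have vv := hzv.dV_eq.symm.trans hzv'.dV_eq
  -- derivatives of the orthonormality relations
  have key : ∀ {a b : ℝ × ℝ → E3} {c : ℝ} {a₁ a₂ b₁ b₂ : E3}, HasD a a₁ a₂ p → HasD b b₁ b₂ p →
      (∀ q ∈ D, inner ℝ (a q) (b q) = c) →
      inner ℝ (a p) b₁ + inner ℝ (b p) a₁ = (0 : ℝ) ∧
      inner ℝ (a p) b₂ + inner ℝ (b p) a₂ = (0 : ℝ) := by
    intro a b c a₁ a₂ b₁ b₂ ha hb hc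
    have h1 := (hasD_const c p).congr hD hp hc
    have h2 := ha.inner hb
    rw [real_inner_comm a₁, real_inner_comm a₂]
    exact ⟨h2.dU_eq.symm.trans h1.dU_eq, h2.dV_eq.symm.trans h1.dV_eq⟩
  obtain ⟨xx1, xx2⟩ := key hx hx fun q hq => (h.isFrame hq).xx
  obtain ⟨yy1, yy2⟩ := key hy hy fun q hq => (h.isFrame hq).yy
  obtain ⟨ll1, ll2⟩ := key hl hl fun q hq => (h.isFrame hq).ll
  obtain ⟨xy1, xy2⟩ := key hx hy fun q hq => (h.isFrame hq).xy
  obtain ⟨xl1, xl2⟩ := key hx hl fun q hq => (h.isFrame hq).xl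
  obtain ⟨yl1, yl2⟩ := key hy hl fun q hq => (h.isFrame hq).yl
  have yx := (real_inner_comm (unitU z p) (unitV z p)).trans fr.xy
  have lx := (real_inner_comm (unitU z p) (normal z p)).trans fr.xl
  have ly := (real_inner_comm (unitV z p) (normal z p)).trans fr.yl
  have hL : coefL z p = lenU z p * inner ℝ (normal z p) (dU (unitU z) p) := by
    rw [coefL, real_inner_comm, uu]
    simp only [inner_add_right, real_inner_smul_right, lx]; ring
  have hN : coefN z p = lenV z p * inner ℝ (normal z p) (dV (unitV z) p) := by
    rw [coefN, real_inner_comm, vv]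
    simp only [inner_add_right, real_inner_smul_right, ly]; ring
  have hM := h.conjugate p hp
  rw [coefM, real_inner_comm, dU_dV_comm hD h.smooth hp] at hM
  have hM1 := hM
  rw [uv] at hM1
  rw [vu] at hM
  simp only [inner_add_right, real_inner_smul_right, lx, ly, mul_zero, add_zero, mul_eq_zero, e0, g0, false_or] at hM hM1
  -- The two expressions of the mixed derivative of `z` in the frame give the tangential connection
  -- coefficients.
  have mixed := uv.symm.trans vu
  have m1 := congrArg (fun a => (inner ℝ (unitU z p) a : ℝ)) mixed
  have m2 := congrArg (fun a => (inner ℝ (unitV z p) a : ℝ)) mixed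
  simp only [inner_add_right, real_inner_smul_right, fr.xx, fr.xy, fr.yy, yx] at m1 m2
  have L' : inner ℝ (normal z p) (dU (unitU z) p) = coefL z p / lenU z p := by
    rw [hL]; field_simp
  have N' : inner ℝ (normal z p) (dV (unitV z) p) = coefN z p / lenV z p := by
    rw [hN]; field_simp
  have a1 : inner ℝ (unitU z p) (dU (unitV z) p) = dV (lenU z) p / lenV z p := by
    rw [eq_div_iff g0]; linear_combination lenU z p / 2 * xx2 - m1
  have a2 : inner ℝ (unitV z p) (dV (unitU z) p) = dU (lenV z) p / lenU z p := by
    rw [eq_div_iff e0]; linear_combination m2 + lenV z p / 2 * yy1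
  refine ⟨hx.eq ?_ ?_, hy.eq ?_ ?_, hl.eq ?_ ?_⟩
  · rw [fr.eq_of_inner (a := dU (unitU z) p) (s := 0)
      (t := -(dV (lenU z) p / lenV z p)) (by linarith) (by linarith) L']
    simp
  · rw [fr.eq_of_inner (a := dV (unitU z) p) (s := 0) (r := 0) (by linarith) a2 hM1]
    simp
  · rw [fr.eq_of_inner (a := dU (unitV z) p) (t := 0) (r := 0) a1 (by linarith) hM]
    simp
  · rw [fr.eq_of_inner (a := dV (unitV z) p) (s := -(dU (lenV z) p / lenU z p)) (t := 0)
      (by linarith) (by linarith) N']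
    simp
  · rw [fr.eq_of_inner (a := dU (normal z) p) (s := -(coefL z p / lenU z p)) (t := 0) (r := 0)
      (by linarith) (by linarith) (by linarith)]
    simp
  · rw [fr.eq_of_inner (a := dV (normal z) p) (s := 0) (t := -(coefN z p / lenV z p)) (r := 0)
      (by linarith) (by linarith) (by linarith)]
    simp

theorem smooth_coefL : ContDiffOn ℝ ∞ (coefL z) D :=
  (contDiffOn_dU h.isOpen h.smooth_dU).inner ℝ h.smooth_normal

theorem smooth_coefN : ContDiffOn ℝ ∞ (coefN z) D :=
  (contDiffOn_dV h.isOpen h.smooth_dV).inner ℝ h.smooth_normal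

/-- The Codazzi equations and the Gauss equation. -/
theorem codazzi_gauss {p : ℝ × ℝ} (hp : p ∈ D) :
    dV (fun q => coefL z q / lenU z q) p = dV (lenU z) p / lenV z p * (coefN z p / lenV z p) ∧
    dU (fun q => coefN z q / lenV z q) p = dU (lenV z) p / lenU z p * (coefL z p / lenU z p) ∧
    dV (fun q => dV (lenU z) q / lenV z q) p + dU (fun q => dU (lenV z) q / lenU z q) p =
      -(coefL z p / lenU z p * (coefN z p / lenV z p)) := by
  have hD := h.isOpen
  have e0 : ∀ q ∈ D, lenU z q ≠ 0 := fun q hq => (h.lenU_pos hq).ne'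
  have g0 : ∀ q ∈ D, lenV z q ≠ 0 := fun q hq => (h.lenV_pos hq).ne'
  have fr := h.isFrame hp
  have hP := hasD_of_smooth (f := fun q => coefL z q / lenU z q) hD (h.smooth_coefL.div h.smooth_lenU e0) hp
  have hQ := hasD_of_smooth (f := fun q => coefN z q / lenV z q) hD (h.smooth_coefN.div h.smooth_lenV g0) hp
  have hs := hasD_of_smooth (f := fun q => dV (lenU z) q / lenV z q) hD
    ((contDiffOn_dV hD h.smooth_lenU).div h.smooth_lenV g0) hp
  have ht := hasD_of_smooth (f := fun q => dU (lenV z) q / lenU z q) hD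
    ((contDiffOn_dU hD h.smooth_lenV).div h.smooth_lenU e0) hp
  obtain ⟨hx, hy, hl⟩ := h.structure_equations hp
  have yx := (real_inner_comm (unitU z p) (unitV z p)).trans fr.xy
  have lx := (real_inner_comm (unitU z p) (normal z p)).trans fr.xl
  have ly := (real_inner_comm (unitV z p) (normal z p)).trans fr.yl
  have lu := (hP.neg.smul hx).congr hD hp fun q hq => (h.structure_equations hq).2.2.dU_eq
  have lv := (hQ.neg.smul hy).congr hD hp fun q hq => (h.structure_equations hq).2.2.dV_eq
  have xu := ((hs.neg.smul hy).add (hP.smul hl)).congr hD hp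
    fun q hq => (h.structure_equations hq).1.dU_eq
  have xv := (ht.smul hy).congr hD hp fun q hq => (h.structure_equations hq).1.dV_eq
  -- Symmetry of the mixed derivatives of the normal yields the Codazzi equations. For the first
  -- frame vector, the component along the second one yields the Gauss equation.
  have ll := lv.dU_eq.symm.trans ((dU_dV_comm hD h.smooth_normal hp).trans lu.dV_eq)
  have xx := xv.dU_eq.symm.trans ((dU_dV_comm hD h.smooth_unitU hp).trans xu.dV_eq)
  have c1 := congrArg (fun a => (inner ℝ (unitU z p) a : ℝ)) ll
  have c2 := congrArg (fun a => (inner ℝ (unitV z p) a : ℝ)) ll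
  have c3 := congrArg (fun a => (inner ℝ (unitV z p) a : ℝ)) xx
  simp only [inner_add_right, real_inner_smul_right, fr.xx, fr.xy, fr.yy, fr.yl, yx] at c1 c2 c3
  refine ⟨by linarith, by linarith, by linarith⟩

end IsPrincipalSurface

/-! ### Curvatures in principal parameters -/

namespace IsPrincipalSurface
variable {z : ℝ × ℝ → E3} {D : Set (ℝ × ℝ)} (h : IsPrincipalSurface z D)
include h

theorem curvK_eq {p : ℝ × ℝ} (hp : p ∈ D) :
    curvK z p = coefL z p / coefE z p * (coefN z p / coefG z p) := by
  have := (h.coefE_pos hp).ne'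
  have := (h.coefG_pos hp).ne'
  rw [curvK, h.orthogonal p hp, h.conjugate p hp]
  simp only [ne_eq, OfNat.ofNat_ne_zero, not_false_eq_true, zero_pow, sub_zero]
  field_simp

theorem curvH_eq {p : ℝ × ℝ} (hp : p ∈ D) :
    curvH z p = (coefL z p / coefE z p + coefN z p / coefG z p) / 2 := by
  have := (h.coefE_pos hp).ne'
  have := (h.coefG_pos hp).ne'
  rw [curvH, h.orthogonal p hp, h.conjugate p hp]
  simp only [ne_eq, OfNat.ofNat_ne_zero, not_false_eq_true, zero_pow, sub_zero, mul_zero]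
  field_simp
  ring

theorem curvH'_eq {p : ℝ × ℝ} (hp : p ∈ D) :
    curvH' z p = |coefL z p / coefE z p - coefN z p / coefG z p| / 2 := by
  rw [curvH', h.curvH_eq hp, h.curvK_eq hp, ← Real.sqrt_sq_eq_abs, ← abs_two,
    ← Real.sqrt_sq_eq_abs, ← Real.sqrt_div (sq_nonneg _)]
  congr 1
  ring

theorem nu_ne {p : ℝ × ℝ} (hp : p ∈ D) : coefL z p / coefE z p ≠ coefN z p / coefG z p := by
  intro hn
  refine h.noUmbilic p hp ⟨coefL z p / coefE z p, ?_, ?_, ?_⟩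
  · rw [div_mul_cancel₀ _ (h.coefE_pos hp).ne']
  · rw [h.orthogonal p hp, h.conjugate p hp, mul_zero]
  · rw [hn, div_mul_cancel₀ _ (h.coefG_pos hp).ne']

theorem coefL_div_lenU {p : ℝ × ℝ} (hp : p ∈ D) :
    coefL z p / lenU z p = coefL z p / coefE z p * lenU z p := by
  have := (h.lenU_pos hp).ne'
  rw [← h.lenU_sq hp]; field_simp

theorem coefN_div_lenV {p : ℝ × ℝ} (hp : p ∈ D) :
    coefN z p / lenV z p = coefN z p / coefG z p * lenV z p := by
  have := (h.lenV_pos hp).ne'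
  rw [← h.lenV_sq hp]; field_simp

end IsPrincipalSurface

/-! ### Weingarten functions and their integrals -/

theorem hasDerivAt_integral_of_continuousOn {k : ℝ → ℝ} {J : Set ℝ} (hJ : IsOpen J)
    (hk : ContinuousOn k J) {t₀ t : ℝ} (ht : Set.uIcc t₀ t ⊆ J) :
    HasDerivAt (fun x => ∫ s in t₀..x, k s) (k t) t := by
  have htJ : t ∈ J := ht Set.right_mem_uIcc
  exact intervalIntegral.integral_hasDerivAt_right (hk.mono ht).intervalIntegrable
    (hk.stronglyMeasurableAtFilter hJ t htJ) (hk.continuousAt (hJ.mem_nhds htJ))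

namespace IsWeingartenPair
variable {f g : ℝ → ℝ} {J : Set ℝ} (h : IsWeingartenPair f g J) (hJ : IsOpen J)
include h hJ

theorem hasDerivAt_f {t : ℝ} (ht : t ∈ J) : HasDerivAt f (deriv f t) t :=
  ((h.smooth_f.contDiffAt (hJ.mem_nhds ht)).differentiableAt (by simp)).hasDerivAt

theorem hasDerivAt_g {t : ℝ} (ht : t ∈ J) : HasDerivAt g (deriv g t) t :=
  ((h.smooth_g.contDiffAt (hJ.mem_nhds ht)).differentiableAt (by simp)).hasDerivAt

theorem smooth_deriv_f : ContDiffOn ℝ ∞ (deriv f) J := h.smooth_f.deriv_of_isOpen hJ le_rfl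

theorem smooth_deriv_g : ContDiffOn ℝ ∞ (deriv g) J := h.smooth_g.deriv_of_isOpen hJ le_rfl

theorem hasDerivAt_deriv_f {t : ℝ} (ht : t ∈ J) : HasDerivAt (deriv f) (deriv (deriv f) t) t :=
  (((h.smooth_deriv_f hJ).contDiffAt (hJ.mem_nhds ht)).differentiableAt (by simp)).hasDerivAt

theorem hasDerivAt_deriv_g {t : ℝ} (ht : t ∈ J) : HasDerivAt (deriv g) (deriv (deriv g) t) t :=
  (((h.smooth_deriv_g hJ).contDiffAt (hJ.mem_nhds ht)).differentiableAt (by simp)).hasDerivAt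

theorem smooth_integrand_f : ContDiffOn ℝ ∞ (fun s => deriv f s / (f s - g s)) J :=
  (h.smooth_deriv_f hJ).div (h.smooth_f.sub h.smooth_g) fun t ht => (sub_pos.2 (h.lt t ht)).ne'

theorem smooth_integrand_g : ContDiffOn ℝ ∞ (fun s => deriv g s / (g s - f s)) J :=
  (h.smooth_deriv_g hJ).div (h.smooth_g.sub h.smooth_f) fun t ht => (sub_neg.2 (h.lt t ht)).ne

theorem hasDerivAt_wInt_f {t₀ t : ℝ} (ht : Set.uIcc t₀ t ⊆ J) :
    HasDerivAt (wInt f g t₀) (deriv f t / (f t - g t)) t :=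
  hasDerivAt_integral_of_continuousOn hJ (h.smooth_integrand_f hJ).continuousOn ht

theorem hasDerivAt_wInt_g {t₀ t : ℝ} (ht : Set.uIcc t₀ t ⊆ J) :
    HasDerivAt (wInt g f t₀) (deriv g t / (g t - f t)) t :=
  hasDerivAt_integral_of_continuousOn hJ (h.smooth_integrand_g hJ).continuousOn ht

theorem smooth_wInt_f (hc : J.OrdConnected) {t₀ : ℝ} (h₀ : t₀ ∈ J) :
    ContDiffOn ℝ ∞ (wInt f g t₀) J := by
  have hd : ∀ t ∈ J, HasDerivAt (wInt f g t₀) (deriv f t / (f t - g t)) t :=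
    fun t ht => h.hasDerivAt_wInt_f hJ (hc.uIcc_subset h₀ ht)
  refine (contDiffOn_infty_iff_deriv_of_isOpen hJ).2
    ⟨fun t ht => (hd t ht).differentiableAt.differentiableWithinAt, ?_⟩
  exact (h.smooth_integrand_f hJ).congr fun t ht => (hd t ht).deriv

theorem smooth_wInt_g (hc : J.OrdConnected) {t₀ : ℝ} (h₀ : t₀ ∈ J) :
    ContDiffOn ℝ ∞ (wInt g f t₀) J := by
  have hd : ∀ t ∈ J, HasDerivAt (wInt g f t₀) (deriv g t / (g t - f t)) t :=
    fun t ht => h.hasDerivAt_wInt_g hJ (hc.uIcc_subset h₀ ht)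
  refine (contDiffOn_infty_iff_deriv_of_isOpen hJ).2
    ⟨fun t ht => (hd t ht).differentiableAt.differentiableWithinAt, ?_⟩
  exact (h.smooth_integrand_g hJ).congr fun t ht => (hd t ht).deriv

omit hJ in
theorem mono {J' : Set ℝ} (hs : J' ⊆ J) : IsWeingartenPair f g J' :=
  ⟨h.smooth_f.mono hs, h.smooth_g.mono hs, fun t ht => h.lt t (hs ht),
    fun t ht => h.deriv_f t (hs ht), fun t ht => h.deriv_g t (hs ht)⟩

end IsWeingartenPair

theorem wInt_self (f g : ℝ → ℝ) (t : ℝ) : wInt f g t t = 0 := by simp [wInt]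

/-- The lengths of the coordinate vectors prescribed by the naturality of the parameters. -/
def natLen (f g : ℝ → ℝ) (a t₀ t : ℝ) : ℝ := |a|⁻¹ * Real.exp (-wInt f g t₀ t)

theorem natLen_pos (f g : ℝ → ℝ) {a : ℝ} (ha : a ≠ 0) (t₀ t : ℝ) : 0 < natLen f g a t₀ t := by
  have := abs_pos.2 ha
  unfold natLen; positivity

/-- The exponential coefficients of the natural PDE are thus `1/E` and `1/G`, the form in which
Gauss's equation produces them. -/
theorem natLen_sq_inv (f g : ℝ → ℝ) (a t₀ t : ℝ) :
    a ^ 2 * Real.exp (2 * wInt f g t₀ t) = (natLen f g a t₀ t ^ 2)⁻¹ := by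
  rw [natLen, mul_pow, inv_pow, sq_abs, ← Real.exp_nat_mul, mul_inv, inv_inv, ← Real.exp_neg]
  congr 2; push_cast; ring

theorem eq_natLen_iff {f g : ℝ → ℝ} {a t₀ t x : ℝ} :
    x * Real.exp (wInt f g t₀ t) = |a|⁻¹ ↔ x = natLen f g a t₀ t := by
  rw [natLen, Real.exp_neg, ← div_eq_mul_inv, eq_div_iff (Real.exp_pos _).ne']

section NaturalData
variable {f g : ℝ → ℝ} {J : Set ℝ} (h : IsWeingartenPair f g J) (hJ : IsOpen J)
  (hc : J.OrdConnected) {t₀ : ℝ} (h₀ : t₀ ∈ J) {a b : ℝ} (ha : a ≠ 0) (hb : b ≠ 0)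
  {V : Set (ℝ × ℝ)} (hV : IsOpen V) {lam : ℝ × ℝ → ℝ} (hl : ContDiffOn ℝ ∞ lam V)
  (hm : Set.MapsTo lam V J)
include h hJ hc h₀ hV hl hm

theorem hasD_natLen_f (a : ℝ) {p : ℝ × ℝ} (hp : p ∈ V) :
    HasD (fun q => natLen f g a t₀ (lam q))
      (-(natLen f g a t₀ (lam p) * (deriv f (lam p) / (f (lam p) - g (lam p)))) * dU lam p)
      (-(natLen f g a t₀ (lam p) * (deriv f (lam p) / (f (lam p) - g (lam p)))) * dV lam p) p := by
  have h1 := (h.hasDerivAt_wInt_f hJ (hc.uIcc_subset h₀ (hm hp))).neg.exp.const_mul |a|⁻¹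
  exact ((hasD_of_smooth hV hl hp).rcomp h1).eq 
    (by simp only [natLen, Pi.neg_apply]; ring) (by simp only [natLen, Pi.neg_apply]; ring)

theorem hasD_natLen_g (b : ℝ) {p : ℝ × ℝ} (hp : p ∈ V) :
    HasD (fun q => natLen g f b t₀ (lam q))
      (-(natLen g f b t₀ (lam p) * (deriv g (lam p) / (g (lam p) - f (lam p)))) * dU lam p)
      (-(natLen g f b t₀ (lam p) * (deriv g (lam p) / (g (lam p) - f (lam p)))) * dV lam p) p := by
  have h1 := (h.hasDerivAt_wInt_g hJ (hc.uIcc_subset h₀ (hm hp))).neg.exp.const_mul |b|⁻¹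
  exact ((hasD_of_smooth hV hl hp).rcomp h1).eq 
    (by simp only [natLen, Pi.neg_apply]; ring) (by simp only [natLen, Pi.neg_apply]; ring)

omit hV in
theorem smooth_natLen_f (a : ℝ) : ContDiffOn ℝ ∞ (fun q => natLen f g a t₀ (lam q)) V :=
  contDiffOn_const.mul (((h.smooth_wInt_f hJ hc h₀).comp hl hm).neg.exp)

omit hV in
theorem smooth_natLen_g (b : ℝ) : ContDiffOn ℝ ∞ (fun q => natLen g f b t₀ (lam q)) V :=
  contDiffOn_const.mul (((h.smooth_wInt_g hJ hc h₀).comp hl hm).neg.exp)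

include hb in
-- The length `e` has logarithmic derivative `-f'/(f-g)` in `λ`, so `f' λ_v e = -(f - g) e_v`. This
-- is the Codazzi equation.
theorem natural_codazzi_one {p : ℝ × ℝ} (hp : p ∈ V) :
    dV (fun q => f (lam q) * natLen f g a t₀ (lam q)) p =
      dV (fun q => natLen f g a t₀ (lam q)) p / natLen g f b t₀ (lam p) *
        (g (lam p) * natLen g f b t₀ (lam p)) := by
  have hs := sub_pos.2 (h.lt _ (hm hp))
  have hn := (natLen_pos g f hb t₀ (lam p)).ne'
  have h1 := hasD_natLen_f h hJ hc h₀ hV hl hm a hp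
  have h2 := (hasD_of_smooth hV hl hp).rcomp (h.hasDerivAt_f hJ (hm hp))
  rw [h1.dV_eq, (h2.mul h1).dV_eq]
  field_simp
  ring

include ha in
theorem natural_codazzi_two {p : ℝ × ℝ} (hp : p ∈ V) :
    dU (fun q => g (lam q) * natLen g f b t₀ (lam q)) p =
      dU (fun q => natLen g f b t₀ (lam q)) p / natLen f g a t₀ (lam p) *
        (f (lam p) * natLen f g a t₀ (lam p)) := by
  have hs := (sub_neg.2 (h.lt _ (hm hp))).ne
  have hn := (natLen_pos f g ha t₀ (lam p)).ne'
  have h1 := hasD_natLen_g h hJ hc h₀ hV hl hm b hp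
  have h2 := (hasD_of_smooth hV hl hp).rcomp (h.hasDerivAt_g hJ (hm hp))
  rw [h1.dU_eq, (h2.mul h1).dU_eq]
  field_simp
  ring

include ha hb in
/-- In natural principal parameters the Gauss equation is the natural PDE. -/
theorem gauss_iff_naturalPDE {p : ℝ × ℝ} (hp : p ∈ V) :
    dV (fun q => dV (fun q => natLen f g a t₀ (lam q)) q / natLen g f b t₀ (lam q)) p +
      dU (fun q => dU (fun q => natLen g f b t₀ (lam q)) q / natLen f g a t₀ (lam q)) p =
      -(f (lam p) * natLen f g a t₀ (lam p) * (g (lam p) * natLen g f b t₀ (lam p))) ↔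
    NaturalPDE f g a b t₀ lam p := by
  have hs := (sub_pos.2 (h.lt _ (hm hp))).ne'
  have hs' := (sub_neg.2 (h.lt _ (hm hp))).ne
  have ne := (natLen_pos f g ha t₀ (lam p)).ne'
  have ng := (natLen_pos g f hb t₀ (lam p)).ne'
  have hl' := hasD_of_smooth hV hl hp
  have hlu := hasD_of_smooth hV (contDiffOn_dU hV hl) hp
  have hlv := hasD_of_smooth hV (contDiffOn_dV hV hl) hp
  have he := hasD_natLen_f h hJ hc h₀ hV hl hm a hp
  have hg := hasD_natLen_g h hJ hc h₀ hV hl hm b hp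
  have f0 := h.hasDerivAt_f hJ (hm hp)
  have g0 := h.hasDerivAt_g hJ (hm hp)
  have hA := hl'.rcomp ((h.hasDerivAt_deriv_f hJ (hm hp)).fun_div (f0.fun_sub g0) hs)
  have hB := hl'.rcomp ((h.hasDerivAt_deriv_g hJ (hm hp)).fun_div (g0.fun_sub f0) hs')
  have h1 := (((he.mul hA).neg.mul hlv).div hg ng).congr hV hp (g := fun q =>
    dV (fun q => natLen f g a t₀ (lam q)) q / natLen g f b t₀ (lam q)) (fun q hq => by
      rw [(hasD_natLen_f h hJ hc h₀ hV hl hm a hq).dV_eq])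
  have h2 := (((hg.mul hB).neg.mul hlu).div he ne).congr hV hp (g := fun q =>
    dU (fun q => natLen g f b t₀ (lam q)) q / natLen f g a t₀ (lam q)) (fun q hq => by
      rw [(hasD_natLen_g h hJ hc h₀ hV hl hm b hq).dU_eq])
  have key : ∀ {X Y c : ℝ}, c ≠ 0 → X = c * Y → (X = 0 ↔ Y = 0) := fun hc hX => by
    rw [hX, mul_eq_zero_iff_left hc]
  rw [h1.dV_eq, h2.dU_eq, NaturalPDE, natLen_sq_inv, natLen_sq_inv, ← sub_eq_zero]
  generalize natLen f g a t₀ (lam p) = e at *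
  generalize natLen g f b t₀ (lam p) = G at *
  -- The difference of the two sides of the Gauss equation is this factor times the left side of the
  -- natural PDE.
  have hk : -(e * G / (f (lam p) - g (lam p))) ≠ 0 :=
    neg_ne_zero.2 (div_ne_zero (mul_ne_zero ne ng) hs)
  refine key hk ?_
  rw [show g (lam p) - f (lam p) = -(f (lam p) - g (lam p)) by ring]
  generalize hw : f (lam p) - g (lam p) = w at *
  field_simp
  ring

include ha hb in
/-- The geometric function of a surface in natural principal parameters satisfies the natural
PDE. -/
theorem _root_.LinearWeingarten.IsNaturalPatch.naturalPDE {z : ℝ × ℝ → E3}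
    (hz : IsNaturalPatch f g a b t₀ lam z V) {p : ℝ × ℝ} (hp : p ∈ V) :
    NaturalPDE f g a b t₀ lam p := by
  have hz' := hz.toIsPrincipalSurface
  have he : ∀ q ∈ V, lenU z q = natLen f g a t₀ (lam q) :=
    fun q hq => eq_natLen_iff.1 (hz.constE q hq)
  have hg : ∀ q ∈ V, lenV z q = natLen g f b t₀ (lam q) :=
    fun q hq => eq_natLen_iff.1 (hz.constG q hq)
  refine (gauss_iff_naturalPDE h hJ hc h₀ ha hb hV hl hm hp).1 ?_
  have hG := (hz'.codazzi_gauss hp).2.2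
  rw [hz'.coefL_div_lenU hp, hz'.coefN_div_lenV hp, hz.nu_one p hp, hz.nu_two p hp, he p hp,
    hg p hp] at hG
  rw [← hG]
  congr 1
  · refine dV_congr hV (fun q hq => ?_) hp
    rw [hg q hq, dV_congr hV he hq]
  · refine dU_congr hV (fun q hq => ?_) hp
    rw [he q hq, dU_congr hV hg hq]

omit hV in
/-- In principal parameters the quantities entering the definition of natural parameters depend
on one parameter only. -/
theorem _root_.LinearWeingarten.IsPrincipalSurface.natural_const {z : ℝ × ℝ → E3}
    (hz : IsPrincipalSurface z V)
    (hf : ∀ p ∈ V, coefL z p / coefE z p = f (lam p))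
    (hg : ∀ p ∈ V, coefN z p / coefG z p = g (lam p)) {p : ℝ × ℝ} (hp : p ∈ V) :
    dV (fun q => lenU z q * Real.exp (wInt f g t₀ (lam q))) p = 0 ∧
    dU (fun q => lenV z q * Real.exp (wInt g f t₀ (lam q))) p = 0 := by
  have hV := hz.isOpen
  have hs := (sub_pos.2 (h.lt _ (hm hp))).ne'
  have hs' := (sub_neg.2 (h.lt _ (hm hp))).ne
  have hl' := hasD_of_smooth hV hl hp
  have e0 := (hz.lenU_pos hp).ne'
  have g0 := (hz.lenV_pos hp).ne'
  have he := hasD_of_smooth hV hz.smooth_lenU hp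
  have hG := hasD_of_smooth hV hz.smooth_lenV hp
  have hA := hl'.rcomp (h.hasDerivAt_wInt_f hJ (hc.uIcc_subset h₀ (hm hp))).exp
  have hB := hl'.rcomp (h.hasDerivAt_wInt_g hJ (hc.uIcc_subset h₀ (hm hp))).exp
  have h1 := ((hl'.rcomp (h.hasDerivAt_f hJ (hm hp))).mul he).congr hV hp
    (g := fun q => coefL z q / lenU z q) (fun q hq => by rw [hz.coefL_div_lenU hq, hf q hq])
  have h2 := ((hl'.rcomp (h.hasDerivAt_g hJ (hm hp))).mul hG).congr hV hp
    (g := fun q => coefN z q / lenV z q) (fun q hq => by rw [hz.coefN_div_lenV hq, hg q hq])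
  obtain ⟨c1, c2, -⟩ := hz.codazzi_gauss hp
  rw [h1.dV_eq, hz.coefN_div_lenV hp, hg p hp, div_mul_eq_mul_div, eq_div_iff g0] at c1
  rw [h2.dU_eq, hz.coefL_div_lenU hp, hf p hp, div_mul_eq_mul_div, eq_div_iff e0] at c2
  -- What remains of Codazzi is `f' λ_v e + (f - g) e_v = 0`: the logarithmic `v`-derivative of the
  -- product vanishes.
  have c1' := mul_right_cancel₀ g0 (c1.trans (by ring :
    _ = (dV (lenU z) p * g (lam p)) * lenV z p))
  have c2' := mul_right_cancel₀ e0 (c2.trans (by ring :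
    _ = (dU (lenV z) p * f (lam p)) * lenU z p))
  constructor
  · rw [(he.mul hA).dV_eq]
    field_simp
    linear_combination Real.exp (wInt f g t₀ (lam p)) * c1'
  · rw [(hG.mul hB).dU_eq]
    field_simp
    linear_combination Real.exp (wInt g f t₀ (lam p)) * c2'

end NaturalData

/-- Half of `log α` is a primitive of the integrand, so the integral itself never has to be
evaluated case by case. -/
theorem exp_two_wInt {f g α : ℝ → ℝ} {t₀ t : ℝ}
    (hα : ∀ s ∈ Set.uIcc t₀ t, 0 < α s)
    (hd : ∀ s ∈ Set.uIcc t₀ t, HasDerivAt α (2 * (deriv f s / (f s - g s)) * α s) s)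
    (hc : ContinuousOn (fun s => deriv f s / (f s - g s)) (Set.uIcc t₀ t)) :
    Real.exp (2 * wInt f g t₀ t) = α t / α t₀ := by
  have h0 : ∀ s ∈ Set.uIcc t₀ t, HasDerivAt (fun s => Real.log (α s) / 2)
      (deriv f s / (f s - g s)) s := fun s hs => by
    have := (hα s hs).ne'
    refine (((hd s hs).log this).div_const 2).congr_deriv ?_
    field_simp
  have h1 : wInt f g t₀ t = Real.log (α t) / 2 - Real.log (α t₀) / 2 :=
    intervalIntegral.integral_eq_sub_of_hasDerivAt h0 hc.intervalIntegrable
  rw [h1, mul_sub, mul_div_cancel₀ _ two_ne_zero, mul_div_cancel₀ _ two_ne_zero, Real.exp_sub,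
    Real.exp_log (hα t Set.right_mem_uIcc), Real.exp_log (hα t₀ Set.left_mem_uIcc)]

/-! ### Explicit Weingarten functions of the ten classes. -/

namespace BasicClass

/-- The first derivatives of the Weingarten functions of a basic class. -/
def dnu₁ : BasicClass → ℝ → ℝ
  | c1, t => Real.exp t
  | c2, t => Real.exp t / 2
  | c3, _ => 1
  | c4 β, _ => (β + 1) / |β - 1|
  | c5 β, _ => (β + 1) / |β - 1|
  | c6 β, _ => (β + 1) / 2
  | c7 β, _ => (β + 1) / 2
  | c8, t => 1 / (2 * Real.cos (t / 2) ^ 2)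
  | c9, t => 2 / (2 - t) ^ 2
  | c10 _ _, _ => 1

def dnu₂ : BasicClass → ℝ → ℝ
  | c1, t => -Real.exp t
  | c2, t => -Real.exp t / 2
  | c3, _ => 1
  | c4 β, _ => (β - 1) / |β - 1|
  | c5 β, _ => (β - 1) / |β - 1|
  | c6 β, _ => (β - 1) / 2
  | c7 β, _ => (β - 1) / 2
  | c8, t => 1 / (2 * Real.sin (t / 2) ^ 2)
  | c9, t => 2 / (4 - t) ^ 2
  | c10 β γ, t => (β ^ 2 - 4 * γ) / (2 * t + β) ^ 2

/-- The second derivatives of the Weingarten functions of a basic class. -/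
def ddnu₁ : BasicClass → ℝ → ℝ
  | c1, t => Real.exp t
  | c2, t => Real.exp t / 2
  | c8, t => Real.sin (t / 2) / (2 * Real.cos (t / 2) ^ 3)
  | c9, t => 4 / (2 - t) ^ 3
  | _, _ => 0

def ddnu₂ : BasicClass → ℝ → ℝ
  | c1, t => -Real.exp t
  | c2, t => -Real.exp t / 2
  | c8, t => -Real.cos (t / 2) / (2 * Real.sin (t / 2) ^ 3)
  | c9, t => 4 / (4 - t) ^ 3
  | c10 β γ, t => -4 * (β ^ 2 - 4 * γ) / (2 * t + β) ^ 3
  | _, _ => 0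

/-- Positive functions with logarithmic derivatives `2 f' / (f - g)` and `2 g' / (g - f)`. -/
def expA : BasicClass → ℝ → ℝ
  | c1, t => Real.exp t
  | c2, t => Real.exp t
  | c3, t => Real.exp t
  | c4 β, t => t ^ (β + 1)
  | c5 β, t => t ^ (β + 1)
  | c6 β, t => t ^ (β + 1)
  | c7 β, t => t ^ (β + 1)
  | c8, t => 1 / Real.cos (t / 2) ^ 2
  | c9, t => Real.exp t / (2 - t) ^ 2
  | c10 β γ, t => (t ^ 2 - γ) * Real.exp (β * arcI γ t)

def expB : BasicClass → ℝ → ℝ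
  | c1, t => Real.exp t
  | c2, t => Real.exp t
  | c3, t => Real.exp (-t)
  | c4 β, t => t ^ (1 - β)
  | c5 β, t => t ^ (1 - β)
  | c6 β, t => t ^ (1 - β)
  | c7 β, t => t ^ (1 - β)
  | c8, t => 1 / Real.sin (t / 2) ^ 2
  | c9, t => Real.exp (-t) / (4 - t) ^ 2
  | c10 β γ, t => (t ^ 2 - γ) / (2 * t + β) ^ 2 * Real.exp (-(β * arcI γ t))

/-- The constant factors of the normalizing constants. -/
def facA : BasicClass → ℝ
  | c1 => 2
  | c9 => 4
  | c10 β γ => -4 / γ / (β ^ 2 - 4 * γ)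
  | _ => 1

/-- The two factors adjust the ratio of `facB * expB * dnu₁` to `facA * expA * dnu₂`, the
coefficients of `λ_vv` and `λ_uu`, and their size against `f g (f - g)`. In classes 4 to 7 the ratio
`|β - 1| / |β + 1|` cancels the slopes of `nu₁` and `nu₂` up to sign. In class 10 the extra `β² -
4γ` in `facA` cancels the numerator of `dnu₂`. -/
def facB : BasicClass → ℝ
  | c1 => 2
  | c4 β => |β - 1| / |β + 1|
  | c5 β => |β - 1| / |β + 1|
  | c6 β => |β - 1| / |β + 1|
  | c7 β => |β - 1| / |β + 1|
  | c9 => 4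
  | c10 _ γ => -4 / γ
  | _ => 1

theorem isOpen_range (C : BasicClass) : IsOpen C.range := by
  cases C <;> simp only [range]
  case c8 => exact isOpen_Ioo
  case c9 => exact isOpen_Iio.union isOpen_Ioi
  case c10 β γ => exact isOpen_lt continuous_const (by fun_prop)
  all_goals first | exact isOpen_univ | exact isOpen_Ioi

theorem arcI_hasDerivAt {γ : ℝ} (hγ : γ < 0) (t : ℝ) :
    HasDerivAt (arcI γ) (1 / (t ^ 2 - γ)) t := by
  have h0 : 0 < Real.sqrt (-γ) := Real.sqrt_pos.2 (by linarith)
  have h2 : Real.sqrt (-γ) ^ 2 = -γ := Real.sq_sqrt (by linarith)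
  have h1 := (((hasDerivAt_id' t).div_const (Real.sqrt (-γ))).arctan).const_mul
    (1 / Real.sqrt (-γ))
  refine h1.congr_deriv ?_
  have h3 : t ^ 2 - γ ≠ 0 := by nlinarith
  rw [show t ^ 2 - γ = Real.sqrt (-γ) ^ 2 * (1 + (t / Real.sqrt (-γ)) ^ 2) by
    field_simp; rw [h2]; ring]
  have h4 : 1 + (t / Real.sqrt (-γ)) ^ 2 ≠ 0 := by positivity
  generalize 1 + (t / Real.sqrt (-γ)) ^ 2 = w at *
  field_simp

theorem half_sin_pos {t : ℝ} (ht : t ∈ Set.Ioo 0 Real.pi) : 0 < Real.sin (t / 2) :=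
  Real.sin_pos_of_pos_of_lt_pi (by linarith [ht.1]) (by linarith [ht.1, ht.2])

theorem half_cos_pos {t : ℝ} (ht : t ∈ Set.Ioo 0 Real.pi) : 0 < Real.cos (t / 2) :=
  Real.cos_pos_of_mem_Ioo ⟨by linarith [ht.1, Real.pi_pos], by linarith [ht.2]⟩

theorem c9_prod_pos {t : ℝ} (ht : t ∈ c9.range) : 0 < (2 - t) * (4 - t) := by
  rcases ht with h | h <;> nlinarith

theorem half_hasDerivAt (t : ℝ) : HasDerivAt (fun s : ℝ => s / 2) (1 / 2) t :=
  (hasDerivAt_id' t).div_const 2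

theorem nu₁_hasDerivAt {C : BasicClass} {t : ℝ} (ht : t ∈ C.range) :
    HasDerivAt C.nu₁ (C.dnu₁ t) t := by
  cases C
  case c1 => exact Real.hasDerivAt_exp t
  case c2 => exact ((Real.hasDerivAt_exp t).const_add 1).div_const 2
  case c3 => exact (hasDerivAt_id' t).add_const 2
  case c4 β => exact ((hasDerivAt_id' t).const_mul _).congr_deriv (mul_one _)
  case c5 β => exact ((hasDerivAt_id' t).const_mul _).congr_deriv (mul_one _)
  case c6 β =>
    exact ((((hasDerivAt_id' t).const_mul (β + 1)).add_const 2).div_const 2).congr_deriv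
      (by simp [dnu₁])
  case c7 β =>
    exact ((((hasDerivAt_id' t).const_mul (β + 1)).add_const 2).div_const 2).congr_deriv
      (by simp [dnu₁])
  case c8 =>
    refine (HasDerivAt.comp t (h₂ := Real.tan) (Real.hasDerivAt_tan (half_cos_pos ht).ne')
      (half_hasDerivAt t)).congr_deriv ?_
    rw [dnu₁]; field_simp
  case c9 =>
    have h1 := left_ne_zero_of_mul (c9_prod_pos ht).ne'
    have h2 : t - 2 ≠ 0 := fun h => h1 (by linarith)
    refine ((((hasDerivAt_id' t).sub_const 4).fun_div ((hasDerivAt_id' t).sub_const 2)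
      h2).sub_const 1).congr_deriv ?_
    rw [dnu₁, show (2 - t) ^ 2 = (t - 2) ^ 2 by ring]
    ring
  case c10 β γ => exact hasDerivAt_id' t

theorem nu₂_hasDerivAt {C : BasicClass} {t : ℝ} (ht : t ∈ C.range) :
    HasDerivAt C.nu₂ (C.dnu₂ t) t := by
  cases C
  case c1 => exact (Real.hasDerivAt_exp t).neg
  case c2 => exact ((Real.hasDerivAt_exp t).const_sub 1).div_const 2
  case c3 => exact hasDerivAt_id' t
  case c4 β => exact ((hasDerivAt_id' t).const_mul _).congr_deriv (mul_one _)
  case c5 β => exact ((hasDerivAt_id' t).const_mul _).congr_deriv (mul_one _)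
  case c6 β =>
    exact ((((hasDerivAt_id' t).const_mul (β - 1)).add_const 2).div_const 2).congr_deriv
      (by simp [dnu₂])
  case c7 β =>
    exact ((((hasDerivAt_id' t).const_mul (β - 1)).add_const 2).div_const 2).congr_deriv
      (by simp [dnu₂])
  case c8 =>
    have hc := (half_cos_pos ht).ne'
    have hs := (half_sin_pos ht).ne'
    have h0 : Real.tan (t / 2) ≠ 0 := by rw [Real.tan_eq_sin_div_cos]; exact div_ne_zero hs hc
    refine ((HasDerivAt.comp t (h₂ := Real.tan) (Real.hasDerivAt_tan hc) (half_hasDerivAt t)).inv h0).neg.congr_deriv ?_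
    simp only [dnu₂, Function.comp, Real.tan_eq_sin_div_cos]
    field_simp
  case c9 =>
    have h1 := right_ne_zero_of_mul (c9_prod_pos ht).ne'
    refine ((hasDerivAt_const t (2 : ℝ)).fun_div ((hasDerivAt_id' t).const_sub 4) h1).congr_deriv ?_
    rw [dnu₂]; ring
  case c10 β γ =>
    have h1 : 2 * t + β ≠ 0 := ne_of_gt ht
    refine ((((hasDerivAt_id' t).const_mul β).add_const (2 * γ)).fun_div
      (((hasDerivAt_id' t).const_mul 2).add_const β) h1).congr_deriv ?_
    rw [dnu₂]; ring

theorem dnu₁_hasDerivAt {C : BasicClass} {t : ℝ} (ht : t ∈ C.range) :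
    HasDerivAt C.dnu₁ (C.ddnu₁ t) t := by
  cases C
  case c1 => exact Real.hasDerivAt_exp t
  case c2 => exact (Real.hasDerivAt_exp t).div_const 2
  case c8 =>
    have hc := (half_cos_pos ht).ne'
    refine ((hasDerivAt_const t (1 : ℝ)).fun_div
      ((((half_hasDerivAt t).cos).fun_pow 2).const_mul 2) (by positivity)).congr_deriv ?_
    rw [ddnu₁]; push_cast; field_simp; ring
  case c9 =>
    have h1 := left_ne_zero_of_mul (c9_prod_pos ht).ne'
    refine ((hasDerivAt_const t (2 : ℝ)).fun_div (((hasDerivAt_id' t).const_sub 2).fun_pow 2)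
      (by positivity)).congr_deriv ?_
    rw [ddnu₁]; push_cast; field_simp; ring
  all_goals exact hasDerivAt_const t _

theorem dnu₂_hasDerivAt {C : BasicClass} {t : ℝ} (ht : t ∈ C.range) :
    HasDerivAt C.dnu₂ (C.ddnu₂ t) t := by
  cases C
  case c1 => exact (Real.hasDerivAt_exp t).neg
  case c2 => exact (Real.hasDerivAt_exp t).neg.div_const 2
  case c8 =>
    have hc := (half_sin_pos ht).ne'
    refine ((hasDerivAt_const t (1 : ℝ)).fun_div
      ((((half_hasDerivAt t).sin).fun_pow 2).const_mul 2) (by positivity)).congr_deriv ?_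
    rw [ddnu₂]; push_cast; field_simp; ring
  case c9 =>
    have h1 := right_ne_zero_of_mul (c9_prod_pos ht).ne'
    refine ((hasDerivAt_const t (2 : ℝ)).fun_div (((hasDerivAt_id' t).const_sub 4).fun_pow 2)
      (by positivity)).congr_deriv ?_
    rw [ddnu₂]; push_cast; field_simp; ring
  case c10 β γ =>
    have h1 : 2 * t + β ≠ 0 := ne_of_gt ht
    refine ((hasDerivAt_const t (β ^ 2 - 4 * γ)).fun_div
      ((((hasDerivAt_id' t).const_mul 2).add_const β).fun_pow 2) (by positivity)).congr_deriv ?_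
    rw [ddnu₂]; push_cast; field_simp; ring
  all_goals exact hasDerivAt_const t _

theorem Admissible.beta_sub_ne {β : ℝ} (h : 1 < β ^ 2 ∨ β ^ 2 < 1) : β - 1 ≠ 0 := fun h0 => by
  have : β = 1 := by linarith
  subst this; norm_num at h

theorem Admissible.beta_add_ne {β : ℝ} (h : 1 < β ^ 2 ∨ β ^ 2 < 1) : β + 1 ≠ 0 := fun h0 => by
  have : β = -1 := by linarith
  subst this; norm_num at h

theorem dnu₁_ne {C : BasicClass} (hC : C.Admissible) {t : ℝ} (ht : t ∈ C.range) :
    C.dnu₁ t ≠ 0 := by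
  cases C <;> simp only [dnu₁]
  case c4 β => exact div_ne_zero (Admissible.beta_add_ne (.inl hC)) (abs_ne_zero.2 (Admissible.beta_sub_ne (.inl hC)))
  case c5 β => exact div_ne_zero (Admissible.beta_add_ne (.inr hC.1)) (abs_ne_zero.2 (Admissible.beta_sub_ne (.inr hC.1)))
  case c6 β => exact div_ne_zero (Admissible.beta_add_ne (.inl hC)) two_ne_zero
  case c7 β => exact div_ne_zero (Admissible.beta_add_ne (.inr hC.1)) two_ne_zero
  case c8 => have := (half_cos_pos ht).ne'; positivity
  case c9 => have := left_ne_zero_of_mul (c9_prod_pos ht).ne'; positivity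
  all_goals positivity

theorem dnu₂_ne {C : BasicClass} (hC : C.Admissible) {t : ℝ} (ht : t ∈ C.range) :
    C.dnu₂ t ≠ 0 := by
  cases C <;> simp only [dnu₂]
  case c1 => exact neg_ne_zero.2 (Real.exp_ne_zero t)
  case c2 => exact div_ne_zero (neg_ne_zero.2 (Real.exp_ne_zero t)) two_ne_zero
  case c3 => exact one_ne_zero
  case c4 β => exact div_ne_zero (Admissible.beta_sub_ne (.inl hC)) (abs_ne_zero.2 (Admissible.beta_sub_ne (.inl hC)))
  case c5 β => exact div_ne_zero (Admissible.beta_sub_ne (.inr hC.1)) (abs_ne_zero.2 (Admissible.beta_sub_ne (.inr hC.1)))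
  case c6 β => exact div_ne_zero (Admissible.beta_sub_ne (.inl hC)) two_ne_zero
  case c7 β => exact div_ne_zero (Admissible.beta_sub_ne (.inr hC.1)) two_ne_zero
  case c8 => have := (half_sin_pos ht).ne'; positivity
  case c9 => have := right_ne_zero_of_mul (c9_prod_pos ht).ne'; positivity
  case c10 β γ =>
    have h1 : 2 * t + β ≠ 0 := ne_of_gt ht
    have h2 : γ < 0 := hC.2
    exact div_ne_zero (by nlinarith [sq_nonneg β]) (by positivity)

/-- Besides the order of the curvatures, these closed forms give the logarithmic derivatives of
`expA`, `expB` and the zero order term of the natural PDE. -/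
theorem nu_sub {C : BasicClass} (hC : C.Admissible) {t : ℝ} (ht : t ∈ C.range) :
    C.nu₁ t - C.nu₂ t = match C with
      | c1 => 2 * Real.exp t
      | c2 => Real.exp t
      | c3 => 2
      | c4 β => 2 * t / |β - 1|
      | c5 β => 2 * t / |β - 1|
      | c6 _ => t
      | c7 _ => t
      | c8 => 1 / (Real.sin (t / 2) * Real.cos (t / 2))
      | c9 => 4 / ((2 - t) * (4 - t))
      | c10 β γ => 2 * (t ^ 2 - γ) / (2 * t + β) := by
  cases C <;> simp only [nu₁, nu₂]
  case c8 =>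
    have hc := (half_cos_pos ht).ne'
    have hs := (half_sin_pos ht).ne'
    rw [Real.tan_eq_sin_div_cos]; field_simp; linear_combination Real.sin_sq_add_cos_sq (t / 2)
  case c9 =>
    have h1 := left_ne_zero_of_mul (c9_prod_pos ht).ne'
    have h2 := right_ne_zero_of_mul (c9_prod_pos ht).ne'
    rw [show t - 2 = -(2 - t) by ring]; field_simp; ring
  case c10 β γ =>
    have h1 : 2 * t + β ≠ 0 := ne_of_gt ht
    rw [eq_div_iff h1, sub_mul, div_mul_cancel₀ _ h1]; ring
  all_goals ring

theorem nu_lt {C : BasicClass} (hC : C.Admissible) {t : ℝ} (ht : t ∈ C.range) :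
    C.nu₂ t < C.nu₁ t := by
  rw [← sub_pos, nu_sub hC ht]
  cases C <;> dsimp only
  case c4 β => have := abs_pos.2 (Admissible.beta_sub_ne (.inl hC)); have : 0 < t := ht; positivity
  case c5 β => have := abs_pos.2 (Admissible.beta_sub_ne (.inr hC.1)); have : 0 < t := ht; positivity
  case c6 => exact ht
  case c7 => exact ht
  case c8 => have := half_cos_pos ht; have := half_sin_pos ht; positivity
  case c9 => have := c9_prod_pos ht; positivity
  case c10 β γ =>
    have h1 : 0 < 2 * t + β := ht
    have h2 : γ < 0 := hC.2
    have : 0 < t ^ 2 - γ := by nlinarith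
    positivity
  all_goals positivity

theorem expA_pos {C : BasicClass} (hC : C.Admissible) {t : ℝ} (ht : t ∈ C.range) :
    0 < C.expA t := by
  cases C <;> simp only [expA]
  case c4 => exact Real.rpow_pos_of_pos ht _
  case c5 => exact Real.rpow_pos_of_pos ht _
  case c6 => exact Real.rpow_pos_of_pos ht _
  case c7 => exact Real.rpow_pos_of_pos ht _
  case c8 => have := half_cos_pos ht; positivity
  case c9 => have := left_ne_zero_of_mul (c9_prod_pos ht).ne'; positivity
  case c10 β γ =>
    have h2 : γ < 0 := hC.2
    have : 0 < t ^ 2 - γ := by nlinarith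
    positivity
  all_goals positivity

theorem expB_pos {C : BasicClass} (hC : C.Admissible) {t : ℝ} (ht : t ∈ C.range) :
    0 < C.expB t := by
  cases C <;> simp only [expB]
  case c4 => exact Real.rpow_pos_of_pos ht _
  case c5 => exact Real.rpow_pos_of_pos ht _
  case c6 => exact Real.rpow_pos_of_pos ht _
  case c7 => exact Real.rpow_pos_of_pos ht _
  case c8 => have := half_sin_pos ht; positivity
  case c9 => have := right_ne_zero_of_mul (c9_prod_pos ht).ne'; positivity
  case c10 β γ =>
    have h2 : γ < 0 := hC.2
    have h1 : 0 < 2 * t + β := ht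
    have : 0 < t ^ 2 - γ := by nlinarith
    positivity
  all_goals positivity

theorem facA_pos {C : BasicClass} (hC : C.Admissible) : 0 < C.facA := by
  cases C <;> simp only [facA]
  case c10 β γ =>
    have h2 : γ < 0 := hC.2
    exact div_pos (div_pos_of_neg_of_neg (by norm_num) h2) (by nlinarith [sq_nonneg β])
  all_goals norm_num

theorem facB_pos {C : BasicClass} (hC : C.Admissible) : 0 < C.facB := by
  cases C <;> simp only [facB]
  case c4 β => exact div_pos (abs_pos.2 (Admissible.beta_sub_ne (.inl hC))) (abs_pos.2 (Admissible.beta_add_ne (.inl hC)))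
  case c5 β => exact div_pos (abs_pos.2 (Admissible.beta_sub_ne (.inr hC.1))) (abs_pos.2 (Admissible.beta_add_ne (.inr hC.1)))
  case c6 β => exact div_pos (abs_pos.2 (Admissible.beta_sub_ne (.inl hC))) (abs_pos.2 (Admissible.beta_add_ne (.inl hC)))
  case c7 β => exact div_pos (abs_pos.2 (Admissible.beta_sub_ne (.inr hC.1))) (abs_pos.2 (Admissible.beta_add_ne (.inr hC.1)))
  case c10 β γ => exact div_pos_of_neg_of_neg (by norm_num) hC.2
  all_goals norm_num

theorem rpow_hasDerivAt {t : ℝ} (ht : 0 < t) (β : ℝ) :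
    HasDerivAt (fun s : ℝ => s ^ β) (β * (t ^ β / t)) t :=
  (Real.hasDerivAt_rpow_const (.inl ht.ne')).congr_deriv (by rw [Real.rpow_sub_one ht.ne'])

theorem expA_hasDerivAt {C : BasicClass} (hC : C.Admissible) {t : ℝ} (ht : t ∈ C.range) :
    HasDerivAt C.expA (2 * (C.dnu₁ t / (C.nu₁ t - C.nu₂ t)) * C.expA t) t := by
  rw [nu_sub hC ht]
  cases C
  case c1 => exact (Real.hasDerivAt_exp t).congr_deriv (by simp only [dnu₁, expA]; field_simp)
  case c2 => exact (Real.hasDerivAt_exp t).congr_deriv (by simp only [dnu₁, expA]; field_simp)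
  case c3 => exact (Real.hasDerivAt_exp t).congr_deriv (by simp only [dnu₁, expA]; field_simp)
  case c4 β =>
    have h1 := abs_ne_zero.2 (Admissible.beta_sub_ne (.inl hC))
    have h2 : t ≠ 0 := ne_of_gt ht
    exact (rpow_hasDerivAt ht _).congr_deriv (by simp only [dnu₁, expA]; field_simp)
  case c5 β =>
    have h1 := abs_ne_zero.2 (Admissible.beta_sub_ne (.inr hC.1))
    have h2 : t ≠ 0 := ne_of_gt ht
    exact (rpow_hasDerivAt ht _).congr_deriv (by simp only [dnu₁, expA]; field_simp)
  case c6 β =>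
    have h2 : t ≠ 0 := ne_of_gt ht
    exact (rpow_hasDerivAt ht _).congr_deriv (by simp only [dnu₁, expA]; field_simp)
  case c7 β =>
    have h2 : t ≠ 0 := ne_of_gt ht
    exact (rpow_hasDerivAt ht _).congr_deriv (by simp only [dnu₁, expA]; field_simp)
  case c8 =>
    have hc := (half_cos_pos ht).ne'
    have hs := (half_sin_pos ht).ne'
    refine ((hasDerivAt_const t (1 : ℝ)).fun_div (((half_hasDerivAt t).cos).fun_pow 2)
      (by positivity)).congr_deriv ?_
    simp only [dnu₁, expA]; push_cast; field_simp; ring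
  case c9 =>
    have h1 := left_ne_zero_of_mul (c9_prod_pos ht).ne'
    have h2 := right_ne_zero_of_mul (c9_prod_pos ht).ne'
    refine ((Real.hasDerivAt_exp t).fun_div (((hasDerivAt_id' t).const_sub 2).fun_pow 2)
      (by positivity)).congr_deriv ?_
    simp only [dnu₁, expA]; push_cast; field_simp; ring
  case c10 β γ =>
    have h2 : γ < 0 := hC.2
    have h1 : 2 * t + β ≠ 0 := ne_of_gt ht
    have h3 : t ^ 2 - γ ≠ 0 := by nlinarith
    refine ((((hasDerivAt_id' t).fun_pow 2).sub_const γ).fun_mul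
      (((arcI_hasDerivAt h2 t).const_mul β).exp)).congr_deriv ?_
    simp only [dnu₁, expA]; push_cast; field_simp

theorem expB_hasDerivAt {C : BasicClass} (hC : C.Admissible) {t : ℝ} (ht : t ∈ C.range) :
    HasDerivAt C.expB (2 * (C.dnu₂ t / (C.nu₂ t - C.nu₁ t)) * C.expB t) t := by
  rw [← neg_sub (C.nu₁ t), nu_sub hC ht]
  cases C
  case c1 => exact (Real.hasDerivAt_exp t).congr_deriv (by simp only [dnu₂, expB]; field_simp)
  case c2 => exact (Real.hasDerivAt_exp t).congr_deriv (by simp only [dnu₂, expB]; field_simp)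
  case c3 => exact (hasDerivAt_id' t).fun_neg.exp.congr_deriv (by simp only [dnu₂, expB]; field_simp)
  case c4 β =>
    have h1 := abs_ne_zero.2 (Admissible.beta_sub_ne (.inl hC))
    have h2 : t ≠ 0 := ne_of_gt ht
    exact (rpow_hasDerivAt ht _).congr_deriv (by simp only [dnu₂, expB]; field_simp; ring)
  case c5 β =>
    have h1 := abs_ne_zero.2 (Admissible.beta_sub_ne (.inr hC.1))
    have h2 : t ≠ 0 := ne_of_gt ht
    exact (rpow_hasDerivAt ht _).congr_deriv (by simp only [dnu₂, expB]; field_simp; ring)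
  case c6 β =>
    have h2 : t ≠ 0 := ne_of_gt ht
    exact (rpow_hasDerivAt ht _).congr_deriv (by simp only [dnu₂, expB]; field_simp; ring)
  case c7 β =>
    have h2 : t ≠ 0 := ne_of_gt ht
    exact (rpow_hasDerivAt ht _).congr_deriv (by simp only [dnu₂, expB]; field_simp; ring)
  case c8 =>
    have hc := (half_cos_pos ht).ne'
    have hs := (half_sin_pos ht).ne'
    refine ((hasDerivAt_const t (1 : ℝ)).fun_div (((half_hasDerivAt t).sin).fun_pow 2)
      (by positivity)).congr_deriv ?_
    simp only [dnu₂, expB]; push_cast; field_simp; ring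
  case c9 =>
    have h1 := left_ne_zero_of_mul (c9_prod_pos ht).ne'
    have h2 := right_ne_zero_of_mul (c9_prod_pos ht).ne'
    refine ((hasDerivAt_id' t).fun_neg.exp.fun_div (((hasDerivAt_id' t).const_sub 4).fun_pow 2)
      (by positivity)).congr_deriv ?_
    simp only [dnu₂, expB]; push_cast; field_simp; ring
  case c10 β γ =>
    have h2 : γ < 0 := hC.2
    have h1 : 2 * t + β ≠ 0 := ne_of_gt ht
    have h3 : t ^ 2 - γ ≠ 0 := by nlinarith
    refine (((((hasDerivAt_id' t).fun_pow 2).sub_const γ).fun_div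
      ((((hasDerivAt_id' t).const_mul 2).add_const β).fun_pow 2) (by positivity)).fun_mul
      (((arcI_hasDerivAt h2 t).const_mul β).fun_neg.exp)).congr_deriv ?_
    simp only [dnu₂, expB]; push_cast; field_simp; ring


theorem smooth_nu₁ (C : BasicClass) : ContDiffOn ℝ ∞ C.nu₁ C.range := by
  cases C
  case c1 => exact Real.contDiff_exp.contDiffOn
  case c2 => exact ((contDiff_const.add Real.contDiff_exp).div_const 2).contDiffOn
  case c8 =>
    intro t ht
    exact ((Real.contDiffAt_tan.2 (half_cos_pos ht).ne').comp t
      (contDiff_id.div_const 2).contDiffAt).contDiffWithinAt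
  case c9 =>
    refine ((contDiffOn_id.sub contDiffOn_const).div (contDiffOn_id.sub contDiffOn_const)
      fun t ht => ?_).sub contDiffOn_const
    have h1 := left_ne_zero_of_mul (c9_prod_pos ht).ne'
    exact fun h => h1 (by simp at h; linarith)
  case c3 => exact (contDiff_id.add contDiff_const).contDiffOn
  case c4 => exact (contDiff_const.mul contDiff_id).contDiffOn
  case c5 => exact (contDiff_const.mul contDiff_id).contDiffOn
  case c6 => exact (((contDiff_const.mul contDiff_id).add contDiff_const).div_const 2).contDiffOn
  case c7 => exact (((contDiff_const.mul contDiff_id).add contDiff_const).div_const 2).contDiffOn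
  case c10 => exact contDiffOn_id

theorem smooth_nu₂ (C : BasicClass) : ContDiffOn ℝ ∞ C.nu₂ C.range := by
  cases C
  case c1 => exact Real.contDiff_exp.neg.contDiffOn
  case c2 => exact ((contDiff_const.sub Real.contDiff_exp).div_const 2).contDiffOn
  case c8 =>
    intro t ht
    have h0 : Real.tan (t / 2) ≠ 0 := by
      rw [Real.tan_eq_sin_div_cos]
      exact div_ne_zero (half_sin_pos ht).ne' (half_cos_pos ht).ne'
    exact (((ContDiffAt.comp t (g := Real.tan) (f := fun s => s / 2)
      (Real.contDiffAt_tan.2 (half_cos_pos ht).ne')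
      (contDiff_id.div_const 2).contDiffAt).inv h0).neg).contDiffWithinAt
  case c9 =>
    exact contDiffOn_const.div (contDiffOn_const.sub contDiffOn_id) fun t ht =>
      right_ne_zero_of_mul (c9_prod_pos ht).ne'
  case c3 => exact contDiffOn_id
  case c4 => exact (contDiff_const.mul contDiff_id).contDiffOn
  case c5 => exact (contDiff_const.mul contDiff_id).contDiffOn
  case c6 => exact (((contDiff_const.mul contDiff_id).add contDiff_const).div_const 2).contDiffOn
  case c7 => exact (((contDiff_const.mul contDiff_id).add contDiff_const).div_const 2).contDiffOn
  case c10 β γ =>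
    exact ((contDiffOn_const.mul contDiffOn_id).add contDiffOn_const).div
      ((contDiffOn_const.mul contDiffOn_id).add contDiffOn_const) fun t ht => ne_of_gt ht

theorem isWeingartenPair {C : BasicClass} (hC : C.Admissible) :
    IsWeingartenPair C.nu₁ C.nu₂ C.range where
  smooth_f := C.smooth_nu₁
  smooth_g := C.smooth_nu₂
  lt _ ht := nu_lt hC ht
  deriv_f t ht := by rw [(nu₁_hasDerivAt ht).deriv]; exact dnu₁_ne hC ht
  deriv_g t ht := by rw [(nu₂_hasDerivAt ht).deriv]; exact dnu₂_ne hC ht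

theorem deriv_deriv_nu₁ {C : BasicClass} {t : ℝ} (ht : t ∈ C.range) :
    deriv (deriv C.nu₁) t = C.ddnu₁ t := by
  rw [(Filter.eventuallyEq_of_mem (C.isOpen_range.mem_nhds ht)
    fun s hs => (nu₁_hasDerivAt hs).deriv).deriv_eq]
  exact (dnu₁_hasDerivAt ht).deriv

theorem deriv_deriv_nu₂ {C : BasicClass} {t : ℝ} (ht : t ∈ C.range) :
    deriv (deriv C.nu₂) t = C.ddnu₂ t := by
  rw [(Filter.eventuallyEq_of_mem (C.isOpen_range.mem_nhds ht)
    fun s hs => (nu₂_hasDerivAt hs).deriv).deriv_eq]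
  exact (dnu₂_hasDerivAt ht).deriv

/-- The normalizing constants. -/
def constA (C : BasicClass) (t₀ : ℝ) : ℝ := Real.sqrt (C.facA * C.expA t₀)
def constB (C : BasicClass) (t₀ : ℝ) : ℝ := Real.sqrt (C.facB * C.expB t₀)

theorem constA_ne {C : BasicClass} (hC : C.Admissible) {t₀ : ℝ} (h₀ : t₀ ∈ C.range) :
    C.constA t₀ ≠ 0 := (Real.sqrt_pos.2 (mul_pos (facA_pos hC) (expA_pos hC h₀))).ne'

theorem constB_ne {C : BasicClass} (hC : C.Admissible) {t₀ : ℝ} (h₀ : t₀ ∈ C.range) :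
    C.constB t₀ ≠ 0 := (Real.sqrt_pos.2 (mul_pos (facB_pos hC) (expB_pos hC h₀))).ne'

/-- The choice `a² = facA * expA t₀` cancels the dependence of the integral on its starting point,
so the coefficient of the PDE no longer contains `t₀`. -/
theorem constA_sq_mul {C : BasicClass} (hC : C.Admissible) {t₀ t : ℝ}
    (h : Set.uIcc t₀ t ⊆ C.range) :
    C.constA t₀ ^ 2 * Real.exp (2 * wInt C.nu₁ C.nu₂ t₀ t) = C.facA * C.expA t := by
  have h₀ := expA_pos hC (h Set.left_mem_uIcc)
  rw [constA, Real.sq_sqrt (mul_pos (facA_pos hC) h₀).le, exp_two_wInt (α := C.expA)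
    (fun s hs => expA_pos hC (h hs))
    (fun s hs => (expA_hasDerivAt hC (h hs)).congr_deriv (by rw [(nu₁_hasDerivAt (h hs)).deriv]))
    (((isWeingartenPair hC).smooth_integrand_f C.isOpen_range).continuousOn.mono h)]
  field_simp

theorem constB_sq_mul {C : BasicClass} (hC : C.Admissible) {t₀ t : ℝ}
    (h : Set.uIcc t₀ t ⊆ C.range) :
    C.constB t₀ ^ 2 * Real.exp (2 * wInt C.nu₂ C.nu₁ t₀ t) = C.facB * C.expB t := by
  have h₀ := expB_pos hC (h Set.left_mem_uIcc)
  rw [constB, Real.sq_sqrt (mul_pos (facB_pos hC) h₀).le, exp_two_wInt (α := C.expB)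
    (fun s hs => expB_pos hC (h hs))
    (fun s hs => (expB_hasDerivAt hC (h hs)).congr_deriv (by rw [(nu₂_hasDerivAt (h hs)).deriv]))
    (((isWeingartenPair hC).smooth_integrand_g C.isOpen_range).continuousOn.mono h)]
  field_simp

end BasicClass

/-! ### From the natural PDE to the listed PDE. -/

/-- Second partial derivatives of a function of `lam`. -/
theorem second_partials_comp {V : Set (ℝ × ℝ)} {lam : ℝ × ℝ → ℝ} (hV : IsOpen V)
    (hl : ContDiffOn ℝ ∞ lam V) {I : Set ℝ} (hm : Set.MapsTo lam V I) {φ φ₁ : ℝ → ℝ} {d : ℝ}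
    (h1 : ∀ t ∈ I, HasDerivAt φ (φ₁ t) t) {p : ℝ × ℝ} (hp : p ∈ V)
    (h2 : HasDerivAt φ₁ d (lam p)) :
    dU (dU fun q => φ (lam q)) p = φ₁ (lam p) * dU (dU lam) p + d * dU lam p ^ 2 ∧
    dV (dV fun q => φ (lam q)) p = φ₁ (lam p) * dV (dV lam) p + d * dV lam p ^ 2 := by
  have hc : ∀ q ∈ V, HasD (fun q => φ (lam q)) (φ₁ (lam q) * dU lam q) (φ₁ (lam q) * dV lam q) q :=
    fun q hq => (hasD_of_smooth hV hl hq).rcomp (h1 _ (hm hq))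
  have hl' := hasD_of_smooth hV hl hp
  have hu := ((hl'.rcomp h2).mul (hasD_of_smooth hV (contDiffOn_dU hV hl) hp)).congr hV hp
    fun q hq => (hc q hq).dU_eq
  have hv := ((hl'.rcomp h2).mul (hasD_of_smooth hV (contDiffOn_dV hV hl) hp)).congr hV hp
    fun q hq => (hc q hq).dV_eq
  exact ⟨hu.dU_eq.trans (by ring), hv.dV_eq.trans (by ring)⟩

theorem iff_of_eq_mul {a b x y c : ℝ} (hc : c ≠ 0) (h : a - b = c * (x - y)) : a = b ↔ x = y := by
  rw [← sub_eq_zero, h, mul_eq_zero_iff_left hc, sub_eq_zero]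

namespace BasicClass

theorem rpow_second_partials {V : Set (ℝ × ℝ)} {lam : ℝ × ℝ → ℝ} (hV : IsOpen V)
    (hl : ContDiffOn ℝ ∞ lam V) (hm : Set.MapsTo lam V (Set.Ioi 0)) (β : ℝ) {p : ℝ × ℝ}
    (hp : p ∈ V) :
    dU (dU fun q => lam q ^ β) p = β * lam p ^ β / lam p * dU (dU lam) p +
      β * (β - 1) * lam p ^ β / lam p ^ 2 * dU lam p ^ 2 ∧
    dV (dV fun q => (lam q ^ β)⁻¹) p = -β / (lam p ^ β * lam p) * dV (dV lam) p +
      β * (β + 1) / (lam p ^ β * lam p ^ 2) * dV lam p ^ 2 := by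
  have h0 : lam p ≠ 0 := ne_of_gt (hm hp)
  have hX : lam p ^ β ≠ 0 := (Real.rpow_pos_of_pos (hm hp) _).ne'
  constructor
  · refine (second_partials_comp hV hl hm (φ := fun t => t ^ β) (φ₁ := fun t => β * (t ^ β / t))
      (fun t ht => rpow_hasDerivAt ht β) hp (d := β * (β - 1) * lam p ^ β / lam p ^ 2) ?_).1.trans
      (by ring)
    refine (((rpow_hasDerivAt (hm hp) β).fun_div (hasDerivAt_id' _) h0).const_mul β).congr_deriv ?_
    field_simp
  · refine (second_partials_comp hV hl hm (φ := fun t => (t ^ β)⁻¹)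
      (φ₁ := fun t => -β / (t ^ β * t))
      (fun t ht => ?_) hp (d := β * (β + 1) / (lam p ^ β * lam p ^ 2)) ?_).2
    · have h0 : t ≠ 0 := ne_of_gt ht
      have hX : t ^ β ≠ 0 := (Real.rpow_pos_of_pos ht _).ne'
      refine ((rpow_hasDerivAt ht β).fun_inv hX).congr_deriv ?_
      field_simp
    · refine ((hasDerivAt_const _ (-β)).fun_div ((rpow_hasDerivAt (hm hp) β).fun_mul
        (hasDerivAt_id' _)) (mul_ne_zero hX h0)).congr_deriv ?_
      field_simp
      ring

theorem exp_second_partials {V : Set (ℝ × ℝ)} {lam : ℝ × ℝ → ℝ} (hV : IsOpen V)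
    (hl : ContDiffOn ℝ ∞ lam V) {p : ℝ × ℝ} (hp : p ∈ V) :
    dU (dU fun q => Real.exp (lam q)) p = Real.exp (lam p) * dU (dU lam) p +
      Real.exp (lam p) * dU lam p ^ 2 ∧
    dV (dV fun q => (Real.exp (lam q))⁻¹) p = -Real.exp (-lam p) * dV (dV lam) p +
      Real.exp (-lam p) * dV lam p ^ 2 := by
  constructor
  · exact (second_partials_comp hV hl (Set.mapsTo_univ _ _) (fun t _ => Real.hasDerivAt_exp t) hp
      (Real.hasDerivAt_exp _)).1
  · simp only [← Real.exp_neg]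
    refine (second_partials_comp hV hl (Set.mapsTo_univ _ _) (φ := fun t => Real.exp (-t))
      (φ₁ := fun t => -Real.exp (-t)) (fun t _ => ?_) hp ?_).2
    · exact (hasDerivAt_id' t).fun_neg.exp.congr_deriv (by ring)
    · exact (hasDerivAt_id' _).fun_neg.exp.fun_neg.congr_deriv (by ring)

theorem exp_arcI_second_partials {V : Set (ℝ × ℝ)} {lam : ℝ × ℝ → ℝ} (hV : IsOpen V)
    (hl : ContDiffOn ℝ ∞ lam V) (β : ℝ) {γ : ℝ} (hγ : γ < 0) {p : ℝ × ℝ} (hp : p ∈ V) :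
    dU (dU fun q => Real.exp (β * arcI γ (lam q))) p =
      β * Real.exp (β * arcI γ (lam p)) / (lam p ^ 2 - γ) * dU (dU lam) p +
      Real.exp (β * arcI γ (lam p)) * (β ^ 2 - 2 * β * lam p) / (lam p ^ 2 - γ) ^ 2 *
        dU lam p ^ 2 ∧
    dV (dV fun q => (Real.exp (β * arcI γ (lam q)))⁻¹) p =
      -β * Real.exp (-(β * arcI γ (lam p))) / (lam p ^ 2 - γ) * dV (dV lam) p +
      Real.exp (-(β * arcI γ (lam p))) * (β ^ 2 + 2 * β * lam p) / (lam p ^ 2 - γ) ^ 2 *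
        dV lam p ^ 2 := by
  have hn : ∀ t : ℝ, t ^ 2 - γ ≠ 0 := fun t => by nlinarith
  have key : ∀ δ t : ℝ, HasDerivAt (fun t => Real.exp (δ * arcI γ t))
      (δ * Real.exp (δ * arcI γ t) / (t ^ 2 - γ)) t := fun δ t =>
    ((arcI_hasDerivAt hγ t).const_mul δ).exp.congr_deriv (by ring)
  have key2 : ∀ δ t : ℝ, HasDerivAt (fun t => δ * Real.exp (δ * arcI γ t) / (t ^ 2 - γ))
      (Real.exp (δ * arcI γ t) * (δ ^ 2 - 2 * δ * t) / (t ^ 2 - γ) ^ 2) t := fun δ t => by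
    have := hn t
    refine (((key δ t).const_mul δ).fun_div (((hasDerivAt_id' t).fun_pow 2).sub_const γ)
      this).congr_deriv ?_
    push_cast; field_simp
  constructor
  · exact (second_partials_comp hV hl (Set.mapsTo_univ _ _) (fun t _ => key β t) hp (key2 β _)).1
  · simp only [← Real.exp_neg, ← neg_mul]
    exact (second_partials_comp hV hl (Set.mapsTo_univ _ _) (fun t _ => key (-β) t) hp
      (key2 (-β) _)).2.trans (by ring)

/-- In each class the two equations differ by a factor `c`, a non-vanishing function of `lam p`. The
condition on `Set.uIcc` matters for class 9, whose range consists of two half-lines: the integral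
must not cross the gap between them. -/
theorem naturalPDE_iff {C : BasicClass} (hC : C.Admissible) {t₀ : ℝ} {V : Set (ℝ × ℝ)}
    {lam : ℝ × ℝ → ℝ} (hV : IsOpen V) (hl : ContDiffOn ℝ ∞ lam V)
    (hm : Set.MapsTo lam V C.range) {p : ℝ × ℝ} (hp : p ∈ V)
    (h : Set.uIcc t₀ (lam p) ⊆ C.range) :
    NaturalPDE C.nu₁ C.nu₂ (C.constA t₀) (C.constB t₀) t₀ lam p ↔ C.PDE lam p := by
  have ht := hm hp
  rw [NaturalPDE, constA_sq_mul hC h, constB_sq_mul hC h, deriv_deriv_nu₁ ht, deriv_deriv_nu₂ ht,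
    (nu₁_hasDerivAt ht).deriv, (nu₂_hasDerivAt ht).deriv, ← neg_sub (C.nu₁ (lam p)),
    nu_sub hC ht]
  cases C <;> simp only [PDE, lap, lapBar, lapStar, lapStarBar]
  case c1 =>
    refine iff_of_eq_mul (c := 2 * Real.exp (lam p) ^ 2) (by positivity) ?_
    simp only [dnu₁, dnu₂, ddnu₁, ddnu₂, expA, expB, facA, facB, nu₁, nu₂]
    field_simp; ring
  case c2 =>
    refine iff_of_eq_mul (c := Real.exp (lam p) ^ 2 / 2) (by positivity) ?_
    simp only [dnu₁, dnu₂, ddnu₁, ddnu₂, expA, expB, facA, facB, nu₁, nu₂, Real.sinh_eq,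
      Real.exp_neg]
    field_simp; ring
  case c3 =>
    obtain ⟨e1, e2⟩ := exp_second_partials hV hl hp
    rw [e1, e2]
    refine iff_of_eq_mul (c := -1) (by norm_num) ?_
    simp only [dnu₁, dnu₂, ddnu₁, ddnu₂, expA, expB, facA, facB, nu₁, nu₂]
    ring
  case c8 =>
    have hc := (half_cos_pos ht).ne'
    have hs := (half_sin_pos ht).ne'
    refine iff_of_eq_mul (c := -1 / (2 * Real.sin (lam p / 2) ^ 2 * Real.cos (lam p / 2) ^ 2))
      (by positivity) ?_
    have : Real.sin (lam p) = 2 * Real.sin (lam p / 2) * Real.cos (lam p / 2) := by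
      rw [← Real.sin_two_mul]; congr 1; ring
    simp only [dnu₁, dnu₂, ddnu₁, ddnu₂, expA, expB, facA, facB, nu₁, nu₂, this,
      Real.tan_eq_sin_div_cos]
    field_simp; ring
  case c9 =>
    have h1 := left_ne_zero_of_mul (c9_prod_pos ht).ne'
    have h2 := right_ne_zero_of_mul (c9_prod_pos ht).ne'
    obtain ⟨e1, e2⟩ := exp_second_partials hV hl hp
    rw [e1, e2]
    refine iff_of_eq_mul (c := -8 / ((4 - lam p) ^ 2 * (2 - lam p) ^ 2)) (by positivity) ?_
    simp only [dnu₁, dnu₂, ddnu₁, ddnu₂, expA, expB, facA, facB, nu₁, nu₂, Real.exp_neg]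
    rw [show lam p - 2 = -(2 - lam p) by ring]
    field_simp; ring
  case c10 β γ =>
    have hb : β ≠ 0 := hC.1
    have hγ : γ < 0 := hC.2
    have h1 : 2 * lam p + β ≠ 0 := ne_of_gt ht
    have h2 : lam p ^ 2 - γ ≠ 0 := by nlinarith
    have h3 : β ^ 2 - 4 * γ ≠ 0 := by nlinarith [sq_nonneg β]
    obtain ⟨e1, e2⟩ := exp_arcI_second_partials hV hl β hγ hp
    rw [e1, e2]
    refine iff_of_eq_mul (c := 4 / (γ * β) * ((lam p ^ 2 - γ) ^ 2 / (2 * lam p + β) ^ 2))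
      (by have := hγ.ne; positivity) ?_
    simp only [dnu₁, dnu₂, ddnu₁, ddnu₂, expA, expB, facA, facB, nu₁, nu₂, Real.exp_neg]
    have := hγ.ne
    have hX := Real.exp_ne_zero (β * arcI γ (lam p))
    generalize Real.exp (β * arcI γ (lam p)) = X at *
    clear e1 e2 h ht hm hp hl hC
    generalize hW : 2 * lam p + β = W at *
    generalize hS : lam p ^ 2 - γ = S at *
    generalize hT : β ^ 2 - 4 * γ = T at *
    field_simp
    subst hW hS hT
    ring
  case c4 β =>
    have hb1 := Admissible.beta_sub_ne (.inl hC)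
    have hb2 := Admissible.beta_add_ne (.inl hC)
    have hb : β ≠ 0 := by rintro rfl; norm_num [Admissible] at hC
    have h0 : lam p ≠ 0 := ne_of_gt ht
    have hX : lam p ^ β ≠ 0 := (Real.rpow_pos_of_pos ht _).ne'
    obtain ⟨e1, e2⟩ := rpow_second_partials hV hl hm β hp
    rw [e1, e2]
    simp only [dnu₁, dnu₂, ddnu₁, ddnu₂, expA, expB, facA, facB, nu₁, nu₂,
      Real.rpow_add_one h0, Real.rpow_sub ht, Real.rpow_one]
    -- Here `|β - 1|` occurs in the Weingarten functions, so the proportionality factor itself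
    -- changes sign between `β > 1` and `β < -1`.
    rcases one_lt_sq_iff_one_lt_abs β |>.1 hC |> lt_abs.1 with hβ | hβ
    · rw [abs_of_pos (by linarith : 0 < β - 1), abs_of_pos (by linarith : 0 < β + 1)]
      refine iff_of_eq_mul (c := -lam p ^ 2 / β)
        (div_ne_zero (neg_ne_zero.2 (pow_ne_zero 2 h0)) hb) ?_
      field_simp; ring
    · rw [abs_of_neg (by linarith : β - 1 < 0), abs_of_neg (by linarith : β + 1 < 0)]
      refine iff_of_eq_mul (c := lam p ^ 2 / β) (by positivity) ?_
      field_simp; ring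
  case c5 β =>
    have hb1 := Admissible.beta_sub_ne (.inr hC.1)
    have hb2 := Admissible.beta_add_ne (.inr hC.1)
    have hb : β ≠ 0 := hC.2
    have hβ := abs_lt.1 ((sq_lt_one_iff_abs_lt_one β).1 hC.1)
    have h0 : lam p ≠ 0 := ne_of_gt ht
    have hX : lam p ^ β ≠ 0 := (Real.rpow_pos_of_pos ht _).ne'
    obtain ⟨e1, e2⟩ := rpow_second_partials hV hl hm β hp
    rw [e1, e2]
    simp only [dnu₁, dnu₂, ddnu₁, ddnu₂, expA, expB, facA, facB, nu₁, nu₂,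
      Real.rpow_add_one h0, Real.rpow_sub ht, Real.rpow_one]
    rw [abs_of_neg (by linarith : β - 1 < 0), abs_of_pos (by linarith : 0 < β + 1)]
    refine iff_of_eq_mul (c := lam p ^ 2 / β) (by positivity) ?_
    field_simp; ring
  case c6 β =>
    have hb1 := Admissible.beta_sub_ne (.inl hC)
    have hb2 := Admissible.beta_add_ne (.inl hC)
    have hb : β ≠ 0 := by rintro rfl; norm_num [Admissible] at hC
    have h0 : lam p ≠ 0 := ne_of_gt ht
    have hX : lam p ^ β ≠ 0 := (Real.rpow_pos_of_pos ht _).ne'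
    obtain ⟨e1, e2⟩ := rpow_second_partials hV hl hm β hp
    rw [e1, e2]
    simp only [dnu₁, dnu₂, ddnu₁, ddnu₂, expA, expB, facA, facB, nu₁, nu₂,
      Real.rpow_add_one h0, Real.rpow_sub ht, Real.rpow_one]
    refine iff_of_eq_mul (c := -(β - 1) * lam p ^ 2 / (2 * β))
      (div_ne_zero (mul_ne_zero (neg_ne_zero.2 hb1) (by positivity)) (by positivity)) ?_
    rcases one_lt_sq_iff_one_lt_abs β |>.1 hC |> lt_abs.1 with hβ | hβ
    · rw [abs_of_pos (by linarith : 0 < β - 1), abs_of_pos (by linarith : 0 < β + 1)]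
      field_simp; ring
    · rw [abs_of_neg (by linarith : β - 1 < 0), abs_of_neg (by linarith : β + 1 < 0)]
      field_simp; ring
  case c7 β =>
    have hb1 := Admissible.beta_sub_ne (.inr hC.1)
    have hb2 := Admissible.beta_add_ne (.inr hC.1)
    have hb : β ≠ 0 := hC.2
    have hβ := abs_lt.1 ((sq_lt_one_iff_abs_lt_one β).1 hC.1)
    have h0 : lam p ≠ 0 := ne_of_gt ht
    have hX : lam p ^ β ≠ 0 := (Real.rpow_pos_of_pos ht _).ne'
    obtain ⟨e1, e2⟩ := rpow_second_partials hV hl hm β hp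
    rw [e1, e2]
    simp only [dnu₁, dnu₂, ddnu₁, ddnu₂, expA, expB, facA, facB, nu₁, nu₂,
      Real.rpow_add_one h0, Real.rpow_sub ht, Real.rpow_one]
    refine iff_of_eq_mul (c := -(β - 1) * lam p ^ 2 / (2 * β))
      (div_ne_zero (mul_ne_zero (neg_ne_zero.2 hb1) (by positivity)) (by positivity)) ?_
    rw [abs_of_neg (by linarith : β - 1 < 0), abs_of_pos (by linarith : 0 < β + 1)]
    field_simp; ring

end BasicClass

/-! ### Principal surfaces from moving frames -/

/-- `x`, `y`, `l` is the moving frame of a surface `z` in principal parameters, `e` and `g` are the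
lengths of the coordinate vectors, `k₁` and `k₂` the principal curvatures. -/
structure IsMovingFrame (z x y l : ℝ × ℝ → E3) (e g k₁ k₂ : ℝ × ℝ → ℝ) (V : Set (ℝ × ℝ)) :
    Prop where
  frame : ∀ p ∈ V, IsFrame (x p) (y p) (l p)
  oriented : ∀ p ∈ V, l p = cross (x p) (y p)
  e_pos : ∀ p ∈ V, 0 < e p
  g_pos : ∀ p ∈ V, 0 < g p
  dz : ∀ p ∈ V, HasD z (e p • x p) (g p • y p) p
  dl : ∀ p ∈ V, HasD l (-(k₁ p * e p) • x p) (-(k₂ p * g p) • y p) p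
  ne : ∀ p ∈ V, k₁ p ≠ k₂ p

theorem IsPrincipalSurface.isMovingFrame {z : ℝ × ℝ → E3} {D : Set (ℝ × ℝ)}
    (h : IsPrincipalSurface z D) : IsMovingFrame z (unitU z) (unitV z) (normal z) (lenU z) (lenV z)
      (fun p => coefL z p / coefE z p) (fun p => coefN z p / coefG z p) D where
  frame _ hp := h.isFrame hp
  oriented _ hp := h.normal_eq hp
  e_pos _ hp := h.lenU_pos hp
  g_pos _ hp := h.lenV_pos hp
  dz p hp := by
    rw [← h.dU_eq hp, ← h.dV_eq hp]
    exact hasD_of_smooth h.isOpen h.smooth hp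
  dl p hp := by
    rw [← h.coefL_div_lenU hp, ← h.coefN_div_lenV hp]
    exact (h.structure_equations hp).2.2
  ne _ hp := h.nu_ne hp

/-- The data of a principal surface read off from a moving frame. -/
structure HasFrameData (z l : ℝ × ℝ → E3) (e g k₁ k₂ : ℝ × ℝ → ℝ) (V : Set (ℝ × ℝ)) : Prop
    extends IsPrincipalSurface z V where
  lenU_eq : ∀ p ∈ V, lenU z p = e p
  lenV_eq : ∀ p ∈ V, lenV z p = g p
  nu₁_eq : ∀ p ∈ V, coefL z p / coefE z p = k₁ p
  nu₂_eq : ∀ p ∈ V, coefN z p / coefG z p = k₂ p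

/-- Only the first derivatives of `z` and `l` are needed to recover both fundamental forms. Every
later operation (change of parameters, parallel surface, integration) can therefore be checked on
`dz` and `dl` alone. -/
theorem IsMovingFrame.hasFrameData {z x y l : ℝ × ℝ → E3} {e g k₁ k₂ : ℝ × ℝ → ℝ}
    {V : Set (ℝ × ℝ)} (h : IsMovingFrame z x y l e g k₁ k₂ V) (hV : IsOpen V)
    (hz : ContDiffOn ℝ ∞ z V) : HasFrameData z l e g k₁ k₂ V := by
  have zu : ∀ p ∈ V, dU z p = e p • x p := fun p hp => (h.dz p hp).dU_eq
  have zv : ∀ p ∈ V, dV z p = g p • y p := fun p hp => (h.dz p hp).dV_eq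
  have hn : ∀ p ∈ V, normal z p = l p := fun p hp => by
    have h1 : ‖l p‖ = 1 := (h.frame p hp).orthonormal.1 2
    have h2 := mul_pos (h.e_pos p hp) (h.g_pos p hp)
    rw [normal, zu p hp, zv p hp, cross_smul_smul, ← h.oriented p hp, norm_smul, h1,
      Real.norm_of_nonneg h2.le, mul_one, smul_smul, inv_mul_cancel₀ h2.ne', one_smul]
  have hE : ∀ p ∈ V, coefE z p = e p ^ 2 := fun p hp => by
    rw [coefE, zu p hp, real_inner_smul_left, real_inner_smul_right, (h.frame p hp).xx]; ring
  have hF : ∀ p ∈ V, coefF z p = 0 := fun p hp => by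
    rw [coefF, zu p hp, zv p hp, real_inner_smul_left, real_inner_smul_right, (h.frame p hp).xy]
    ring
  have hG : ∀ p ∈ V, coefG z p = g p ^ 2 := fun p hp => by
    rw [coefG, zv p hp, real_inner_smul_left, real_inner_smul_right, (h.frame p hp).yy]; ring
  have nn : ∀ p ∈ V, HasD (normal z) (-(k₁ p * e p) • x p) (-(k₂ p * g p) • y p) p :=
    fun p hp => (h.dl p hp).congr hV hp hn
  -- Differentiating `⟨a, l⟩ = 0` trades the second derivatives of `z` in the second fundamental
  -- form for the derivatives of the normal.
  have key : ∀ {a : ℝ × ℝ → E3} {a₁ a₂ : E3} {p}, p ∈ V → HasD a a₁ a₂ p →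
      (∀ q ∈ V, inner ℝ (a q) (l q) = (0 : ℝ)) →
      inner ℝ a₁ (normal z p) = k₁ p * e p * inner ℝ (a p) (x p) ∧
      inner ℝ a₂ (normal z p) = k₂ p * g p * inner ℝ (a p) (y p) := by
    intro a a₁ a₂ p hp ha hc
    have h1 := (hasD_const (0 : ℝ) p).congr hV hp (g := fun q => inner ℝ (a q) (normal z q))
      (fun q hq => by rw [hn q hq, hc q hq])
    have h2 := ha.inner (nn p hp)
    have e1 := h2.dU_eq.symm.trans h1.dU_eq
    have e2 := h2.dV_eq.symm.trans h1.dV_eq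
    rw [real_inner_smul_right] at e1 e2
    constructor <;> linarith
  have zul : ∀ q ∈ V, inner ℝ (dU z q) (l q) = (0 : ℝ) := fun q hq => by
    rw [zu q hq, real_inner_smul_left, (h.frame q hq).xl, mul_zero]
  have zvl : ∀ q ∈ V, inner ℝ (dV z q) (l q) = (0 : ℝ) := fun q hq => by
    rw [zv q hq, real_inner_smul_left, (h.frame q hq).yl, mul_zero]
  have hL : ∀ p ∈ V, coefL z p = k₁ p * e p ^ 2 := fun p hp => by
    rw [coefL, (key hp (hasD_of_smooth hV (contDiffOn_dU hV hz) hp) zul).1, zu p hp,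
      real_inner_smul_left, (h.frame p hp).xx]; ring
  have hM : ∀ p ∈ V, coefM z p = 0 := fun p hp => by
    rw [coefM, (key hp (hasD_of_smooth hV (contDiffOn_dV hV hz) hp) zvl).1, zv p hp,
      real_inner_smul_left, real_inner_comm, (h.frame p hp).xy]; ring
  have hN : ∀ p ∈ V, coefN z p = k₂ p * g p ^ 2 := fun p hp => by
    rw [coefN, (key hp (hasD_of_smooth hV (contDiffOn_dV hV hz) hp) zvl).2, zv p hp,
      real_inner_smul_left, (h.frame p hp).yy]; ring
  have n1 : ∀ p ∈ V, coefL z p / coefE z p = k₁ p := fun p hp => by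
    rw [hL p hp, hE p hp]
    exact mul_div_cancel_right₀ _ (pow_ne_zero 2 (h.e_pos p hp).ne')
  have n2 : ∀ p ∈ V, coefN z p / coefG z p = k₂ p := fun p hp => by
    rw [hN p hp, hG p hp]
    exact mul_div_cancel_right₀ _ (pow_ne_zero 2 (h.g_pos p hp).ne')
  refine { isOpen := hV, smooth := hz, regular := fun p hp => ?_, noUmbilic := fun p hp => ?_,
           orthogonal := hF, conjugate := hM, lenU_eq := fun p hp => ?_,
           lenV_eq := fun p hp => ?_, nu₁_eq := n1, nu₂_eq := n2 }
  · have hEp : coefE z p ≠ 0 := by rw [hE p hp]; exact pow_ne_zero 2 (h.e_pos p hp).ne'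
    have hGp : coefG z p ≠ 0 := by rw [hG p hp]; exact pow_ne_zero 2 (h.g_pos p hp).ne'
    have hFp := hF p hp
    unfold coefE at hEp; unfold coefF at hFp; unfold coefG at hGp
    refine LinearIndependent.pair_iff.2 fun s t hst => ⟨?_, ?_⟩
    · have := congrArg (fun a => (inner ℝ a (dU z p) : ℝ)) hst
      simp only [inner_add_left, real_inner_smul_left, real_inner_comm (dU z p) (dV z p), hFp,
        mul_zero, add_zero, inner_zero_left] at this
      exact (mul_eq_zero.1 this).resolve_right hEp
    · have := congrArg (fun a => (inner ℝ a (dV z p) : ℝ)) hst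
      simp only [inner_add_left, real_inner_smul_left, hFp, mul_zero, zero_add,
        inner_zero_left] at this
      exact (mul_eq_zero.1 this).resolve_right hGp
  · rintro ⟨k, e1, -, e2⟩
    have hEp : coefE z p ≠ 0 := by rw [hE p hp]; exact pow_ne_zero 2 (h.e_pos p hp).ne'
    have hGp : coefG z p ≠ 0 := by rw [hG p hp]; exact pow_ne_zero 2 (h.g_pos p hp).ne'
    refine h.ne p hp ?_
    rw [← n1 p hp, ← n2 p hp, e1, e2, mul_div_cancel_right₀ _ hEp, mul_div_cancel_right₀ _ hGp]
  · rw [lenU, hE p hp, Real.sqrt_sq (h.e_pos p hp).le]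
  · rw [lenV, hG p hp, Real.sqrt_sq (h.g_pos p hp).le]

/-- Here `σ`, `τ` are signs. The factor `σ τ` of the normal is the one compatible with the
orientation `l = x × y`. -/
theorem IsFrame.signed {x y l : E3} (h : IsFrame x y l) {σ τ : ℝ} (hσ : σ ^ 2 = 1)
    (hτ : τ ^ 2 = 1) : IsFrame (σ • x) (τ • y) ((σ * τ) • l) := by
  constructor <;> simp only [real_inner_smul_left, real_inner_smul_right, h.xx, h.yy, h.ll, h.xy,
    h.xl, h.yl, mul_zero]
  · linarith
  · linarith
  · linear_combination τ ^ 2 * hσ + hτ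

namespace IsMovingFrame
variable {z x y l : ℝ × ℝ → E3} {e g k₁ k₂ : ℝ × ℝ → ℝ} {D : Set (ℝ × ℝ)}
  (h : IsMovingFrame z x y l e g k₁ k₂ D)
include h

theorem mono {V : Set (ℝ × ℝ)} (hs : V ⊆ D) : IsMovingFrame z x y l e g k₁ k₂ V :=
  ⟨fun p hp => h.frame p (hs hp), fun p hp => h.oriented p (hs hp), fun p hp => h.e_pos p (hs hp),
    fun p hp => h.g_pos p (hs hp), fun p hp => h.dz p (hs hp), fun p hp => h.dl p (hs hp),
    fun p hp => h.ne p (hs hp)⟩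

/-- Change of the parameters of each family of parametric lines. -/
theorem diag {V : Set (ℝ × ℝ)} {U W U' W' : ℝ → ℝ} {σ τ : ℝ} (hσ : σ ^ 2 = 1) (hτ : τ ^ 2 = 1)
    (hm : ∀ q ∈ V, (U q.1, W q.2) ∈ D) (hU : ∀ q ∈ V, HasDerivAt U (U' q.1) q.1)
    (hW : ∀ q ∈ V, HasDerivAt W (W' q.2) q.2) (hU' : ∀ q ∈ V, 0 < σ * U' q.1)
    (hW' : ∀ q ∈ V, 0 < τ * W' q.2) :
    IsMovingFrame (fun q => z (U q.1, W q.2)) (fun q => σ • x (U q.1, W q.2))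
      (fun q => τ • y (U q.1, W q.2)) (fun q => (σ * τ) • l (U q.1, W q.2))
      (fun q => σ * U' q.1 * e (U q.1, W q.2)) (fun q => τ * W' q.2 * g (U q.1, W q.2))
      (fun q => σ * τ * k₁ (U q.1, W q.2)) (fun q => σ * τ * k₂ (U q.1, W q.2)) V where
  frame q hq := (h.frame _ (hm q hq)).signed hσ hτ
  oriented q hq := by rw [cross_smul_smul, h.oriented _ (hm q hq)]
  e_pos q hq := mul_pos (hU' q hq) (h.e_pos _ (hm q hq))
  g_pos q hq := mul_pos (hW' q hq) (h.g_pos _ (hm q hq))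
  dz q hq := by
    refine ((h.dz _ (hm q hq)).comp_param (φ₁ := fun q => U q.1) (φ₂ := fun q => W q.2)
      ((hasD_fst q).rcomp (hU q hq)) ((hasD_snd q).rcomp (hW q hq))).eq ?_ ?_
    · rw [smul_smul (σ * U' q.1 * _), show σ * U' q.1 * e (U q.1, W q.2) * σ =
        U' q.1 * e (U q.1, W q.2) by linear_combination (U' q.1 * e (U q.1, W q.2)) * hσ]
      simp only [smul_smul, mul_one, mul_zero, zero_smul, add_zero, zero_mul]
    · rw [smul_smul (τ * W' q.2 * _), show τ * W' q.2 * g (U q.1, W q.2) * τ =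
        W' q.2 * g (U q.1, W q.2) by linear_combination (W' q.2 * g (U q.1, W q.2)) * hτ]
      simp only [smul_smul, mul_one, mul_zero, zero_smul, zero_add, zero_mul]
  dl q hq := by
    refine ((hasD_const (σ * τ) q).smul ((h.dl _ (hm q hq)).comp_param (φ₁ := fun q => U q.1)
      (φ₂ := fun q => W q.2)
      ((hasD_fst q).rcomp (hU q hq)) ((hasD_snd q).rcomp (hW q hq)))).eq ?_ ?_
    · rw [smul_smul (-_) σ, show -(σ * τ * k₁ (U q.1, W q.2) * (σ * U' q.1 * e (U q.1, W q.2))) * σ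
        = σ * τ * (U' q.1 * -(k₁ (U q.1, W q.2) * e (U q.1, W q.2))) by
          linear_combination (-σ * τ * k₁ (U q.1, W q.2) * U' q.1 * e (U q.1, W q.2)) * hσ]
      simp only [smul_smul, mul_one, mul_zero, zero_smul, add_zero, zero_mul]
    · rw [smul_smul (-_) τ, show -(σ * τ * k₂ (U q.1, W q.2) * (τ * W' q.2 * g (U q.1, W q.2))) * τ
        = σ * τ * (W' q.2 * -(k₂ (U q.1, W q.2) * g (U q.1, W q.2))) by
          linear_combination (-σ * τ * k₂ (U q.1, W q.2) * W' q.2 * g (U q.1, W q.2)) * hτ]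
      simp only [smul_smul, mul_one, mul_zero, zero_smul, add_zero, zero_add, zero_mul]
  ne q hq hk := by
    have h0 : σ * τ ≠ 0 := by
      intro h0
      have : (σ * τ) ^ 2 = 1 := by rw [mul_pow, hσ, hτ, one_mul]
      rw [h0] at this; norm_num at this
    exact h.ne _ (hm q hq) (mul_left_cancel₀ h0 hk)

/-- Interchange of the two families of parametric lines. -/
theorem swap : IsMovingFrame (fun q => z (q.2, q.1)) (fun q => y (q.2, q.1)) (fun q => x (q.2, q.1))
    (fun q => -l (q.2, q.1)) (fun q => g (q.2, q.1)) (fun q => e (q.2, q.1))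
    (fun q => -k₂ (q.2, q.1)) (fun q => -k₁ (q.2, q.1)) {q | (q.2, q.1) ∈ D} where
  frame q hq := by
    have f := h.frame _ hq
    exact ⟨f.yy, f.xx, by rw [inner_neg_neg]; exact f.ll, (real_inner_comm _ _).trans f.xy,
      by rw [inner_neg_right, f.yl, neg_zero], by rw [inner_neg_right, f.xl, neg_zero]⟩
  oriented q hq := by rw [cross_swap, h.oriented _ hq]
  e_pos q hq := h.g_pos _ hq
  g_pos q hq := h.e_pos _ hq
  dz q hq := ((h.dz _ hq).comp_param (φ₁ := fun q => q.2) (φ₂ := fun q => q.1)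
    (hasD_snd q) (hasD_fst q)).eq (by simp) (by simp)
  dl q hq := ((h.dl _ hq).comp_param (φ₁ := fun q => q.2) (φ₂ := fun q => q.1)
    (hasD_snd q) (hasD_fst q)).neg.eq (by simp) (by simp)
  ne q hq hk := h.ne _ hq (by linarith)

/-- Parallel surfaces and homotheties. -/
theorem parallel {d c σ τ : ℝ} (hσ : σ ^ 2 = 1) (hτ : τ ^ 2 = 1) (hc : 0 < c)
    (h1 : ∀ p ∈ D, 0 < σ * (1 - d * k₁ p)) (h2 : ∀ p ∈ D, 0 < τ * (1 - d * k₂ p)) :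
    IsMovingFrame (fun p => c • (z p + d • l p)) (fun p => σ • x p) (fun p => τ • y p)
      (fun p => (σ * τ) • l p) (fun p => c * (σ * (1 - d * k₁ p)) * e p)
      (fun p => c * (τ * (1 - d * k₂ p)) * g p) (fun p => σ * τ * (k₁ p / (c * (1 - d * k₁ p))))
      (fun p => σ * τ * (k₂ p / (c * (1 - d * k₂ p)))) D where
  frame p hp := (h.frame _ hp).signed hσ hτ
  oriented p hp := by rw [cross_smul_smul, h.oriented _ hp]
  e_pos p hp := mul_pos (mul_pos hc (h1 p hp)) (h.e_pos p hp)
  g_pos p hp := mul_pos (mul_pos hc (h2 p hp)) (h.g_pos p hp)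
  dz p hp := by
    -- The derivative of `z + d l` in `u` is `e (1 - d k₁) x`; since `1 - d k₁` may be negative, `σ`
    -- moves its sign from the length to the unit vector.
    refine ((hasD_const c p).smul ((h.dz p hp).add ((hasD_const d p).smul (h.dl p hp)))).eq ?_ ?_
    · simp only [smul_smul, zero_smul, add_zero, ← add_smul]
      congr 1
      linear_combination (-c * e p * (1 - d * k₁ p)) * hσ
    · simp only [smul_smul, zero_smul, add_zero, ← add_smul]
      congr 1
      linear_combination (-c * g p * (1 - d * k₂ p)) * hτ
  dl p hp := by
    have e1 := right_ne_zero_of_mul (h1 p hp).ne'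
    have e2 := right_ne_zero_of_mul (h2 p hp).ne'
    refine ((hasD_const (σ * τ) p).smul (h.dl p hp)).eq ?_ ?_
    · rw [smul_smul (-_) σ, show -(σ * τ * (k₁ p / (c * (1 - d * k₁ p))) *
        (c * (σ * (1 - d * k₁ p)) * e p)) * σ = σ * τ * -(k₁ p * e p) by
          generalize 1 - d * k₁ p = r at e1
          field_simp
          linear_combination (-σ * τ * k₁ p * e p) * hσ]
      simp only [smul_smul, zero_smul, add_zero]
    · rw [smul_smul (-_) τ, show -(σ * τ * (k₂ p / (c * (1 - d * k₂ p))) *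
        (c * (τ * (1 - d * k₂ p)) * g p)) * τ = σ * τ * -(k₂ p * g p) by
          generalize 1 - d * k₂ p = r at e2
          field_simp
          linear_combination (-σ * τ * k₂ p * g p) * hτ]
      simp only [smul_smul, zero_smul, add_zero]
  ne p hp hk := by
    have e1 := right_ne_zero_of_mul (h1 p hp).ne'
    have e2 := right_ne_zero_of_mul (h2 p hp).ne'
    have h0 : σ * τ ≠ 0 := by
      intro h0
      have : (σ * τ) ^ 2 = 1 := by rw [mul_pow, hσ, hτ, one_mul]
      rw [h0] at this; norm_num at this
    have := mul_left_cancel₀ h0 hk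
    rw [div_eq_div_iff (mul_ne_zero hc.ne' e1) (mul_ne_zero hc.ne' e2)] at this
    refine h.ne p hp (mul_left_cancel₀ hc.ne' ?_)
    linear_combination this

end IsMovingFrame

/-! ### Changes of parameters -/

theorem IsReparam.comp {φ ψ : ℝ × ℝ → ℝ × ℝ} {V W D : Set (ℝ × ℝ)} (hφ : IsReparam φ W D)
    (hψ : IsReparam ψ V W) : IsReparam (φ ∘ ψ) V D where
  isOpen := hψ.isOpen
  smooth := hφ.smooth.comp hψ.smooth hψ.mapsTo
  injOn := hφ.injOn.comp hψ.injOn hψ.mapsTo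
  mapsTo := hφ.mapsTo.comp hψ.mapsTo
  regular q hq := by
    have h1 : DifferentiableAt ℝ ψ q := differentiableAt_of_smooth hψ.isOpen hψ.smooth hq
    have h2 : DifferentiableAt ℝ φ (ψ q) :=
      differentiableAt_of_smooth hφ.isOpen hφ.smooth (hψ.mapsTo hq)
    rw [fderiv_comp q h2 h1, ContinuousLinearMap.coe_comp]
    exact (hφ.regular _ (hψ.mapsTo hq)).comp (hψ.regular q hq)

theorem IsReparam.of_equiv (T : (ℝ × ℝ) ≃L[ℝ] (ℝ × ℝ)) {V D : Set (ℝ × ℝ)} (hV : IsOpen V)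
    (hm : Set.MapsTo T V D) : IsReparam T V D where
  isOpen := hV
  smooth := T.contDiff.contDiffOn
  injOn := T.injective.injOn
  mapsTo := hm
  regular q _ := by
    rw [T.fderiv]
    exact T.bijective

theorem IsReparam.inclusion {V D : Set (ℝ × ℝ)} (hV : IsOpen V) (hm : V ⊆ D) :
    IsReparam id V D :=
  IsReparam.of_equiv (ContinuousLinearEquiv.refl ℝ (ℝ × ℝ)) hV hm

theorem HasD.hasDerivAt_left {F : Type*} [NormedAddCommGroup F] [NormedSpace ℝ F]
    {f : ℝ × ℝ → F} {a b : F} {u v : ℝ} (h : HasD f a b (u, v)) :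
    HasDerivAt (fun s => f (s, v)) a u := by
  have := HasFDerivAt.comp_hasDerivAt (f := fun s : ℝ => (s, v)) u h
    ((hasDerivAt_id u).prodMk (hasDerivAt_const u v))
  exact this.congr_deriv (by simp)

theorem HasD.hasDerivAt_right {F : Type*} [NormedAddCommGroup F] [NormedSpace ℝ F]
    {f : ℝ × ℝ → F} {a b : F} {u v : ℝ} (h : HasD f a b (u, v)) :
    HasDerivAt (fun s => f (u, s)) b v := by
  have := HasFDerivAt.comp_hasDerivAt (f := fun s : ℝ => (u, s)) v h
    ((hasDerivAt_const v u).prodMk (hasDerivAt_id v))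
  exact this.congr_deriv (by simp)

theorem IsReparam.diag {A B : Set ℝ} (hA : IsOpen A) (hB : IsOpen B) (cA : Convex ℝ A)
    (cB : Convex ℝ B) {U W U' W' : ℝ → ℝ} {D : Set (ℝ × ℝ)} (sU : ContDiffOn ℝ ∞ U A)
    (sW : ContDiffOn ℝ ∞ W B) (hU : ∀ t ∈ A, HasDerivAt U (U' t) t)
    (hW : ∀ t ∈ B, HasDerivAt W (W' t) t) (pU : ∀ t ∈ A, 0 < U' t) (pW : ∀ t ∈ B, 0 < W' t)
    (hm : ∀ q ∈ A ×ˢ B, (U q.1, W q.2) ∈ D) :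
    IsReparam (fun q => (U q.1, W q.2)) (A ×ˢ B) D where
  isOpen := hA.prod hB
  smooth := (sU.comp contDiffOn_fst fun _ hq => hq.1).prodMk
    (sW.comp contDiffOn_snd fun _ hq => hq.2)
  injOn := by
    have mU : StrictMonoOn U A := strictMonoOn_of_deriv_pos cA sU.continuousOn fun t ht => by
      rw [hA.interior_eq] at ht; rw [(hU t ht).deriv]; exact pU t ht
    have mW : StrictMonoOn W B := strictMonoOn_of_deriv_pos cB sW.continuousOn fun t ht => by
      rw [hB.interior_eq] at ht; rw [(hW t ht).deriv]; exact pW t ht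
    intro q hq r hr e
    exact Prod.ext (mU.injOn hq.1 hr.1 (Prod.ext_iff.1 e).1) (mW.injOn hq.2 hr.2 (Prod.ext_iff.1 e).2)
  mapsTo := hm
  regular q hq := by
    have h1 : HasFDerivAt (fun q : ℝ × ℝ => (U q.1, W q.2)) _ q :=
      (((hasD_fst q).rcomp (hU q.1 hq.1) : HasFDerivAt _ _ q)).prodMk
      (((hasD_snd q).rcomp (hW q.2 hq.2) : HasFDerivAt _ _ q))
    have e1 := (pU q.1 hq.1).ne'
    have e2 := (pW q.2 hq.2).ne'
    rw [h1.fderiv]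
    constructor
    · intro x y hxy
      simp only [ContinuousLinearMap.prod_apply, add_apply,
        ContinuousLinearMap.smulRight_apply, ContinuousLinearMap.coe_fst',
        ContinuousLinearMap.coe_snd', smul_eq_mul, mul_one, mul_zero, add_zero, zero_add,
        Prod.mk.injEq] at hxy
      exact Prod.ext (mul_right_cancel₀ e1 hxy.1) (mul_right_cancel₀ e2 hxy.2)
    · intro y
      refine ⟨(y.1 / U' q.1, y.2 / W' q.2), ?_⟩
      simp only [ContinuousLinearMap.prod_apply, add_apply,
        ContinuousLinearMap.smulRight_apply, ContinuousLinearMap.coe_fst',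
        ContinuousLinearMap.coe_snd', smul_eq_mul, mul_one, mul_zero, add_zero, zero_add]
      rw [div_mul_cancel₀ _ e1, div_mul_cancel₀ _ e2]

/-- An autonomous equation on the line has a smooth local solution. -/
theorem exists_smooth_solution {k : ℝ → ℝ} {S : Set ℝ} (hS : IsOpen S) (hk : ContDiffOn ℝ ∞ k S)
    {u₀ : ℝ} (h₀ : u₀ ∈ S) : ∃ ε > 0, ∃ U : ℝ → ℝ, U 0 = u₀ ∧
      (∀ t ∈ Set.Ioo (-ε) ε, U t ∈ S ∧ HasDerivAt U (k (U t)) t) ∧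
      ContDiffOn ℝ ∞ U (Set.Ioo (-ε) ε) := by
  obtain ⟨U, hU0, ε, hε, hU⟩ :=
    ((hk.contDiffAt (hS.mem_nhds h₀)).of_le (by simp : (1 : WithTop ℕ∞) ≤ ∞)
      ).exists_forall_mem_closedBall_exists_eq_forall_mem_Ioo_hasDerivAt₀ 0
  rw [zero_sub, zero_add] at hU
  have hcont : ContinuousAt U 0 := (hU 0 ⟨by linarith, hε⟩).continuousAt
  have hev : ∀ᶠ t in nhds 0, U t ∈ S := hcont (hS.mem_nhds (by rwa [hU0]))
  obtain ⟨δ, hδ, hδS⟩ := Metric.eventually_nhds_iff_ball.1 hev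
  have hsub : ∀ t ∈ Set.Ioo (-min ε δ) (min ε δ), U t ∈ S ∧ HasDerivAt U (k (U t)) t := by
    intro t ht
    have h1 := min_le_left ε δ
    have h2 := min_le_right ε δ
    refine ⟨hδS t ?_, hU t ⟨by linarith [ht.1], by linarith [ht.2]⟩⟩
    rw [Metric.mem_ball, dist_zero_right, Real.norm_eq_abs, abs_lt]
    exact ⟨by linarith [ht.1], by linarith [ht.2]⟩
  refine ⟨min ε δ, lt_min hε hδ, U, hU0, hsub, contDiffOn_infty.2 fun n => ?_⟩
  have hd : ∀ t ∈ Set.Ioo (-min ε δ) (min ε δ), DifferentiableWithinAt ℝ U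
      (Set.Ioo (-min ε δ) (min ε δ)) t :=
    fun t ht => (hsub t ht).2.differentiableAt.differentiableWithinAt
  -- Bootstrap: if `U` is of class `C^n`, so is its derivative `k ∘ U`.
  induction n with
  | zero => exact contDiffOn_zero.2 fun t ht => (hd t ht).continuousWithinAt
  | succ n ih =>
    push_cast
    refine (contDiffOn_succ_iff_deriv_of_isOpen isOpen_Ioo).2 ⟨hd, by simp, ?_⟩
    refine (((hk.of_le (by norm_cast; simp)).comp ih fun t ht => (hsub t ht).1 :
      ContDiffOn ℝ n (k ∘ U) _)).congr fun t ht => (hsub t ht).2.deriv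

theorem ball_eq_prod (p : ℝ × ℝ) (r : ℝ) :
    Metric.ball p r = Metric.ball p.1 r ×ˢ Metric.ball p.2 r := by
  rw [ball_prod_same]

/-- Existence of natural principal parameters. -/
theorem IsPrincipalSurface.exists_natural {z : ℝ × ℝ → E3} {D : Set (ℝ × ℝ)}
    (hz : IsPrincipalSurface z D) {f g : ℝ → ℝ} {J : Set ℝ} (h : IsWeingartenPair f g J)
    (hJ : IsOpen J) (hc : J.OrdConnected) {lam : ℝ × ℝ → ℝ} (hl : ContDiffOn ℝ ∞ lam D)
    (hm : Set.MapsTo lam D J) (hf : ∀ p ∈ D, coefL z p / coefE z p = f (lam p))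
    (hg : ∀ p ∈ D, coefN z p / coefG z p = g (lam p)) {p : ℝ × ℝ} (hp : p ∈ D) {a b : ℝ}
    (ha : a ≠ 0) (hb : b ≠ 0) :
    ∃ ε > 0, ∃ U W U' W' : ℝ → ℝ, (U 0, W 0) = p ∧
      ContDiffOn ℝ ∞ U (Set.Ioo (-ε) ε) ∧ ContDiffOn ℝ ∞ W (Set.Ioo (-ε) ε) ∧
      (∀ t ∈ Set.Ioo (-ε) ε, HasDerivAt U (U' t) t ∧ 0 < U' t) ∧
      (∀ t ∈ Set.Ioo (-ε) ε, HasDerivAt W (W' t) t ∧ 0 < W' t) ∧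
      ∀ q ∈ Set.Ioo (-ε) ε ×ˢ Set.Ioo (-ε) ε, (U q.1, W q.2) ∈ D ∧
        U' q.1 * lenU z (U q.1, W q.2) = natLen f g a (lam p) (lam (U q.1, W q.2)) ∧
        W' q.2 * lenV z (U q.1, W q.2) = natLen g f b (lam p) (lam (U q.1, W q.2)) := by
  obtain ⟨r, hr, hrD⟩ := Metric.isOpen_iff.1 hz.isOpen p hp
  rw [ball_eq_prod] at hrD
  obtain ⟨u₀, v₀⟩ := p
  set t₀ := lam (u₀, v₀)
  have h₀ : t₀ ∈ J := hm hp
  have hu₀ : u₀ ∈ Metric.ball u₀ r := Metric.mem_ball_self hr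
  have hv₀ : v₀ ∈ Metric.ball v₀ r := Metric.mem_ball_self hr
  set P : ℝ × ℝ → ℝ := fun q => lenU z q * Real.exp (wInt f g t₀ (lam q)) with hP
  set Q : ℝ × ℝ → ℝ := fun q => lenV z q * Real.exp (wInt g f t₀ (lam q)) with hQ
  have sP : ContDiffOn ℝ ∞ P D := hz.smooth_lenU.mul ((h.smooth_wInt_f hJ hc h₀).comp hl hm).exp
  have sQ : ContDiffOn ℝ ∞ Q D := hz.smooth_lenV.mul ((h.smooth_wInt_g hJ hc h₀).comp hl hm).exp
  have P0 : ∀ q ∈ D, 0 < P q := fun q hq => mul_pos (hz.lenU_pos hq) (Real.exp_pos _)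
  have Q0 : ∀ q ∈ D, 0 < Q q := fun q hq => mul_pos (hz.lenV_pos hq) (Real.exp_pos _)
  have hconst := fun q (hq : q ∈ D) => hz.natural_const h hJ hc h₀ hl hm hf hg hq
  -- Vanishing of the partial derivative makes `P` independent of `v` on the vertical segments of
  -- the square ball; likewise `Q` does not depend on `u`.
  have cP : ∀ u ∈ Metric.ball u₀ r, ∀ v ∈ Metric.ball v₀ r, P (u, v) = P (u, v₀) := by
    intro u hu v hv
    have hd : ∀ s ∈ Metric.ball v₀ r, HasDerivAt (fun s => P (u, s)) 0 s := fun s hs => by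
      have h1 := hasD_of_smooth hz.isOpen sP (hrD ⟨hu, hs⟩ : (u, s) ∈ D)
      rw [(hconst (u, s) (hrD ⟨hu, hs⟩)).1] at h1
      exact h1.hasDerivAt_right
    exact Metric.isOpen_ball.is_const_of_deriv_eq_zero (convex_ball v₀ r).isPreconnected
      (fun s hs => (hd s hs).differentiableAt.differentiableWithinAt)
      (fun s hs => (hd s hs).deriv) hv hv₀
  have cQ : ∀ u ∈ Metric.ball u₀ r, ∀ v ∈ Metric.ball v₀ r, Q (u, v) = Q (u₀, v) := by
    intro u hu v hv
    have hd : ∀ s ∈ Metric.ball u₀ r, HasDerivAt (fun s => Q (s, v)) 0 s := fun s hs => by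
      have h1 := hasD_of_smooth hz.isOpen sQ (hrD ⟨hs, hv⟩ : (s, v) ∈ D)
      rw [(hconst (s, v) (hrD ⟨hs, hv⟩)).2] at h1
      exact h1.hasDerivAt_left
    exact Metric.isOpen_ball.is_const_of_deriv_eq_zero (convex_ball u₀ r).isPreconnected
      (fun s hs => (hd s hs).differentiableAt.differentiableWithinAt)
      (fun s hs => (hd s hs).deriv) hu hu₀
  -- Naturality demands `U' P(U, v₀) = 1/|a|`, an autonomous equation for the new parameter;
  -- similarly for `W`.
  have sk : ContDiffOn ℝ ∞ (fun u => (|a| * P (u, v₀))⁻¹) (Metric.ball u₀ r) := by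
    refine (contDiffOn_const.mul (sP.comp (contDiffOn_id.prodMk contDiffOn_const)
      fun u hu => hrD ⟨hu, hv₀⟩)).inv fun u hu => ?_
    exact (mul_pos (abs_pos.2 ha) (P0 (u, v₀) (hrD ⟨hu, hv₀⟩))).ne'
  have sm : ContDiffOn ℝ ∞ (fun v => (|b| * Q (u₀, v))⁻¹) (Metric.ball v₀ r) := by
    refine (contDiffOn_const.mul (sQ.comp (contDiffOn_const.prodMk contDiffOn_id)
      fun v hv => hrD ⟨hu₀, hv⟩)).inv fun v hv => ?_
    exact (mul_pos (abs_pos.2 hb) (Q0 (u₀, v) (hrD ⟨hu₀, hv⟩))).ne'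
  obtain ⟨ε₁, hε₁, U, U0, hU, sU⟩ := exists_smooth_solution Metric.isOpen_ball sk hu₀
  obtain ⟨ε₂, hε₂, W, W0, hW, sW⟩ := exists_smooth_solution Metric.isOpen_ball sm hv₀
  have i1 : Set.Ioo (-min ε₁ ε₂) (min ε₁ ε₂) ⊆ Set.Ioo (-ε₁) ε₁ :=
    Set.Ioo_subset_Ioo (neg_le_neg (min_le_left _ _)) (min_le_left _ _)
  have i2 : Set.Ioo (-min ε₁ ε₂) (min ε₁ ε₂) ⊆ Set.Ioo (-ε₂) ε₂ :=
    Set.Ioo_subset_Ioo (neg_le_neg (min_le_right _ _)) (min_le_right _ _)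
  refine ⟨min ε₁ ε₂, lt_min hε₁ hε₂, U, W, fun t => (|a| * P (U t, v₀))⁻¹,
    fun t => (|b| * Q (u₀, W t))⁻¹, by rw [U0, W0], sU.mono i1, sW.mono i2,
    fun t ht => ⟨(hU t (i1 ht)).2, ?_⟩, fun t ht => ⟨(hW t (i2 ht)).2, ?_⟩, fun q hq => ?_⟩
  · exact inv_pos.2 (mul_pos (abs_pos.2 ha) (P0 _ (hrD ⟨(hU t (i1 ht)).1, hv₀⟩)))
  · exact inv_pos.2 (mul_pos (abs_pos.2 hb) (Q0 _ (hrD ⟨hu₀, (hW t (i2 ht)).1⟩)))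
  · have hUm := (hU q.1 (i1 hq.1)).1
    have hWm := (hW q.2 (i2 hq.2)).1
    have hD : (U q.1, W q.2) ∈ D := hrD ⟨hUm, hWm⟩
    refine ⟨hD, eq_natLen_iff.1 ?_, eq_natLen_iff.1 ?_⟩
    · rw [mul_assoc]
      change (|a| * P (U q.1, v₀))⁻¹ * P (U q.1, W q.2) = _
      rw [cP _ hUm _ hWm, mul_inv, mul_assoc, inv_mul_cancel₀ (P0 _ (hrD ⟨hUm, hv₀⟩)).ne', mul_one]
    · rw [mul_assoc]
      change (|b| * Q (u₀, W q.2))⁻¹ * Q (U q.1, W q.2) = _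
      rw [cQ _ hUm _ hWm, mul_inv, mul_assoc, inv_mul_cancel₀ (Q0 _ (hrD ⟨hu₀, hWm⟩)).ne', mul_one]

/-! ### Recovering the parameter of a class from the principal curvatures. -/

namespace BasicClass

/-- The parameter of a basic class as a function of the principal curvatures. -/
def param : BasicClass → ℝ → ℝ → ℝ
  | c1, a, _ => Real.log a
  | c2, a, _ => Real.log (2 * a - 1)
  | c3, _, b => b
  | c4 β, a, b => |β - 1| * ((a - b) / 2)
  | c5 β, a, b => |β - 1| * ((a - b) / 2)
  | c6 _, a, b => a - b
  | c7 _, a, b => a - b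
  | c8, a, _ => 2 * Real.arctan a
  | c9, a, _ => 2 - 2 / a
  | c10 _ _, a, _ => a

theorem relation_nu {C : BasicClass} (hC : C.Admissible) {t : ℝ} (ht : t ∈ C.range) :
    C.Relation (C.nu₁ t * C.nu₂ t) ((C.nu₁ t + C.nu₂ t) / 2) ((C.nu₁ t - C.nu₂ t) / 2) := by
  cases C <;> simp only [Relation, nu₁, nu₂]
  case c1 => ring
  case c2 => ring
  case c3 => ring
  case c4 β =>
    have := abs_ne_zero.2 (Admissible.beta_sub_ne (Or.inl hC))
    field_simp; ring
  case c5 β =>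
    have := abs_ne_zero.2 (Admissible.beta_sub_ne (Or.inr hC.1))
    field_simp; ring
  case c6 β => ring
  case c7 β => ring
  case c8 =>
    have : Real.tan (t / 2) ≠ 0 := by
      rw [Real.tan_eq_sin_div_cos]
      exact (div_pos (half_sin_pos ht) (half_cos_pos ht)).ne'
    field_simp
  case c9 =>
    have h1 := c9_prod_pos ht
    have h2 : t - 2 ≠ 0 := fun h => by
      rw [show (2 : ℝ) - t = 0 by linarith, zero_mul] at h1; exact lt_irrefl _ h1
    have h3 := right_ne_zero_of_mul h1.ne'
    field_simp; ring
  case c10 β γ =>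
    have := div_mul_cancel₀ (β * t + 2 * γ) (show 0 < 2 * t + β from ht).ne'
    linear_combination this / 2

/-- The relation together with `b < a` forces the parameter into the admitted range. For `K = -1`
the order gives `a > 0`; for class 10 it gives `2a + β > 0` through `(a - b)(2a + β) = 2(a² - γ)`.
-/
theorem param_spec {C : BasicClass} (hC : C.Admissible) {a b : ℝ} (hab : b < a)
    (h : C.Relation (a * b) ((a + b) / 2) ((a - b) / 2)) :
    C.param a b ∈ C.range ∧ C.nu₁ (C.param a b) = a ∧ C.nu₂ (C.param a b) = b := by
  cases C <;> simp only [Relation] at h <;> simp only [range, nu₁, nu₂, param]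
  case c1 =>
    have h0 : 0 < a := by linarith
    exact ⟨trivial, Real.exp_log h0, by rw [Real.exp_log h0]; linarith⟩
  case c2 =>
    have h0 : 0 < 2 * a - 1 := by linarith
    rw [Real.exp_log h0]
    exact ⟨trivial, by ring, by linarith⟩
  case c3 => exact ⟨trivial, by linarith, trivial⟩
  case c4 β =>
    have h0 := abs_pos.2 (Admissible.beta_sub_ne (Or.inl hC))
    refine ⟨mul_pos h0 (by linarith), ?_, ?_⟩ <;> field_simp <;> linarith
  case c5 β =>
    have h0 := abs_pos.2 (Admissible.beta_sub_ne (Or.inr hC.1))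
    refine ⟨mul_pos h0 (by linarith), ?_, ?_⟩ <;> field_simp <;> linarith
  case c6 β => exact ⟨sub_pos.2 hab, by linarith, by linarith⟩
  case c7 β => exact ⟨sub_pos.2 hab, by linarith, by linarith⟩
  case c8 =>
    have h0 : 0 < a := by
      by_contra hn
      have : 0 ≤ a * b := mul_nonneg_of_nonpos_of_nonpos (not_lt.1 hn) (hab.le.trans (not_lt.1 hn))
      linarith
    have h1 := Real.arctan_pos.2 h0
    have h2 := Real.arctan_lt_pi_div_two a
    rw [mul_div_cancel_left₀ _ (two_ne_zero' ℝ), Real.tan_arctan]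
    refine ⟨⟨by linarith, by linarith⟩, rfl, ?_⟩
    field_simp; linarith
  case c9 =>
    have h0 : a ≠ 0 := by rintro rfl; linarith
    have e : b * (a + 1) = a := by linarith
    -- The relation is `b (a + 1) = a`, whence `(a - b)(a + 1) = a²`.
    have h1 : 0 < a + 1 := by
      by_contra hn
      rcases eq_or_lt_of_le (not_lt.1 hn) with h2 | h2
      · rw [h2, mul_zero] at e; exact h0 e.symm
      · have : (a - b) * (a + 1) = a ^ 2 := by linear_combination -e
        nlinarith [sq_nonneg a, mul_pos (sub_pos.2 hab) (neg_pos.2 h2)]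
    refine ⟨?_, ?_, ?_⟩
    -- The two components of the range correspond to the sign of `a`: `-1 < a < 0` gives `t > 4` and
    -- `a > 0` gives `t < 2`.
    · rcases lt_or_gt_of_ne h0 with h2 | h2
      · right
        have : 2 < 2 / -a := by rw [lt_div_iff₀ (by linarith)]; linarith
        rw [div_neg] at this; linarith
      · left
        have := div_pos two_pos h2
        linarith
    · rw [show 2 - 2 / a - 2 = -(2 / a) by ring]
      field_simp; ring
    · rw [show 4 - (2 - 2 / a) = 2 * (a + 1) / a by field_simp; ring, eq_comm, ← e]
      have : b * (a + 1) ≠ 0 := by rwa [e]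
      have h3 := h1.ne'
      rw [div_div_eq_mul_div, eq_div_iff (by rw [e]; positivity), e]
      linear_combination 2 * e
  case c10 β γ =>
    have e : b * (2 * a + β) = β * a + 2 * γ := by linarith
    have e2 : (a - b) * (2 * a + β) = 2 * a ^ 2 - 2 * γ := by linear_combination -e
    have hγ : γ < 0 := hC.2
    have h0 : 0 < 2 * a + β := by
      refine pos_of_mul_pos_right (a := a - b) ?_ (sub_pos.2 hab).le
      rw [e2]; linarith [sq_nonneg a]
    exact ⟨h0, trivial, by rw [div_eq_iff h0.ne']; exact e.symm⟩

theorem smooth_param {C : BasicClass} (hC : C.Admissible) {D : Set (ℝ × ℝ)} {a b : ℝ × ℝ → ℝ}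
    (ha : ContDiffOn ℝ ∞ a D) (hb : ContDiffOn ℝ ∞ b D) (hab : ∀ p ∈ D, b p < a p)
    (h : ∀ p ∈ D, C.Relation (a p * b p) ((a p + b p) / 2) ((a p - b p) / 2)) :
    ContDiffOn ℝ ∞ (fun p => C.param (a p) (b p)) D := by
  have hs := fun p hp => param_spec hC (hab p hp) (h p hp)
  cases C <;> simp only [Relation] at h <;> simp only [param] at hs ⊢
  case c1 =>
    exact ha.log fun p hp => by have := hab p hp; have := h p hp; linarith
  case c2 =>
    refine ((contDiffOn_const.mul ha).sub contDiffOn_const).log fun p hp => ?_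
    have := hab p hp; have := h p hp; linarith
  case c3 => exact hb
  case c4 β => exact contDiffOn_const.mul ((ha.sub hb).div_const 2)
  case c5 β => exact contDiffOn_const.mul ((ha.sub hb).div_const 2)
  case c6 β => exact ha.sub hb
  case c7 β => exact ha.sub hb
  case c8 => exact contDiffOn_const.mul ha.arctan
  case c9 =>
    refine contDiffOn_const.sub (contDiffOn_const.div ha fun p hp h0 => ?_)
    have := h p hp
    have := hab p hp
    rw [h0] at *; linarith
  case c10 β γ => exact ha

end BasicClass

/-! ### Weingarten functions of parallel surfaces -/

section Parallel

/-- The Weingarten function of a parallel surface. -/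
def parFun (m κ : ℝ) (F : ℝ → ℝ) (t : ℝ) : ℝ := m * F t / (1 + κ * F t)

variable {F G : ℝ → ℝ} {I : Set ℝ} (h : IsWeingartenPair F G I) (hI : IsOpen I) {m κ : ℝ}
  (hm : ∀ t ∈ I, 0 < m * ((1 + κ * F t) * (1 + κ * G t))) (hc : I.OrdConnected)

theorem parFun_hasDerivAt {F : ℝ → ℝ} {F' : ℝ} {t : ℝ} (m κ : ℝ) (hF : HasDerivAt F F' t)
    (h0 : 1 + κ * F t ≠ 0) : HasDerivAt (parFun m κ F) (m * F' / (1 + κ * F t) ^ 2) t := by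
  refine ((hF.const_mul m).div ((hF.const_mul κ).const_add 1) h0).congr_deriv ?_
  field_simp; ring

theorem parFun_deriv_hasDerivAt {F : ℝ → ℝ} {F'' : ℝ} {t : ℝ} {I : Set ℝ} (m κ : ℝ)
    (hI : IsOpen I) (hF : ∀ t ∈ I, HasDerivAt F (deriv F t) t)
    (hF' : HasDerivAt (deriv F) F'' t) (h0 : ∀ t ∈ I, 1 + κ * F t ≠ 0) (ht : t ∈ I) :
    HasDerivAt (deriv (parFun m κ F))
      (m * (F'' / (1 + κ * F t) ^ 2 - 2 * κ * deriv F t ^ 2 / (1 + κ * F t) ^ 3)) t := by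
  have h1 : HasDerivAt (fun t => m * deriv F t / (1 + κ * F t) ^ 2) _ t :=
    (hF'.const_mul m).fun_div ((((hF t ht).const_mul κ).const_add 1).fun_pow 2)
      (pow_ne_zero 2 (h0 t ht))
  refine (h1.congr_of_eventuallyEq ?_).congr_deriv ?_
  · filter_upwards [hI.mem_nhds ht] with s hs
    exact (parFun_hasDerivAt m κ (hF s hs) (h0 s hs)).deriv
  · have := h0 t ht
    field_simp; ring

/-- Passing to the parallel surface changes the integrand `F'/(F-G)` by `-κF'/(1+κF)`, a logarithmic
derivative. Hence `1 + κF` times the exponential of the difference of the integrals is constant on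
the interval `I`. The order of `F` and `G` is left open so that both integrals are covered. -/
theorem exp_wInt_parFun_aux {F G : ℝ → ℝ} {I : Set ℝ} (hI : IsOpen I) (hc : I.OrdConnected)
    {m κ : ℝ} (hF : ∀ s ∈ I, HasDerivAt F (deriv F s) s) (h0 : m ≠ 0)
    (h1 : ∀ s ∈ I, 1 + κ * F s ≠ 0) (h2 : ∀ s ∈ I, 1 + κ * G s ≠ 0) (h3 : ∀ s ∈ I, F s - G s ≠ 0)
    {t₀ t : ℝ} (h₀ : t₀ ∈ I) (ht : t ∈ I)
    (d1 : ∀ s ∈ I, HasDerivAt (wInt F G t₀) (deriv F s / (F s - G s)) s)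
    (d2 : ∀ s ∈ I, HasDerivAt (wInt (parFun m κ F) (parFun m κ G) t₀)
      (deriv (parFun m κ F) s / (parFun m κ F s - parFun m κ G s)) s) :
    Real.exp (wInt (parFun m κ F) (parFun m κ G) t₀ t) =
      Real.exp (wInt F G t₀ t) * ((1 + κ * F t₀) / (1 + κ * F t)) := by
  have key : ∀ s ∈ I, HasDerivAt (fun s => (1 + κ * F s) *
      Real.exp (wInt (parFun m κ F) (parFun m κ G) t₀ s - wInt F G t₀ s)) 0 s := by
    intro s hs
    have e1 := h1 s hs
    have e2 := h2 s hs
    have e3 := h3 s hs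
    refine ((((hF s hs).const_mul κ).const_add 1).mul
      ((d2 s hs).fun_sub (d1 s hs)).exp).congr_deriv ?_
    rw [(parFun_hasDerivAt m κ (hF s hs) e1).deriv, parFun, parFun, div_sub_div _ _ e1 e2,
      show m * F s * (1 + κ * G s) - (1 + κ * F s) * (m * G s) = m * (F s - G s) by ring]
    have e4 : m * deriv F s / (1 + κ * F s) ^ 2 /
        (m * (F s - G s) / ((1 + κ * F s) * (1 + κ * G s))) - deriv F s / (F s - G s) =
        -(κ * deriv F s) / (1 + κ * F s) := by
      have e5 : 1 + κ * G s = (1 + κ * F s) - κ * (F s - G s) := by ring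
      rw [e5] at e2 ⊢
      generalize F s - G s = y at e2 e3 ⊢
      generalize 1 + κ * F s = x at e1 e2 ⊢
      field_simp
      ring
    rw [e4]
    field_simp
    ring
  have hcst := hI.is_const_of_deriv_eq_zero hc.isPreconnected
    (fun s hs => (key s hs).differentiableAt.differentiableWithinAt)
    (fun s hs => (key s hs).deriv) ht h₀
  simp only [wInt_self, sub_self, Real.exp_zero, mul_one] at hcst
  rw [Real.exp_sub] at hcst
  have e1 := h1 t ht
  field_simp at hcst ⊢
  linear_combination hcst

include h hm

theorem parFun_pos_ne {t : ℝ} (ht : t ∈ I) :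
    m ≠ 0 ∧ 1 + κ * F t ≠ 0 ∧ 1 + κ * G t ≠ 0 ∧ F t - G t ≠ 0 := by
  have h1 := (hm t ht).ne'
  have h2 := right_ne_zero_of_mul h1
  exact ⟨left_ne_zero_of_mul h1, left_ne_zero_of_mul h2, right_ne_zero_of_mul h2,
    (sub_pos.2 (h.lt t ht)).ne'⟩

theorem parFun_sub {t : ℝ} (ht : t ∈ I) : parFun m κ F t - parFun m κ G t =
    m * (F t - G t) / ((1 + κ * F t) * (1 + κ * G t)) := by
  obtain ⟨-, h1, h2, -⟩ := parFun_pos_ne h hm ht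
  rw [parFun, parFun, div_sub_div _ _ h1 h2]
  congr 1; ring

include hI

/-- The new difference is `m (F - G) / ((1 + κF)(1 + κG))`, so `hm` expresses that the first
function remains the larger one. -/
theorem IsWeingartenPair.parallel : IsWeingartenPair (parFun m κ F) (parFun m κ G) I where
  smooth_f := (contDiffOn_const.mul h.smooth_f).div
    (contDiffOn_const.add (contDiffOn_const.mul h.smooth_f))
    fun t ht => (parFun_pos_ne h hm ht).2.1
  smooth_g := (contDiffOn_const.mul h.smooth_g).div
    (contDiffOn_const.add (contDiffOn_const.mul h.smooth_g))
    fun t ht => (parFun_pos_ne h hm ht).2.2.1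
  lt t ht := by
    obtain ⟨h0, h1, h2, h3⟩ := parFun_pos_ne h hm ht
    rw [← sub_pos, parFun_sub h hm ht]
    have := hm t ht
    have h4 := sub_pos.2 (h.lt t ht)
    rw [show m * (F t - G t) / ((1 + κ * F t) * (1 + κ * G t)) =
      m * ((1 + κ * F t) * (1 + κ * G t)) * (F t - G t) / ((1 + κ * F t) * (1 + κ * G t)) ^ 2 by
        field_simp]
    positivity
  deriv_f t ht := by
    obtain ⟨h0, h1, h2, h3⟩ := parFun_pos_ne h hm ht
    rw [(parFun_hasDerivAt m κ (h.hasDerivAt_f hI ht) h1).deriv]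
    exact div_ne_zero (mul_ne_zero h0 (h.deriv_f t ht)) (pow_ne_zero 2 h1)
  deriv_g t ht := by
    obtain ⟨h0, h1, h2, h3⟩ := parFun_pos_ne h hm ht
    rw [(parFun_hasDerivAt m κ (h.hasDerivAt_g hI ht) h2).deriv]
    exact div_ne_zero (mul_ne_zero h0 (h.deriv_g t ht)) (pow_ne_zero 2 h2)

include hc
omit hI hc in
theorem parFun_ne_all : (∀ t ∈ I, 1 + κ * F t ≠ 0) ∧ (∀ t ∈ I, 1 + κ * G t ≠ 0) ∧
    ∀ t ∈ I, F t - G t ≠ 0 :=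
  ⟨fun _ ht => (parFun_pos_ne h hm ht).2.1, fun _ ht => (parFun_pos_ne h hm ht).2.2.1,
    fun _ ht => (parFun_pos_ne h hm ht).2.2.2⟩

theorem exp_wInt_parFun_f {t₀ t : ℝ} (h₀ : t₀ ∈ I) (ht : t ∈ I) :
    Real.exp (wInt (parFun m κ F) (parFun m κ G) t₀ t) =
      Real.exp (wInt F G t₀ t) * ((1 + κ * F t₀) / (1 + κ * F t)) := by
  obtain ⟨h1, h2, h3⟩ := parFun_ne_all h hm
  exact exp_wInt_parFun_aux hI hc (fun s hs => h.hasDerivAt_f hI hs) (parFun_pos_ne h hm ht).1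
    h1 h2 h3 h₀ ht (fun s hs => h.hasDerivAt_wInt_f hI (hc.uIcc_subset h₀ hs))
    fun s hs => (h.parallel hI hm).hasDerivAt_wInt_f hI (hc.uIcc_subset h₀ hs)

theorem exp_wInt_parFun_g {t₀ t : ℝ} (h₀ : t₀ ∈ I) (ht : t ∈ I) :
    Real.exp (wInt (parFun m κ G) (parFun m κ F) t₀ t) =
      Real.exp (wInt G F t₀ t) * ((1 + κ * G t₀) / (1 + κ * G t)) := by
  obtain ⟨h1, h2, h3⟩ := parFun_ne_all h hm
  exact exp_wInt_parFun_aux hI hc (fun s hs => h.hasDerivAt_g hI hs) (parFun_pos_ne h hm ht).1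
    h2 h1 (fun s hs => by rw [← neg_sub]; exact neg_ne_zero.2 (h3 s hs)) h₀ ht
    (fun s hs => h.hasDerivAt_wInt_g hI (hc.uIcc_subset h₀ hs))
    fun s hs => (h.parallel hI hm).hasDerivAt_wInt_g hI (hc.uIcc_subset h₀ hs)

/-- The lengths on a parallel surface are those of the original one times `|1 + κF|`, up to
homothety. The shifted constant `a m / (1 + κF(t₀))` absorbs the value at the base point, so that
natural parameters remain natural. -/
theorem natLen_parFun_f {t₀ t : ℝ} (h₀ : t₀ ∈ I) (ht : t ∈ I) (a : ℝ) :
    natLen (parFun m κ F) (parFun m κ G) (a * m / (1 + κ * F t₀)) t₀ t =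
      natLen F G a t₀ t * |1 + κ * F t| / |m| := by
  have h1 := (parFun_ne_all h hm).1
  have e := exp_wInt_parFun_f h hI hm hc h₀ ht
  have hp : 0 < (1 + κ * F t₀) / (1 + κ * F t) :=
    pos_of_mul_pos_right (e ▸ Real.exp_pos _) (Real.exp_pos _).le
  rw [natLen, natLen, Real.exp_neg, Real.exp_neg, e, ← abs_of_pos hp, abs_div, abs_div, abs_mul]
  have := abs_ne_zero.2 (h1 t ht)
  have := abs_ne_zero.2 (h1 t₀ h₀)
  field_simp

theorem natLen_parFun_g {t₀ t : ℝ} (h₀ : t₀ ∈ I) (ht : t ∈ I) (b : ℝ) :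
    natLen (parFun m κ G) (parFun m κ F) (b * m / (1 + κ * G t₀)) t₀ t =
      natLen G F b t₀ t * |1 + κ * G t| / |m| := by
  have h1 := (parFun_ne_all h hm).2.1
  have e := exp_wInt_parFun_g h hI hm hc h₀ ht
  have hp : 0 < (1 + κ * G t₀) / (1 + κ * G t) :=
    pos_of_mul_pos_right (e ▸ Real.exp_pos _) (Real.exp_pos _).le
  rw [natLen, natLen, Real.exp_neg, Real.exp_neg, e, ← abs_of_pos hp, abs_div, abs_div, abs_mul]
  have := abs_ne_zero.2 (h1 t ht)
  have := abs_ne_zero.2 (h1 t₀ h₀)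
  field_simp

/-- The natural PDE is invariant under the passage to parallel surfaces. -/
theorem naturalPDE_parFun {t₀ : ℝ} (h₀ : t₀ ∈ I) {a b : ℝ} (μ : ℝ × ℝ → ℝ) {p : ℝ × ℝ}
    (ht : μ p ∈ I) :
    NaturalPDE (parFun m κ F) (parFun m κ G) (a * m / (1 + κ * F t₀)) (b * m / (1 + κ * G t₀)) t₀
      μ p ↔ NaturalPDE F G a b t₀ μ p := by
  obtain ⟨h1, h2, h3⟩ := parFun_ne_all h hm
  have eF := exp_wInt_parFun_f h hI hm hc h₀ ht
  have eG := exp_wInt_parFun_g h hI hm hc h₀ ht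
  have hs := parFun_sub h hm ht
  have hs' : parFun m κ G (μ p) - parFun m κ F (μ p) =
      -(m * (F (μ p) - G (μ p)) / ((1 + κ * F (μ p)) * (1 + κ * G (μ p)))) := by
    rw [← hs]; ring
  have hsq : ∀ x : ℝ, Real.exp (2 * x) = Real.exp x ^ 2 := fun x => by
    rw [← Real.exp_nat_mul]; norm_num
  rw [NaturalPDE, NaturalPDE, hs, hs', hsq, hsq, hsq, hsq, eF, eG,
    (parFun_hasDerivAt m κ (h.hasDerivAt_f hI ht) (h1 _ ht)).deriv,
    (parFun_hasDerivAt m κ (h.hasDerivAt_g hI ht) (h2 _ ht)).deriv,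
    (parFun_deriv_hasDerivAt m κ hI (fun t ht => h.hasDerivAt_f hI ht)
      (h.hasDerivAt_deriv_f hI ht) h1 ht).deriv,
    (parFun_deriv_hasDerivAt m κ hI (fun t ht => h.hasDerivAt_g hI ht)
      (h.hasDerivAt_deriv_g hI ht) h2 ht).deriv, parFun, parFun]
  have h0 := (parFun_pos_ne h hm ht).1
  have e1 := h1 _ ht
  have e2 := h2 _ ht
  have e3 := h3 _ ht
  have e4 := h1 _ h₀
  have e5 := h2 _ h₀
  rw [show G (μ p) - F (μ p) = -(F (μ p) - G (μ p)) by ring]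
  have hx : 1 + κ * F (μ p) = 1 + κ * G (μ p) + κ * (F (μ p) - G (μ p)) := by ring
  generalize 1 + κ * F t₀ = x₀ at *
  generalize 1 + κ * G t₀ = y₀ at *
  generalize Real.exp (wInt F G t₀ (μ p)) = A
  generalize Real.exp (wInt G F t₀ (μ p)) = B
  generalize deriv F (μ p) = F1
  generalize deriv G (μ p) = G1
  generalize deriv (deriv F) (μ p) = F2
  generalize deriv (deriv G) (μ p) = G2
  generalize F (μ p) - G (μ p) = r at *
  generalize 1 + κ * F (μ p) = x at *
  generalize 1 + κ * G (μ p) = y at *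
  have key : ∀ c v w : ℝ, c ≠ 0 → v = c * w → (v = 0 ↔ w = 0) := fun c v w hc' hv => by
    rw [hv, mul_eq_zero, or_iff_right hc']
  -- With `x = 1 + κF` and `y = 1 + κG`, this is the factor between the left sides of the two
  -- natural PDEs.
  refine key (m ^ 3 / (x ^ 2 * y ^ 2)) _ _ (div_ne_zero (pow_ne_zero 3 h0)
    (mul_ne_zero (pow_ne_zero 2 e1) (pow_ne_zero 2 e2))) ?_
  -- Eliminating `κ` by `x - y = κ (F - G)` leaves a rational identity in independent quantities.
  rw [show κ = (x - y) / r by rw [hx]; field_simp; ring]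
  field_simp
  ring

end Parallel

/-! ### Surfaces parallel to surfaces of a basic class -/

/-- Near `p`, the surface `z` has natural principal parameters such that the image of the parallel
surface at distance `d` under the homothety with factor `c` belongs to the basic class `C`. -/
def HasPatch (C : BasicClass) (d c : ℝ) (z : ℝ × ℝ → E3) (D : Set (ℝ × ℝ)) (p : ℝ × ℝ) : Prop :=
  ∃ (V : Set (ℝ × ℝ)) (q : ℝ × ℝ) (φ : ℝ × ℝ → ℝ × ℝ), IsReparam φ V D ∧ φ q = p ∧
    ∃ lam : ℝ × ℝ → ℝ,
      IsBasicPatch C (C.constA (lam q)) (C.constB (lam q)) lam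
        (fun x => c • parallel d (z ∘ φ) x) V q ∧
      (∀ x ∈ V, C.PDE lam x) ∧
      ∃ (I : Set ℝ) (f g : ℝ → ℝ) (a' b' : ℝ), IsOpen I ∧ I.OrdConnected ∧
        I ⊆ C.range ∧ Set.MapsTo lam V I ∧ IsWeingartenPair f g I ∧ a' ≠ 0 ∧ b' ≠ 0 ∧
        IsNaturalPatch f g a' b' (lam q) lam (z ∘ φ) V ∧
        ∀ (V' : Set (ℝ × ℝ)) (μ : ℝ × ℝ → ℝ), IsOpen V' → ContDiffOn ℝ ∞ μ V' →
          Set.MapsTo μ V' I → ∀ x ∈ V', (NaturalPDE f g a' b' (lam q) μ x ↔ C.PDE μ x)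

theorem HasPatch.of_reparam {C : BasicClass} {d c : ℝ} {z : ℝ × ℝ → E3} {D V₀ : Set (ℝ × ℝ)}
    {φ₀ : ℝ × ℝ → ℝ × ℝ} {p₀ : ℝ × ℝ} (h₀ : IsReparam φ₀ V₀ D)
    (h : HasPatch C d c (z ∘ φ₀) V₀ p₀) : HasPatch C d c z D (φ₀ p₀) := by
  obtain ⟨V, q, φ, h1, rfl, h2⟩ := h
  exact ⟨V, q, φ₀ ∘ φ, h₀.comp h1, rfl, h2⟩

theorem HasPatch.mono {C : BasicClass} {d c : ℝ} {z : ℝ × ℝ → E3} {D V₀ : Set (ℝ × ℝ)}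
    {p : ℝ × ℝ} (hV : IsOpen V₀) (hs : V₀ ⊆ D) (h : HasPatch C d c z V₀ p) :
    HasPatch C d c z D p :=
  HasPatch.of_reparam (φ₀ := id) (IsReparam.inclusion hV hs) h

theorem IsRegularSurface.mono {z : ℝ × ℝ → E3} {D V : Set (ℝ × ℝ)} (h : IsRegularSurface z D)
    (hV : IsOpen V) (hs : V ⊆ D) : IsRegularSurface z V :=
  ⟨hV, h.smooth.mono hs, fun p hp => h.regular p (hs hp)⟩

theorem IsPrincipalSurface.mono {z : ℝ × ℝ → E3} {D V : Set (ℝ × ℝ)} (h : IsPrincipalSurface z D)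
    (hV : IsOpen V) (hs : V ⊆ D) : IsPrincipalSurface z V :=
  ⟨h.toIsRegularSurface.mono hV hs, fun p hp => h.noUmbilic p (hs hp),
    fun p hp => h.orthogonal p (hs hp), fun p hp => h.conjugate p (hs hp)⟩

theorem IsPrincipalSurface.smooth_nu {z : ℝ × ℝ → E3} {D : Set (ℝ × ℝ)}
    (h : IsPrincipalSurface z D) : ContDiffOn ℝ ∞ (fun p => coefL z p / coefE z p) D ∧
      ContDiffOn ℝ ∞ (fun p => coefN z p / coefG z p) D :=
  ⟨h.smooth_coefL.div h.smooth_coefE fun _ hp => (h.coefE_pos hp).ne',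
    h.smooth_coefN.div h.smooth_coefG fun _ hp => (h.coefG_pos hp).ne'⟩

/-- The curvature data of a parallel surface, multiplied by `c`. -/
theorem IsPrincipalSurface.parallel_data {z : ℝ × ℝ → E3} {D : Set (ℝ × ℝ)}
    (h : IsPrincipalSurface z D) {d c σ τ : ℝ} (hσ : σ ^ 2 = 1) (hτ : τ ^ 2 = 1) (hc : 0 < c)
    (h1 : ∀ p ∈ D, 0 < σ * (1 - d * (coefL z p / coefE z p)))
    (h2 : ∀ p ∈ D, 0 < τ * (1 - d * (coefN z p / coefG z p))) :
    HasFrameData (fun p => c • parallel d z p) (fun p => (σ * τ) • normal z p)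
      (fun p => c * (σ * (1 - d * (coefL z p / coefE z p))) * lenU z p)
      (fun p => c * (τ * (1 - d * (coefN z p / coefG z p))) * lenV z p)
      (fun p => σ * τ * (coefL z p / coefE z p / (c * (1 - d * (coefL z p / coefE z p)))))
      (fun p => σ * τ * (coefN z p / coefG z p / (c * (1 - d * (coefN z p / coefG z p))))) D :=
  (h.isMovingFrame.parallel hσ hτ hc h1 h2).hasFrameData h.isOpen
    ((h.smooth.add (h.smooth_normal.const_smul d)).const_smul c)

theorem HasFrameData.relation {z l : ℝ × ℝ → E3} {e g k₁ k₂ : ℝ × ℝ → ℝ} {V : Set (ℝ × ℝ)}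
    (h : HasFrameData z l e g k₁ k₂ V) {p : ℝ × ℝ} (hp : p ∈ V) (hk : k₂ p < k₁ p) :
    curvK z p = k₁ p * k₂ p ∧ curvH z p = (k₁ p + k₂ p) / 2 ∧ curvH' z p = (k₁ p - k₂ p) / 2 := by
  have h' := h.toIsPrincipalSurface
  rw [h'.curvK_eq hp, h'.curvH_eq hp, h'.curvH'_eq hp, h.nu₁_eq p hp, h.nu₂_eq p hp,
    abs_of_pos (sub_pos.2 hk)]
  exact ⟨rfl, rfl, rfl⟩

theorem exists_ball_subset_of_continuousAt {C : BasicClass} {t₀ : ℝ} (h₀ : t₀ ∈ C.range)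
    {P : ℝ → ℝ} (hP : ContinuousAt P t₀) {Q : ℝ → ℝ} (hQ : ContinuousAt Q t₀) (hp : 0 < P t₀)
    (hq : 0 < Q t₀) : ∃ r > 0, ∀ t ∈ Metric.ball t₀ r, t ∈ C.range ∧ 0 < P t ∧ 0 < Q t := by
  have h1 : ∀ᶠ t in nhds t₀, t ∈ C.range := C.isOpen_range.mem_nhds h₀
  have h2 : ∀ᶠ t in nhds t₀, 0 < P t := hP.eventually (lt_mem_nhds hp)
  have h3 : ∀ᶠ t in nhds t₀, 0 < Q t := hQ.eventually (lt_mem_nhds hq)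
  obtain ⟨r, hr, h⟩ := Metric.eventually_nhds_iff_ball.1 (h1.and (h2.and h3))
  exact ⟨r, hr, h⟩

/-- The signs `σ`, `τ` are those of `1 - d n₁`, `1 - d n₂`, so `w = c (z + d l)` has normal `σ τ l`
and curvatures `m₁ > m₂`. These satisfy the relation of the class, and `param` makes a geometric
function of them. Natural parameters of `w` serve `z` as well, because `z` is, up to homothety, a
parallel surface of `w`. -/
theorem hasPatch_of_relation {C : BasicClass} (hC : C.Admissible) {z : ℝ × ℝ → E3}
    {D : Set (ℝ × ℝ)} (h : IsPrincipalSurface z D) {d c σ τ : ℝ} (hσ : σ ^ 2 = 1)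
    (hτ : τ ^ 2 = 1) (hc : 0 < c) {n₁ n₂ : ℝ × ℝ → ℝ}
    (e1 : ∀ p ∈ D, coefL z p / coefE z p = n₁ p) (e2 : ∀ p ∈ D, coefN z p / coefG z p = n₂ p)
    (h1 : ∀ p ∈ D, 0 < σ * (1 - d * n₁ p)) (h2 : ∀ p ∈ D, 0 < τ * (1 - d * n₂ p))
    (hlt : ∀ p ∈ D, n₂ p < n₁ p) {m₁ m₂ : ℝ × ℝ → ℝ}
    (hm₁ : ∀ p, m₁ p = σ * τ * (n₁ p / (c * (1 - d * n₁ p))))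
    (hm₂ : ∀ p, m₂ p = σ * τ * (n₂ p / (c * (1 - d * n₂ p))))
    (hrel : ∀ p ∈ D, C.Relation (m₁ p * m₂ p) ((m₁ p + m₂ p) / 2) ((m₁ p - m₂ p) / 2))
    {p : ℝ × ℝ} (hp : p ∈ D) : HasPatch C d c z D p := by
  have hw := h.parallel_data hσ hτ hc (d := d) (fun p hp => by rw [e1 p hp]; exact h1 p hp)
    (fun p hp => by rw [e2 p hp]; exact h2 p hp)
  have hn1 : ∀ p ∈ D, 1 - d * n₁ p ≠ 0 := fun p hp => right_ne_zero_of_mul (h1 p hp).ne'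
  have hn2 : ∀ p ∈ D, 1 - d * n₂ p ≠ 0 := fun p hp => right_ne_zero_of_mul (h2 p hp).ne'
  have wn1 : ∀ p ∈ D, coefL (fun p => c • parallel d z p) p / coefE (fun p => c • parallel d z p) p
      = m₁ p := fun p hp => by rw [hw.nu₁_eq p hp, e1 p hp, hm₁ p]
  have wn2 : ∀ p ∈ D, coefN (fun p => c • parallel d z p) p / coefG (fun p => c • parallel d z p) p
      = m₂ p := fun p hp => by rw [hw.nu₂_eq p hp, e2 p hp, hm₂ p]
  have hst : (σ * τ) ^ 2 = 1 := by rw [mul_pow, hσ, hτ, one_mul]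
  have hmlt : ∀ p ∈ D, m₂ p < m₁ p := fun p hp => by
    have a1 := hn1 p hp
    have a2 := hn2 p hp
    have a3 := mul_pos (h1 p hp) (h2 p hp)
    have a4 := sub_pos.2 (hlt p hp)
    rw [← sub_pos, hm₁, hm₂, show σ * τ * (n₁ p / (c * (1 - d * n₁ p))) -
      σ * τ * (n₂ p / (c * (1 - d * n₂ p))) = (σ * (1 - d * n₁ p) * (τ * (1 - d * n₂ p))) *
        (n₁ p - n₂ p) / (c * (1 - d * n₁ p) ^ 2 * (1 - d * n₂ p) ^ 2) by
        rw [show n₁ p - n₂ p = n₁ p * (1 - d * n₂ p) - n₂ p * (1 - d * n₁ p) by ring]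
        generalize 1 - d * n₁ p = r at *
        generalize 1 - d * n₂ p = s at *
        field_simp]
    positivity
  have sm1 : ContDiffOn ℝ ∞ m₁ D := hw.toIsPrincipalSurface.smooth_nu.1.congr
    fun p hp => (wn1 p hp).symm
  have sm2 : ContDiffOn ℝ ∞ m₂ D := hw.toIsPrincipalSurface.smooth_nu.2.congr
    fun p hp => (wn2 p hp).symm
  set lam₀ : ℝ × ℝ → ℝ := fun p => C.param (m₁ p) (m₂ p) with hlam₀
  have sl : ContDiffOn ℝ ∞ lam₀ D := C.smooth_param hC sm1 sm2 hmlt hrel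
  have spec := fun p hp => C.param_spec hC (hmlt p hp) (hrel p hp)
  set t₀ := lam₀ p with ht₀
  have h₀ : t₀ ∈ C.range := (spec p hp).1
  -- With this `κ`, `1 + κ m` is the inverse of `1 - d n`. Hence `parFun (σ * τ * c) κ` leads back
  -- from the curvatures of `w` to those of `z`.
  set κ := σ * τ * c * d with hκ
  have kap1 : ∀ x ∈ D, (1 + κ * C.nu₁ (lam₀ x)) * (1 - d * n₁ x) = 1 := fun x hx => by
    rw [(spec x hx).2.1, hm₁]
    have := hn1 x hx
    have e : κ * (σ * τ * (n₁ x / (c * (1 - d * n₁ x)))) = d * n₁ x / (1 - d * n₁ x) := by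
      rw [hκ, show d * n₁ x / (1 - d * n₁ x) = (σ * τ) ^ 2 * (d * n₁ x / (1 - d * n₁ x)) by
        rw [hst, one_mul]]
      generalize 1 - d * n₁ x = r at *
      field_simp
    rw [e, add_mul, div_mul_cancel₀ _ this]; ring
  have kap2 : ∀ x ∈ D, (1 + κ * C.nu₂ (lam₀ x)) * (1 - d * n₂ x) = 1 := fun x hx => by
    rw [(spec x hx).2.2, hm₂]
    have := hn2 x hx
    have e : κ * (σ * τ * (n₂ x / (c * (1 - d * n₂ x)))) = d * n₂ x / (1 - d * n₂ x) := by
      rw [hκ, show d * n₂ x / (1 - d * n₂ x) = (σ * τ) ^ 2 * (d * n₂ x / (1 - d * n₂ x)) by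
        rw [hst, one_mul]]
      generalize 1 - d * n₂ x = r at *
      field_simp
    rw [e, add_mul, div_mul_cancel₀ _ this]; ring
  have sgn : ∀ {ρ x y : ℝ}, ρ ^ 2 = 1 → x * y = 1 → 0 < ρ * y → 0 < ρ * x := by
    intro ρ x y hρ hxy hy
    refine pos_of_mul_pos_left ?_ hy.le
    have : ρ * x * (ρ * y) = 1 := by linear_combination ρ ^ 2 * hxy + hρ
    rw [this]; exact one_pos
  have cont := fun t (ht : t ∈ C.range) => (C.nu₁_hasDerivAt ht).continuousAt
  have cont' := fun t (ht : t ∈ C.range) => (C.nu₂_hasDerivAt ht).continuousAt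
  -- The signs of `1 + κ ν₁`, `1 + κ ν₂` must persist on a whole interval of values, since the PDEs
  -- are compared for every function with values in `I`, not only for `lam`.
  obtain ⟨r, hr, hI⟩ := exists_ball_subset_of_continuousAt h₀
    (P := fun t => σ * (1 + κ * C.nu₁ t)) (Q := fun t => τ * (1 + κ * C.nu₂ t))
    (continuousAt_const.mul (continuousAt_const.add (continuousAt_const.mul (cont _ h₀))))
    (continuousAt_const.mul (continuousAt_const.add (continuousAt_const.mul (cont' _ h₀))))
    (sgn hσ (kap1 p hp) (h1 p hp)) (sgn hτ (kap2 p hp) (h2 p hp))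
  set I := Metric.ball t₀ r with hIdef
  have oI : IsOpen I := Metric.isOpen_ball
  have cI : I.OrdConnected := (convex_ball t₀ r).ordConnected
  have mI : t₀ ∈ I := Metric.mem_ball_self hr
  have IC : I ⊆ C.range := fun t ht => (hI t ht).1
  have hpair : IsWeingartenPair C.nu₁ C.nu₂ I := (C.isWeingartenPair hC).mono IC
  have hpos : ∀ t ∈ I, 0 < σ * τ * c * ((1 + κ * C.nu₁ t) * (1 + κ * C.nu₂ t)) := fun t ht => by
    have := mul_pos hc (mul_pos (hI t ht).2.1 (hI t ht).2.2)
    linarith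
  set D₁ := D ∩ lam₀ ⁻¹' I with hD₁
  have oD₁ : IsOpen D₁ := sl.continuousOn.isOpen_inter_preimage h.isOpen oI
  have sD : D₁ ⊆ D := Set.inter_subset_left
  have hA := C.constA_ne hC h₀
  have hB := C.constB_ne hC h₀
  -- The natural parameters are constructed on the surface of the basic class; the same change of
  -- parameters is then applied to `z`.
  obtain ⟨ε, hε, U, W, U', W', hp0, sU, sW, hU, hW, hUW⟩ :=
    (hw.toIsPrincipalSurface.mono oD₁ sD).exists_natural hpair oI cI (sl.mono sD)
      (fun x hx => hx.2) (fun x hx => (wn1 x hx.1).trans (spec x hx.1).2.1.symm)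
      (fun x hx => (wn2 x hx.1).trans (spec x hx.1).2.2.symm) ⟨hp, mI⟩ hA hB
  set V := Set.Ioo (-ε) ε ×ˢ Set.Ioo (-ε) ε with hV
  have oV : IsOpen V := isOpen_Ioo.prod isOpen_Ioo
  have h0V : ((0 : ℝ), (0 : ℝ)) ∈ V := ⟨⟨by linarith, hε⟩, ⟨by linarith, hε⟩⟩
  set φ : ℝ × ℝ → ℝ × ℝ := fun q => (U q.1, W q.2) with hφ
  have hre : IsReparam φ V D := IsReparam.diag isOpen_Ioo isOpen_Ioo (convex_Ioo _ _)
    (convex_Ioo _ _) sU sW (fun t ht => (hU t ht).1) (fun t ht => (hW t ht).1)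
    (fun t ht => (hU t ht).2) (fun t ht => (hW t ht).2) fun q hq => sD (hUW q hq).1
  have hφD : ∀ q ∈ V, φ q ∈ D := hre.mapsTo
  have hz1 := ((h.isMovingFrame.mono sD).diag (V := V) (U := U) (W := W) (U' := U') (W' := W')
    (one_pow 2) (one_pow 2) (fun q hq => (hUW q hq).1)
    (fun q hq => (hU q.1 hq.1).1) (fun q hq => (hW q.2 hq.2).1)
    (fun q hq => by rw [one_mul]; exact (hU q.1 hq.1).2)
    (fun q hq => by rw [one_mul]; exact (hW q.2 hq.2).2)).hasFrameData oV
      (h.smooth.comp hre.smooth hre.mapsTo)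
  have zn1 : ∀ q ∈ V, coefL (z ∘ φ) q / coefE (z ∘ φ) q = n₁ (φ q) := fun q hq =>
    (hz1.nu₁_eq q hq).trans (by rw [one_mul, one_mul]; exact e1 _ (hφD q hq))
  have zn2 : ∀ q ∈ V, coefN (z ∘ φ) q / coefG (z ∘ φ) q = n₂ (φ q) := fun q hq =>
    (hz1.nu₂_eq q hq).trans (by rw [one_mul, one_mul]; exact e2 _ (hφD q hq))
  have zl1 : ∀ q ∈ V, lenU (z ∘ φ) q = U' q.1 * lenU z (φ q) := fun q hq =>
    (hz1.lenU_eq q hq).trans (by rw [one_mul])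
  have zl2 : ∀ q ∈ V, lenV (z ∘ φ) q = W' q.2 * lenV z (φ q) := fun q hq =>
    (hz1.lenV_eq q hq).trans (by rw [one_mul])
  have hz1' : IsPrincipalSurface (z ∘ φ) V := hz1.toIsPrincipalSurface
  have hw1 := hz1'.parallel_data hσ hτ hc (d := d)
    (fun q hq => by rw [zn1 q hq]; exact h1 _ (hφD q hq))
    (fun q hq => by rw [zn2 q hq]; exact h2 _ (hφD q hq))
  have w1n1 : ∀ q ∈ V, coefL (fun x => c • parallel d (z ∘ φ) x) q /
      coefE (fun x => c • parallel d (z ∘ φ) x) q = m₁ (φ q) := fun q hq => by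
    rw [hw1.nu₁_eq q hq, zn1 q hq, hm₁]
  have w1n2 : ∀ q ∈ V, coefN (fun x => c • parallel d (z ∘ φ) x) q /
      coefG (fun x => c • parallel d (z ∘ φ) x) q = m₂ (φ q) := fun q hq => by
    rw [hw1.nu₂_eq q hq, zn2 q hq, hm₂]
  have w1l1 : ∀ q ∈ V, lenU (fun x => c • parallel d (z ∘ φ) x) q =
      natLen C.nu₁ C.nu₂ (C.constA t₀) t₀ (lam₀ (φ q)) := fun q hq => by
    rw [hw1.lenU_eq q hq, zn1 q hq, zl1 q hq, ← (hUW q hq).2.1, hw.lenU_eq _ (hφD q hq),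
      e1 _ (hφD q hq)]
    ring
  have w1l2 : ∀ q ∈ V, lenV (fun x => c • parallel d (z ∘ φ) x) q =
      natLen C.nu₂ C.nu₁ (C.constB t₀) t₀ (lam₀ (φ q)) := fun q hq => by
    rw [hw1.lenV_eq q hq, zn2 q hq, zl2 q hq, ← (hUW q hq).2.2, hw.lenV_eq _ (hφD q hq),
      e2 _ (hφD q hq)]
    ring
  have slam : ContDiffOn ℝ ∞ (lam₀ ∘ φ) V := sl.comp hre.smooth hre.mapsTo
  have mlam : Set.MapsTo (lam₀ ∘ φ) V I := fun q hq => (hUW q hq).1.2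
  have base : (lam₀ ∘ φ) (0, 0) = t₀ := congrArg lam₀ hp0
  have hnat : IsNaturalPatch C.nu₁ C.nu₂ (C.constA t₀) (C.constB t₀) t₀ (lam₀ ∘ φ)
      (fun x => c • parallel d (z ∘ φ) x) V :=
    { toIsPrincipalSurface := hw1.toIsPrincipalSurface
      nu_one := fun q hq => (w1n1 q hq).trans (spec _ (hφD q hq)).2.1.symm
      nu_two := fun q hq => (w1n2 q hq).trans (spec _ (hφD q hq)).2.2.symm
      constE := fun q hq => eq_natLen_iff.2 (w1l1 q hq)
      constG := fun q hq => eq_natLen_iff.2 (w1l2 q hq) }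
  have hm0 : σ * τ * c ≠ 0 := (parFun_pos_ne hpair hpos mI).1
  have habs : |σ * τ * c| = c := by
    rw [abs_mul, abs_of_pos hc, (pow_eq_one_iff_of_nonneg (abs_nonneg (σ * τ)) two_ne_zero).1
      (by rw [sq_abs, hst]), one_mul]
  have hx1 := (parFun_pos_ne hpair hpos mI).2.1
  have hx2 := (parFun_pos_ne hpair hpos mI).2.2.1
  have back : ∀ {n F : ℝ}, (1 + κ * F) * (1 - d * n) = 1 →
      F = σ * τ * (n / (c * (1 - d * n))) → σ * τ * c * F / (1 + κ * F) = n := by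
    intro n F h1 h2
    have h3 := left_ne_zero_of_mul (by rw [h1]; exact one_ne_zero : (1 + κ * F) * (1 - d * n) ≠ 0)
    have h4 := right_ne_zero_of_mul (by rw [h1]; exact one_ne_zero : (1 + κ * F) * (1 - d * n) ≠ 0)
    have h5 : c * F * (1 - d * n) = σ * τ * n := by
      rw [h2]
      generalize 1 - d * n = r at *
      field_simp
    rw [div_eq_iff h3]
    refine mul_right_cancel₀ h4 ?_
    linear_combination σ * τ * h5 + n * hst - n * h1
  have absf : ∀ {ρ x y s e : ℝ}, ρ ^ 2 = 1 → x * y = 1 → 0 < ρ * x →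
      e = c * (ρ * y) * s → s = e * |x| / c := by
    intro ρ x y s e hρ hxy hx he
    have h1 : |x| = ρ * x := by
      rw [← abs_of_pos hx, abs_mul, (pow_eq_one_iff_of_nonneg (abs_nonneg ρ) two_ne_zero).1
        (by rw [sq_abs, hρ]), one_mul]
    rw [h1, he, eq_div_iff hc.ne']
    linear_combination -s * c * ρ ^ 2 * hxy - s * c * hρ
  refine ⟨V, (0, 0), φ, hre, hp0, lam₀ ∘ φ, ?_, fun x hx => ?_, I,
    parFun (σ * τ * c) κ C.nu₁, parFun (σ * τ * c) κ C.nu₂,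
    C.constA t₀ * (σ * τ * c) / (1 + κ * C.nu₁ t₀), C.constB t₀ * (σ * τ * c) / (1 + κ * C.nu₂ t₀),
    oI, cI, IC, mlam, hpair.parallel oI hpos, div_ne_zero (mul_ne_zero hA hm0) hx1,
    div_ne_zero (mul_ne_zero hB hm0) hx2, ?_, fun V' μ hV' hμ mμ x hx => ?_⟩
  · rw [base]
    exact { toIsNaturalPatch := base.symm ▸ hnat
            connected := ((convex_Ioo _ _).prod (convex_Ioo _ _)).isPreconnected
            base := h0V
            relation := fun q hq => by
              have hlt' := hmlt _ (hφD q hq)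
              have := hw1.relation hq (by rw [zn1 q hq, zn2 q hq, ← hm₁, ← hm₂]; exact hlt')
              rw [zn1 q hq, zn2 q hq, ← hm₁, ← hm₂] at this
              rw [this.1, this.2.1, this.2.2]
              exact hrel _ (hφD q hq)
            smooth_lam := slam
            mapsTo_lam := fun q hq => IC (mlam hq) }
  · exact (C.naturalPDE_iff hC oV slam (fun q hq => IC (mlam hq)) hx
      ((cI.uIcc_subset mI (mlam hx)).trans IC)).1
      (hnat.naturalPDE hpair oI cI mI hA hB oV slam mlam hx)
  · rw [base]
    refine { toIsPrincipalSurface := hz1'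
             nu_one := fun q hq => ?_
             nu_two := fun q hq => ?_
             constE := fun q hq => eq_natLen_iff.2 ?_
             constG := fun q hq => eq_natLen_iff.2 ?_ }
    · refine (zn1 q hq).trans (back (kap1 _ (hφD q hq)) ?_).symm
      rw [(spec _ (hφD q hq)).2.1, hm₁]
    · refine (zn2 q hq).trans (back (kap2 _ (hφD q hq)) ?_).symm
      rw [(spec _ (hφD q hq)).2.2, hm₂]
    · rw [natLen_parFun_f hpair oI hpos cI mI (mlam hq), habs]
      refine absf hσ (kap1 _ (hφD q hq)) (hI _ (mlam hq)).2.1 ?_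
      rw [Function.comp_apply, ← w1l1 q hq, hw1.lenU_eq q hq, zn1 q hq]
      rfl
    · rw [natLen_parFun_g hpair oI hpos cI mI (mlam hq), habs]
      refine absf hτ (kap2 _ (hφD q hq)) (hI _ (mlam hq)).2.2 ?_
      rw [Function.comp_apply, ← w1l2 q hq, hw1.lenV_eq q hq, zn2 q hq]
      rfl
  · rw [base]
    exact (naturalPDE_parFun hpair oI hpos cI mI μ (mμ hx)).trans
      (C.naturalPDE_iff hC hV' hμ (fun q hq => IC (mμ hq)) hx
        ((cI.uIcc_subset mI (mμ hx)).trans IC))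

/-! ### Orientation of the parametric lines -/

/-- Interchanging the parameters one obtains a surface with the opposite normal. -/
theorem IsPrincipalSurface.exists_swap {z : ℝ × ℝ → E3} {D : Set (ℝ × ℝ)}
    (h : IsPrincipalSurface z D) {p : ℝ × ℝ} (hp : p ∈ D) :
    ∃ (V : Set (ℝ × ℝ)) (φ : ℝ × ℝ → ℝ × ℝ) (q : ℝ × ℝ), IsReparam φ V D ∧ q ∈ V ∧ φ q = p ∧
      IsPrincipalSurface (z ∘ φ) V ∧ ∀ x ∈ V,
        coefL (z ∘ φ) x / coefE (z ∘ φ) x = -(coefN z (φ x) / coefG z (φ x)) ∧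
        coefN (z ∘ φ) x / coefG (z ∘ φ) x = -(coefL z (φ x) / coefE z (φ x)) := by
  have oV : IsOpen {q : ℝ × ℝ | (q.2, q.1) ∈ D} := h.isOpen.preimage continuous_swap
  have hφ : IsReparam (fun q : ℝ × ℝ => (q.2, q.1)) {q : ℝ × ℝ | (q.2, q.1) ∈ D} D :=
    IsReparam.of_equiv (ContinuousLinearEquiv.prodComm ℝ ℝ ℝ) oV fun _ hq => hq
  have hs := h.isMovingFrame.swap.hasFrameData oV (h.smooth.comp hφ.smooth hφ.mapsTo)
  exact ⟨_, _, (p.2, p.1), hφ, hp, rfl, hs.toIsPrincipalSurface, fun x hx =>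
    ⟨hs.nu₁_eq x hx, hs.nu₂_eq x hx⟩⟩

/-- Reversing the second parameter one obtains a surface with the opposite normal. -/
theorem IsPrincipalSurface.exists_flip {z : ℝ × ℝ → E3} {D : Set (ℝ × ℝ)}
    (h : IsPrincipalSurface z D) {p : ℝ × ℝ} (hp : p ∈ D) :
    ∃ (V : Set (ℝ × ℝ)) (φ : ℝ × ℝ → ℝ × ℝ) (q : ℝ × ℝ), IsReparam φ V D ∧ q ∈ V ∧ φ q = p ∧
      IsPrincipalSurface (z ∘ φ) V ∧ ∀ x ∈ V,
        coefL (z ∘ φ) x / coefE (z ∘ φ) x = -(coefL z (φ x) / coefE z (φ x)) ∧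
        coefN (z ∘ φ) x / coefG (z ∘ φ) x = -(coefN z (φ x) / coefG z (φ x)) := by
  have oV : IsOpen {q : ℝ × ℝ | (q.1, -q.2) ∈ D} :=
    h.isOpen.preimage (continuous_fst.prodMk continuous_snd.neg)
  have hφ : IsReparam (fun q : ℝ × ℝ => (q.1, -q.2)) {q : ℝ × ℝ | (q.1, -q.2) ∈ D} D :=
    IsReparam.of_equiv ((ContinuousLinearEquiv.refl ℝ ℝ).prodCongr (ContinuousLinearEquiv.neg ℝ))
      oV fun _ hq => hq
  have hs := (h.isMovingFrame.diag (V := {q : ℝ × ℝ | (q.1, -q.2) ∈ D}) (U := id)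
    (W := fun t => -t) (U' := fun _ => 1) (W' := fun _ => -1) (σ := 1) (τ := -1) (by norm_num)
    (by norm_num) (fun q hq => hq) (fun q _ => hasDerivAt_id q.1) (fun q _ => hasDerivAt_neg q.2)
    (fun q _ => by norm_num) (fun q _ => by norm_num)).hasFrameData oV
    (h.smooth.comp hφ.smooth hφ.mapsTo)
  exact ⟨_, _, (p.1, -p.2), hφ, by simpa using hp, by simp, hs.toIsPrincipalSurface, fun x hx =>
    ⟨(hs.nu₁_eq x hx).trans (by simp), (hs.nu₂_eq x hx).trans (by simp)⟩⟩

theorem IsReparam.mono {φ : ℝ × ℝ → ℝ × ℝ} {V V' D D' : Set (ℝ × ℝ)} (h : IsReparam φ V D)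
    (oV : IsOpen V') (hV : V' ⊆ V) (hm : Set.MapsTo φ V' D') : IsReparam φ V' D' :=
  ⟨oV, h.smooth.mono hV, h.injOn.mono hV, hm, fun q hq => h.regular q (hV hq)⟩

/-- Near a given point the first principal curvature may be assumed to be the larger one. -/
theorem IsPrincipalSurface.exists_ordered {z : ℝ × ℝ → E3} {D : Set (ℝ × ℝ)}
    (h : IsPrincipalSurface z D) {p : ℝ × ℝ} (hp : p ∈ D) :
    ∃ (V : Set (ℝ × ℝ)) (φ : ℝ × ℝ → ℝ × ℝ) (q : ℝ × ℝ), IsReparam φ V D ∧ q ∈ V ∧ φ q = p ∧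
      IsPrincipalSurface (z ∘ φ) V ∧ ∃ n₁ n₂ : ℝ × ℝ → ℝ, ∀ x ∈ V,
        coefL (z ∘ φ) x / coefE (z ∘ φ) x = n₁ x ∧ coefN (z ∘ φ) x / coefG (z ∘ φ) x = n₂ x ∧
        n₂ x < n₁ x ∧ curvK z (φ x) = n₁ x * n₂ x ∧ curvH z (φ x) = (n₁ x + n₂ x) / 2 ∧
        curvH' z (φ x) = (n₁ x - n₂ x) / 2 := by
  set k₁ := fun p => coefL z p / coefE z p with hk₁
  set k₂ := fun p => coefN z p / coefG z p with hk₂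
  have c1 := h.smooth_nu.1.continuousOn
  have c2 := h.smooth_nu.2.continuousOn
  rcases lt_or_gt_of_ne (h.nu_ne hp) with hlt | hlt
  · obtain ⟨V₁, φ₁, q₁, r1, m1, rfl, P1, n1⟩ := h.exists_swap hp
    -- Interchanging the parameters exchanges and negates the curvatures; reversing one parameter
    -- negates them back. The net effect is an exchange with the orientation preserved.
    obtain ⟨V₂, φ₂, q₂, r2, m2, rfl, P2, n2⟩ := P1.exists_flip m1
    have r3 := r1.comp r2
    have oV : IsOpen {q | q ∈ V₂ ∧ 0 < (fun x => k₂ x - k₁ x) ((φ₁ ∘ φ₂) q)} :=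
      ((c2.sub c1).comp r3.smooth.continuousOn r3.mapsTo).isOpen_inter_preimage r3.isOpen isOpen_Ioi
    refine ⟨_, φ₁ ∘ φ₂, q₂, r3.mono oV (fun q hq => hq.1) fun q hq => r3.mapsTo hq.1,
      ⟨m2, sub_pos.2 hlt⟩, rfl, P2.mono oV fun q hq => hq.1, fun x => k₂ (φ₁ (φ₂ x)),
      fun x => k₁ (φ₁ (φ₂ x)), fun x hx => ?_⟩
    have hD : φ₁ (φ₂ x) ∈ D := r3.mapsTo hx.1
    have hl : k₁ (φ₁ (φ₂ x)) < k₂ (φ₁ (φ₂ x)) := sub_pos.1 hx.2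
    have a1 := (n2 x hx.1).1.trans (congrArg Neg.neg (n1 _ (r2.mapsTo hx.1)).1)
    have a2 := (n2 x hx.1).2.trans (congrArg Neg.neg (n1 _ (r2.mapsTo hx.1)).2)
    rw [neg_neg] at a1 a2
    refine ⟨a1, a2, hl, (h.curvK_eq hD).trans (mul_comm _ _), (h.curvH_eq hD).trans (by
      simp only [hk₁, hk₂]; ring), (h.curvH'_eq hD).trans ?_⟩
    rw [abs_sub_comm]
    exact congrArg (· / 2) (abs_of_pos (sub_pos.2 hl))
  · have oV : IsOpen (D ∩ (fun x => k₁ x - k₂ x) ⁻¹' Set.Ioi 0) :=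
      (c1.sub c2).isOpen_inter_preimage h.isOpen isOpen_Ioi
    refine ⟨_, id, p, IsReparam.inclusion oV Set.inter_subset_left, ⟨hp, sub_pos.2 hlt⟩, rfl,
      h.mono oV Set.inter_subset_left, k₁, k₂, fun x hx => ?_⟩
    have hl : k₂ x < k₁ x := sub_pos.1 hx.2
    exact ⟨rfl, rfl, hl, h.curvK_eq hx.1, h.curvH_eq hx.1, (h.curvH'_eq hx.1).trans
      (congrArg (· / 2) (abs_of_pos (sub_pos.2 hl)))⟩

/-- Every surface of a basic class is locally described by the PDE of the class. -/
theorem exists_basicPatch {C : BasicClass} (hC : C.Admissible) {z : ℝ × ℝ → E3}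
    {D : Set (ℝ × ℝ)} (h : IsPrincipalSurface z D)
    (hrel : ∀ p ∈ D, C.Relation (curvK z p) (curvH z p) (curvH' z p)) {p : ℝ × ℝ} (hp : p ∈ D) :
    ∃ (V : Set (ℝ × ℝ)) (q : ℝ × ℝ) (φ : ℝ × ℝ → ℝ × ℝ) (lam : ℝ × ℝ → ℝ),
      IsReparam φ V D ∧ φ q = p ∧
      IsBasicPatch C (C.constA (lam q)) (C.constB (lam q)) lam (z ∘ φ) V q ∧
      ∀ x ∈ V, C.PDE lam x := by
  obtain ⟨V, φ, q, r, hq, rfl, P, n₁, n₂, hn⟩ := h.exists_ordered hp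
  -- A surface of the class is its own parallel surface: distance zero and homothety factor one.
  have hp : HasPatch C 0 1 z D (φ q) := by
    refine HasPatch.of_reparam r (hasPatch_of_relation hC P (σ := 1) (τ := 1) (one_pow 2)
      (one_pow 2) one_pos (fun x hx => (hn x hx).1) (fun x hx => (hn x hx).2.1)
      (fun x hx => by norm_num) (fun x hx => by norm_num) (fun x hx => (hn x hx).2.2.1)
      (fun _ => rfl) (fun _ => rfl) (fun x hx => ?_) hq)
    have := hrel _ (r.mapsTo hx)
    rw [(hn x hx).2.2.2.1, (hn x hx).2.2.2.2.1, (hn x hx).2.2.2.2.2] at this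
    simpa using this
  obtain ⟨V', q', φ', r', e, lam, h1, h2, -⟩ := hp
  have : (fun x => (1 : ℝ) • parallel 0 (z ∘ φ') x) = z ∘ φ' := by
    funext x; simp [parallel]
  rw [this] at h1
  exact ⟨V', q', φ', lam, r', e, h1, h2⟩

/-! ### Integration of flat connections -/

section Flat
variable {E A : Type*} [NormedAddCommGroup E] [NormedSpace ℝ E] [NormedRing A] [NormedAlgebra ℝ A]
  [CompleteSpace A] [NormOneClass A]

/-- A linear equation with a small coefficient has a solution on the unit interval. -/
theorem exists_linear_solution {k : ℝ → A} (hk : ContinuousOn k (Set.Icc 0 1))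
    (hb : ∀ t ∈ Set.Icc (0 : ℝ) 1, ‖k t‖ ≤ 1 / 2) : ∃ Y : ℝ → A, Y 0 = 1 ∧
      (∀ t ∈ Set.Icc (0 : ℝ) 1, HasDerivWithinAt Y (Y t * k t) (Set.Icc 0 1) t) ∧
      ∀ t ∈ Set.Icc (0 : ℝ) 1, ‖Y t‖ ≤ Real.exp 1 := by
  -- On the unit ball about `1` one has `‖Y‖ ≤ 2`, so `‖k‖ ≤ 1/2` bounds the speed by `1` and the
  -- solution cannot leave the ball in unit time.
  have hpl : IsPicardLindelof (fun t Y => Y * k t) (⟨0, by simp⟩ : Set.Icc (0 : ℝ) 1) (1 : A)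
      1 0 1 1 :=
    { lipschitzOnWith := fun t ht => LipschitzOnWith.of_dist_le_mul fun x _ y _ => by
        rw [dist_eq_norm, dist_eq_norm, ← sub_mul, NNReal.coe_one, one_mul]
        refine (norm_mul_le _ _).trans ?_
        have := mul_le_mul_of_nonneg_left (hb t ht) (norm_nonneg (x - y))
        linarith [norm_nonneg (x - y)]
      continuousOn := fun x _ => continuousOn_const.mul hk
      norm_le := fun t ht x hx => by
        have h1 : ‖x‖ ≤ 2 := by
          have := norm_sub_norm_le x 1
          rw [mem_closedBall_iff_norm, NNReal.coe_one] at hx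
          rw [norm_one] at this
          linarith
        rw [NNReal.coe_one]
        exact (norm_mul_le _ _).trans ((mul_le_mul h1 (hb t ht) (norm_nonneg _) two_pos.le).trans
          (by norm_num))
      mul_max_le := by simp }
  obtain ⟨Y, hY0, hY⟩ := hpl.exists_eq_forall_mem_Icc_hasDerivWithinAt₀
  refine ⟨Y, hY0, hY, fun t ht => ?_⟩
  have := norm_le_gronwallBound_of_norm_deriv_right_le (f := Y) (f' := fun t => Y t * k t) (δ := 1)
    (K := 1) (ε := 0) (a := 0) (b := 1) (fun t ht => (hY t ht).continuousWithinAt)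
    (fun t ht => (hY t ⟨ht.1, ht.2.le⟩).mono_of_mem_nhdsWithin (Icc_mem_nhdsGE_of_mem ht))
    (by rw [show Y 0 = 1 from hY0, norm_one]) (fun t ht => by
      refine (norm_mul_le _ _).trans ?_
      have := mul_le_mul_of_nonneg_left (hb t ⟨ht.1, ht.2.le⟩) (norm_nonneg (Y t))
      linarith [norm_nonneg (Y t)]) t ht
  rw [gronwallBound_ε0] at this
  refine this.trans ?_
  rw [one_mul, one_mul, sub_zero]
  exact Real.exp_le_exp.2 ht.2

/-- The connection is integrated along rays: `X(x) = Y_x(1)` with `Y_x' = Y_x θ(t x) x`. To see that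
`dX = X θ` in all directions, `Y_y(t)` is compared with `Y_x(t) (1 + t θ(t x) h)`, `h = y - x`. By
the flatness `hf` the difference satisfies a linear equation with forcing of order `‖h‖²`, and
Gronwall's inequality bounds it by a multiple of `‖h‖²`. -/
theorem exists_parallel_aux {θ : E → E →L[ℝ] A} {θ' : E → E →L[ℝ] E →L[ℝ] A} {ρ M : ℝ}
    (hρ : 0 < ρ) (hd : ∀ x ∈ Metric.ball 0 ρ, HasFDerivAt θ (θ' x) x)
    (hM : ∀ x ∈ Metric.ball 0 ρ, ‖θ x‖ ≤ M) (hM' : ∀ x ∈ Metric.ball 0 ρ, ‖θ' x‖ ≤ M)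
    (hL : ∀ x ∈ Metric.ball 0 ρ, ∀ y ∈ Metric.ball 0 ρ, ‖θ' y - θ' x‖ ≤ M * ‖y - x‖)
    (hs : M * ρ ≤ 1 / 2)
    (hf : ∀ x ∈ Metric.ball 0 ρ, ∀ h k, θ x h * θ x k + θ' x h k = θ x k * θ x h + θ' x k h) :
    ∃ X : E → A, X 0 = 1 ∧ ∀ x ∈ Metric.ball 0 ρ,
      HasFDerivAt X ((ContinuousLinearMap.mul ℝ A (X x)).comp (θ x)) x := by
  have hM0 : 0 ≤ M := (norm_nonneg _).trans (hM 0 (Metric.mem_ball_self hρ))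
  have hsm : ∀ x ∈ Metric.ball (0 : E) ρ, ∀ t ∈ Set.Icc (0 : ℝ) 1, t • x ∈ Metric.ball 0 ρ := by
    intro x hx t ht
    rw [mem_ball_zero_iff] at hx ⊢
    rw [norm_smul, Real.norm_of_nonneg ht.1]
    exact (mul_le_of_le_one_left (norm_nonneg x) ht.2).trans_lt hx
  have hbd : ∀ x ∈ Metric.ball (0 : E) ρ, ∀ t ∈ Set.Icc (0 : ℝ) 1, ‖θ (t • x) x‖ ≤ 1 / 2 := by
    intro x hx t ht
    refine ((θ (t • x)).le_of_opNorm_le (hM _ (hsm x hx t ht)) x).trans ?_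
    rw [mem_ball_zero_iff] at hx
    exact (mul_le_mul_of_nonneg_left hx.le hM0).trans hs
  have hray : ∀ x ∈ Metric.ball (0 : E) ρ, ∀ t ∈ Set.Icc (0 : ℝ) 1, ∀ h : E,
      HasDerivAt (fun t : ℝ => θ (t • x) h) (θ' (t • x) x h) t := by
    intro x hx t ht h
    have h1 : HasDerivAt (fun t : ℝ => t • x) x t := by
      simpa using (hasDerivAt_id t).smul_const x
    have h2 := (hd _ (hsm x hx t ht)).comp_hasDerivAt t h1
    simpa using h2.clm_apply (hasDerivAt_const t h)
  have hex : ∀ x : E, ∃ Y : ℝ → A, x ∈ Metric.ball (0 : E) ρ → Y 0 = 1 ∧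
      (∀ t ∈ Set.Icc (0 : ℝ) 1, HasDerivWithinAt Y (Y t * θ (t • x) x) (Set.Icc 0 1) t) ∧
      ∀ t ∈ Set.Icc (0 : ℝ) 1, ‖Y t‖ ≤ Real.exp 1 := by
    intro x
    by_cases hx : x ∈ Metric.ball (0 : E) ρ
    · obtain ⟨Y, hY⟩ := exists_linear_solution (k := fun t => θ (t • x) x)
        (fun t ht => (hray x hx t ht x).continuousAt.continuousWithinAt) (hbd x hx)
      exact ⟨Y, fun _ => hY⟩
    · exact ⟨fun _ => 0, fun h => absurd h hx⟩
  choose Y hY using hex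
  have hlip : ∀ x ∈ Metric.ball (0 : E) ρ, ∀ y ∈ Metric.ball (0 : E) ρ,
      ‖θ y - θ x‖ ≤ M * ‖y - x‖ := fun x hx y hy =>
    (convex_ball 0 ρ).norm_image_sub_le_of_norm_hasFDerivWithin_le
      (fun z hz => (hd z hz).hasFDerivWithinAt) hM' hx hy
  have htaylor : ∀ x ∈ Metric.ball (0 : E) ρ, ∀ y ∈ Metric.ball (0 : E) ρ,
      ‖θ y - θ x - θ' x (y - x)‖ ≤ M * ‖y - x‖ * ‖y - x‖ := by
    intro x hx y hy
    have hseg : segment ℝ x y ⊆ Metric.ball 0 ρ := (convex_ball 0 ρ).segment_subset hx hy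
    refine (convex_segment x y).norm_image_sub_le_of_norm_hasFDerivWithin_le'
      (fun z hz => (hd z (hseg hz)).hasFDerivWithinAt) (fun z hz => ?_)
      (left_mem_segment ℝ x y) (right_mem_segment ℝ x y)
    refine (hL x hx z (hseg hz)).trans (mul_le_mul_of_nonneg_left ?_ hM0)
    exact norm_sub_le_of_mem_segment hz
  set C := M * (M * ρ + M) + M * ρ + M with hC
  have hC0 : 0 ≤ C := by positivity
  have key : ∀ x ∈ Metric.ball (0 : E) ρ, ∀ y ∈ Metric.ball (0 : E) ρ,
      ‖Y y 1 - Y x 1 - Y x 1 * θ x (y - x)‖ ≤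
        gronwallBound 0 (1 / 2) (Real.exp 1 * C * ‖y - x‖ ^ 2) 1 := by
    intro x hx y hy
    obtain ⟨x0, xd, xb⟩ := hY x hx
    obtain ⟨y0, yd, -⟩ := hY y hy
    set h := y - x with hh
    have hyx : y = x + h := by rw [hh]; abel
    have hd' : ∀ t ∈ Set.Icc (0 : ℝ) 1, HasDerivWithinAt
        (fun t => Y y t - Y x t * (1 + t • θ (t • x) h))
        (Y y t * θ (t • y) y - (Y x t * θ (t • x) x * (1 + t • θ (t • x) h) +
          Y x t * (t • θ' (t • x) x h + θ (t • x) h))) (Set.Icc 0 1) t := by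
      intro t ht
      have h1 := ((hasDerivAt_id' t).fun_smul (hray x hx t ht h)).const_add 1
      refine ((yd t ht).fun_sub ((xd t ht).fun_mul h1.hasDerivWithinAt)).congr_deriv ?_
      rw [one_smul]
    have hg := norm_le_gronwallBound_of_norm_deriv_right_le (δ := 0) (K := 1 / 2)
      (ε := Real.exp 1 * C * ‖h‖ ^ 2) (fun t ht => (hd' t ht).continuousWithinAt)
      (fun t ht => (hd' t ⟨ht.1, ht.2.le⟩).mono_of_mem_nhdsWithin (Icc_mem_nhdsGE_of_mem ht))
      (by simp [x0, y0]) (fun t ht => ?_) 1 (by simp)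
    · rw [sub_zero] at hg
      refine le_trans (le_of_eq ?_) hg
      simp only [one_smul]
      congr 1
      rw [mul_add, mul_one, sub_sub]
    · have ht' : t ∈ Set.Icc (0 : ℝ) 1 := ⟨ht.1, ht.2.le⟩
      have m1 := hsm x hx t ht'
      have m2 := hsm y hy t ht'
      have hty : t • y - t • x = t • h := by rw [← smul_sub]
      have hth : ‖t • h‖ ≤ ‖h‖ := by
        rw [norm_smul, Real.norm_of_nonneg ht.1]
        exact mul_le_of_le_one_left (norm_nonneg _) ht.2.le
      have l1 := hlip _ m1 _ m2
      have l2 := htaylor _ m1 _ m2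
      rw [hty] at l1 l2
      have l1' : ‖θ (t • y) - θ (t • x)‖ ≤ M * ‖h‖ := l1.trans (mul_le_mul_of_nonneg_left hth hM0)
      have l2' : ‖θ (t • y) - θ (t • x) - θ' (t • x) (t • h)‖ ≤ M * ‖h‖ * ‖h‖ :=
        l2.trans (mul_le_mul (mul_le_mul_of_nonneg_left hth hM0) hth (norm_nonneg _)
          (by positivity))
      have nx : ‖x‖ ≤ ρ := (mem_ball_zero_iff.1 hx).le
      have ny : ‖y‖ ≤ ρ := (mem_ball_zero_iff.1 hy).le
      -- All terms of the derivative of the error that are not proportional to the error itself;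
      -- each is quadratic in `h`, and `C` is the sum of the constants.
      set R := t • (θ (t • x) h * ((θ (t • y) - θ (t • x)) y + θ (t • x) h)) +
        (θ (t • y) - θ (t • x) - θ' (t • x) (t • h)) x + (θ (t • y) - θ (t • x)) h with hR
      have hRn : ‖R‖ ≤ C * ‖h‖ ^ 2 := by
        have r1 : ‖θ (t • x) h‖ ≤ M * ‖h‖ := (θ (t • x)).le_of_opNorm_le (hM _ m1) h
        have r2 : ‖(θ (t • y) - θ (t • x)) y‖ ≤ M * ‖h‖ * ρ :=
          (ContinuousLinearMap.le_of_opNorm_le _ l1' y).trans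
            (mul_le_mul_of_nonneg_left ny (by positivity))
        have r3 : ‖(θ (t • y) - θ (t • x)) h‖ ≤ M * ‖h‖ * ‖h‖ :=
          ContinuousLinearMap.le_of_opNorm_le _ l1' h
        have r4 : ‖(θ (t • y) - θ (t • x) - θ' (t • x) (t • h)) x‖ ≤ M * ‖h‖ * ‖h‖ * ρ :=
          (ContinuousLinearMap.le_of_opNorm_le _ l2' x).trans
            (mul_le_mul_of_nonneg_left nx (by positivity))
        have r5 : ‖t • (θ (t • x) h * ((θ (t • y) - θ (t • x)) y + θ (t • x) h))‖ ≤
            M * ‖h‖ * (M * ‖h‖ * ρ + M * ‖h‖) := by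
          rw [norm_smul, Real.norm_of_nonneg ht.1]
          refine (mul_le_of_le_one_left (norm_nonneg _) ht.2.le).trans ?_
          refine (norm_mul_le _ _).trans (mul_le_mul r1 ?_ (norm_nonneg _) (by positivity))
          exact (norm_add_le _ _).trans (add_le_add r2 r1)
        refine (norm_add_le _ _).trans ((add_le_add ((norm_add_le _ _).trans
          (add_le_add r5 r4)) r3).trans (le_of_eq ?_))
        rw [hC]; ring
      have hident : Y y t * θ (t • y) y - (Y x t * θ (t • x) x * (1 + t • θ (t • x) h) +
          Y x t * (t • θ' (t • x) x h + θ (t • x) h)) =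
          (Y y t - Y x t * (1 + t • θ (t • x) h)) * θ (t • y) y + Y x t * R := by
        -- Flatness is used only here: it exchanges `θ' x h` and `θ' h x` at the cost of a
        -- commutator, which cancels the first order terms in `h`.
        have hflat := hf _ m1 h x
        have e1 : θ' (t • x) x h = θ (t • x) h * θ (t • x) x + θ' (t • x) h x -
            θ (t • x) x * θ (t • x) h := by rw [hflat]; abel
        have e2 : θ (t • y) y = θ (t • y) x + θ (t • y) h := by
          rw [← map_add, ← hyx]
        have e3 : θ (t • x) y = θ (t • x) x + θ (t • x) h := by
          rw [← map_add, ← hyx]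
        rw [hR, e1]
        simp only [sub_apply, map_smul, smul_apply, e2, e3]
        simp only [mul_add, add_mul, mul_sub, sub_mul, smul_add, smul_sub, mul_one,
          smul_mul_assoc, mul_smul_comm, mul_assoc]
        abel
      rw [hident]
      refine (norm_add_le _ _).trans (add_le_add ?_ ?_)
      · rw [mul_comm (1 / 2)]
        exact (norm_mul_le _ _).trans (mul_le_mul_of_nonneg_left (hbd y hy t ht') (norm_nonneg _))
      · rw [mul_assoc]
        exact (norm_mul_le _ _).trans (mul_le_mul (xb t ht') hRn (norm_nonneg _)
          (Real.exp_pos _).le)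
  refine ⟨fun x => Y x 1, ?_, fun x hx => ?_⟩
  · obtain ⟨h0, h1, -⟩ := hY 0 (Metric.mem_ball_self hρ)
    rw [← h0]
    refine constant_of_has_deriv_right_zero (fun t ht => (h1 t ht).continuousWithinAt)
      (fun t ht => ?_) 1 (by simp)
    have := (h1 t ⟨ht.1, ht.2.le⟩).mono_of_mem_nhdsWithin (Icc_mem_nhdsGE_of_mem ht)
    simpa using this
  · rw [hasFDerivAt_iff_isLittleO]
    -- With zero initial error the Gronwall bound is linear in the forcing, hence quadratic in `‖y -
    -- x‖`.
    refine Asymptotics.IsBigO.trans_isLittleO (g := fun y => ‖y - x‖ ^ 2) ?_ ?_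
    · refine Asymptotics.IsBigO.of_bound (2 * (Real.exp 1 * C) * (Real.exp (1 / 2) - 1)) ?_
      filter_upwards [Metric.isOpen_ball.mem_nhds hx] with y hy
      refine (key x hx y hy).trans (le_of_eq ?_)
      rw [gronwallBound_of_K_ne_0 (by norm_num), norm_pow, norm_norm]
      norm_num
      ring
    · exact Asymptotics.isLittleO_pow_sub_sub x one_lt_two

end Flat

/-! ### One-forms in the plane: closed forms and flat connections. -/

section Forms
variable {F : Type*} [NormedAddCommGroup F] [NormedSpace ℝ F]

/-- The one-form with given components. -/
def oneForm (α β : ℝ × ℝ → F) (p : ℝ × ℝ) : ℝ × ℝ →L[ℝ] F :=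
  (ContinuousLinearMap.fst ℝ ℝ ℝ).smulRight (α p) + (ContinuousLinearMap.snd ℝ ℝ ℝ).smulRight (β p)

theorem oneForm_apply (α β : ℝ × ℝ → F) (p h : ℝ × ℝ) :
    oneForm α β p h = h.1 • α p + h.2 • β p := by
  simp [oneForm]

theorem hasD_oneForm {α β : ℝ × ℝ → F} {p : ℝ × ℝ} {a₁ a₂ b₁ b₂ : F} (ha : HasD α a₁ a₂ p)
    (hb : HasD β b₁ b₂ p) : HasD (oneForm α β)
      ((ContinuousLinearMap.fst ℝ ℝ ℝ).smulRight a₁ + (ContinuousLinearMap.snd ℝ ℝ ℝ).smulRight b₁)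
      ((ContinuousLinearMap.fst ℝ ℝ ℝ).smulRight a₂ + (ContinuousLinearMap.snd ℝ ℝ ℝ).smulRight b₂)
      p :=
  (ha.clm (ContinuousLinearMap.smulRightL ℝ (ℝ × ℝ) F (ContinuousLinearMap.fst ℝ ℝ ℝ))).add
    (hb.clm (ContinuousLinearMap.smulRightL ℝ (ℝ × ℝ) F (ContinuousLinearMap.snd ℝ ℝ ℝ)))

theorem hasD_oneForm_fderiv {α β : ℝ × ℝ → F} {p : ℝ × ℝ} {a₁ a₂ b₁ b₂ : F}
    (ha : HasD α a₁ a₂ p) (hb : HasD β b₁ b₂ p) (h k : ℝ × ℝ) :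
    fderiv ℝ (oneForm α β) p h k = k.1 • (h.1 • a₁ + h.2 • a₂) + k.2 • (h.1 • b₁ + h.2 • b₂) := by
  rw [HasFDerivAt.fderiv (hasD_oneForm ha hb)]
  simp only [add_apply, ContinuousLinearMap.smulRight_apply, ContinuousLinearMap.coe_fst',
    ContinuousLinearMap.coe_snd', smul_apply, smul_add, smul_smul]
  rw [mul_comm h.1 k.1, mul_comm h.2 k.1, mul_comm h.1 k.2, mul_comm h.2 k.2]
  abel

theorem contDiffOn_oneForm {α β : ℝ × ℝ → F} {V : Set (ℝ × ℝ)} (ha : ContDiffOn ℝ ∞ α V)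
    (hb : ContDiffOn ℝ ∞ β V) : ContDiffOn ℝ ∞ (oneForm α β) V :=
  (contDiffOn_const.smulRight ha).add (contDiffOn_const.smulRight hb)

/-- Poincaré lemma in the plane. -/
theorem exists_hasD_of_closed {F : Type*} [NormedAddCommGroup F] [NormedSpace ℝ F]
    [CompleteSpace F] {α β : ℝ × ℝ → F} {V : Set (ℝ × ℝ)} (hV : IsOpen V) (hc : Convex ℝ V)
    (ha : ContDiffOn ℝ ∞ α V) (hb : ContDiffOn ℝ ∞ β V) (h : ∀ p ∈ V, dV α p = dU β p) :
    ∃ z : ℝ × ℝ → F, ∀ p ∈ V, HasD z (α p) (β p) p := by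
  refine hc.exists_forall_hasFDerivAt_of_fderiv_symmetric hV
    (show DifferentiableOn ℝ (oneForm α β) V from
      (contDiffOn_oneForm ha hb).differentiableOn (by simp)) fun p hp x y => ?_
  change fderiv ℝ (oneForm α β) p x y = fderiv ℝ (oneForm α β) p y x
  rw [hasD_oneForm_fderiv (hasD_of_smooth hV ha hp) (hasD_of_smooth hV hb hp),
    hasD_oneForm_fderiv (hasD_of_smooth hV ha hp) (hasD_of_smooth hV hb hp), h p hp]
  module

/-- Frobenius theorem for flat connections in the plane. -/
theorem exists_parallel {A : Type*} [NormedRing A] [NormedAlgebra ℝ A] [CompleteSpace A]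
    [NormOneClass A] {a b : ℝ × ℝ → A} {V : Set (ℝ × ℝ)} (hV : IsOpen V)
    (ha : ContDiffOn ℝ ∞ a V) (hb : ContDiffOn ℝ ∞ b V)
    (hf : ∀ p ∈ V, a p * b p + dU b p = b p * a p + dV a p) {q : ℝ × ℝ} (hq : q ∈ V) :
    ∃ r > 0, Metric.ball q r ⊆ V ∧ ∃ X : ℝ × ℝ → A, X q = 1 ∧
      (∀ p ∈ Metric.ball q r, HasD X (X p * a p) (X p * b p) p) ∧
      ContDiffOn ℝ ∞ X (Metric.ball q r) := by
  set Θ := oneForm a b with hΘ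
  have sΘ : ContDiffOn ℝ ∞ Θ V := contDiffOn_oneForm ha hb
  have sΘ' : ContDiffOn ℝ ∞ (fderiv ℝ Θ) V := sΘ.fderiv_of_isOpen hV le_rfl
  obtain ⟨K, T, hT, hK⟩ := ((sΘ'.contDiffAt (hV.mem_nhds hq)).of_le
    (by simp : (1 : WithTop ℕ∞) ≤ ∞)).exists_lipschitzOnWith
  -- `M` bounds the form, its derivative and the Lipschitz constant of the derivative near `q`; a
  -- radius of at most `1/(2M)` then meets the smallness condition of `exists_parallel_aux`.
  set M := max (K : ℝ) (max (‖Θ q‖ + 1) (‖fderiv ℝ Θ q‖ + 1)) with hM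
  have c1 : ∀ᶠ p in nhds q, ‖Θ p‖ < ‖Θ q‖ + 1 :=
    (sΘ.continuousOn.continuousAt (hV.mem_nhds hq)).norm.eventually (gt_mem_nhds (lt_add_one _))
  have c2 : ∀ᶠ p in nhds q, ‖fderiv ℝ Θ p‖ < ‖fderiv ℝ Θ q‖ + 1 :=
    (ContinuousAt.norm (f := fderiv ℝ Θ)
      (sΘ'.continuousOn.continuousAt (hV.mem_nhds hq))).eventually_lt_const (lt_add_one _)
  obtain ⟨r₀, hr₀, hr⟩ := Metric.eventually_nhds_iff_ball.1
    (((show ∀ᶠ p in nhds q, p ∈ V from hV.mem_nhds hq).and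
      (show ∀ᶠ p in nhds q, p ∈ T from hT)).and (c1.and c2))
  have hM1 : 0 < M := (add_pos_of_nonneg_of_pos (norm_nonneg (Θ q)) one_pos).trans_le
    ((le_max_left _ _).trans (le_max_right _ _))
  set r := min r₀ (1 / (2 * M)) with hrdef
  have hr0 : 0 < r := lt_min hr₀ (by positivity)
  have hball : ∀ x ∈ Metric.ball (0 : ℝ × ℝ) r, q + x ∈ Metric.ball q r₀ := by
    intro x hx
    rw [mem_ball_iff_norm, add_sub_cancel_left]
    exact (mem_ball_zero_iff.1 hx).trans_le (min_le_left _ _)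
  have hrV : Metric.ball q r ⊆ V := fun p hp =>
    (hr p (Metric.ball_subset_ball (min_le_left _ _) hp)).1.1
  obtain ⟨X, hX0, hX⟩ := exists_parallel_aux (θ := fun x => Θ (q + x))
    (θ' := fun x => fderiv ℝ Θ (q + x)) hr0 (M := M)
    (fun x hx => by
      have h1 := (differentiableAt_of_smooth hV sΘ (hr _ (hball x hx)).1.1).hasFDerivAt
      have h2 := h1.comp x ((hasFDerivAt_id x).const_add q)
      rw [ContinuousLinearMap.comp_id] at h2
      exact h2)
    (fun x hx => (hr _ (hball x hx)).2.1.le.trans ((le_max_left _ _).trans (le_max_right _ _)))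
    (fun x hx => (hr _ (hball x hx)).2.2.le.trans ((le_max_right _ _).trans (le_max_right _ _)))
    (fun x hx y hy => by
      have := hK.dist_le_mul _ (hr _ (hball y hy)).1.2 _ (hr _ (hball x hx)).1.2
      rw [dist_eq_norm, dist_eq_norm, add_sub_add_left_eq_sub] at this
      exact this.trans (mul_le_mul_of_nonneg_right (le_max_left _ _) (norm_nonneg _)))
    (by
      have := mul_le_mul_of_nonneg_left (min_le_right r₀ (1 / (2 * M))) hM1.le
      refine this.trans (le_of_eq ?_)
      field_simp)
    (fun x hx h k => by
      have hp := (hr _ (hball x hx)).1.1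
      have e := hf _ hp
      have ha' := hasD_of_smooth hV ha hp
      have hb' := hasD_of_smooth hV hb hp
      simp only [hΘ, hasD_oneForm_fderiv ha' hb', oneForm_apply]
      rw [← sub_eq_zero] at e ⊢
      -- The curvature is alternating, so on arbitrary vectors it is the component identity times
      -- their determinant.
      have : (h.1 * k.2 - h.2 * k.1) • (a (q + x) * b (q + x) + dU b (q + x) -
        (b (q + x) * a (q + x) + dV a (q + x))) = 0 := by rw [e, smul_zero]
      rw [← this]
      simp only [mul_add, add_mul, smul_mul_smul_comm]
      module)
  have hD : ∀ p ∈ Metric.ball q r, HasD (fun p => X (p - q)) (X (p - q) * a p) (X (p - q) * b p) p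
      := by
    intro p hp
    have hp' : p - q ∈ Metric.ball 0 r := by
      rw [mem_ball_zero_iff, ← dist_eq_norm]; exact hp
    have h1 := (hX (p - q) hp').comp p ((hasFDerivAt_id p).sub_const q)
    refine hasD_of_hasFDerivAt h1 ?_ ?_ <;> simp [hΘ, oneForm_apply]
  refine ⟨r, hr0, hrV, fun p => X (p - q), by simp [hX0], hD, contDiffOn_infty.2 fun n => ?_⟩
  -- Bootstrap: the partial derivatives `X a`, `X b` are as smooth as `X`.
  induction n with
  | zero => exact contDiffOn_zero.2 fun p hp =>
      (hD p hp).differentiableAt.continuousAt.continuousWithinAt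
  | succ n ih =>
    exact contDiffOn_succ_of_hasD Metric.isOpen_ball hD
      (ih.mul ((ha.mono hrV).of_le (by norm_cast; simp)))
      (ih.mul ((hb.mono hrV).of_le (by norm_cast; simp)))

end Forms

/-! ### Existence of surfaces with given principal data -/

/-- The cross product as a continuous bilinear map. -/
def crossL : E3 →L[ℝ] E3 →L[ℝ] E3 :=
  (LinearMap.mk₂ ℝ cross
    (fun a b c => by ext i; fin_cases i <;> simp [cross] <;> ring)
    (fun r a b => by ext i; fin_cases i <;> simp [cross] <;> ring)
    (fun a b c => by ext i; fin_cases i <;> simp [cross] <;> ring)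
    (fun r a b => by ext i; fin_cases i <;> simp [cross] <;> ring)).toContinuousBilinearMap

theorem crossL_apply (a b : E3) : crossL a b = cross a b := rfl

/-- The standard basis vectors. -/
def stdVec (i : Fin 3) : E3 := EuclideanSpace.single i 1

theorem cross_stdVec (a b c : ℝ) :
    cross (a • stdVec 0 + b • stdVec 1 + c • stdVec 2) (stdVec 0) =
      c • stdVec 1 + (-b) • stdVec 2 ∧
    cross (a • stdVec 0 + b • stdVec 1 + c • stdVec 2) (stdVec 1) =
      (-c) • stdVec 0 + a • stdVec 2 ∧
    cross (a • stdVec 0 + b • stdVec 1 + c • stdVec 2) (stdVec 2) =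
      b • stdVec 0 + (-a) • stdVec 1 := by
  refine ⟨?_, ?_, ?_⟩ <;> ext i <;> fin_cases i <;> simp [cross, stdVec]

/-- Zero curvature of the connection given by the structure equations. -/
theorem crossL_flat {P Q r s P₂ Q₁ r₂ s₁ : ℝ} (h1 : P₂ = r * Q) (h2 : Q₁ = s * P)
    (h3 : r₂ + s₁ = -(P * Q)) :
    crossL ((0 : ℝ) • stdVec 0 + (-P) • stdVec 1 + (-r) • stdVec 2) *
        crossL (Q • stdVec 0 + (0 : ℝ) • stdVec 1 + s • stdVec 2) +
      crossL (Q₁ • stdVec 0 + (0 : ℝ) • stdVec 1 + s₁ • stdVec 2) =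
    crossL (Q • stdVec 0 + (0 : ℝ) • stdVec 1 + s • stdVec 2) *
        crossL ((0 : ℝ) • stdVec 0 + (-P) • stdVec 1 + (-r) • stdVec 2) +
      crossL ((0 : ℝ) • stdVec 0 + (-P₂) • stdVec 1 + (-r₂) • stdVec 2) := by
  have h3' : s₁ = -(P * Q) - r₂ := by linarith
  subst h1 h2 h3'
  ext v i
  fin_cases i <;> simp [crossL_apply, cross, stdVec] <;> ring

/-- A Parseval identity characterizes orthonormal frames. -/
theorem isFrame_of_parseval {x y l : E3} (h : ∀ v w : E3, inner ℝ x v * inner ℝ x w +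
    inner ℝ y v * inner ℝ y w + inner ℝ l v * inner ℝ l w = (inner ℝ v w : ℝ)) :
    IsFrame x y l := by
  set M : Matrix (Fin 3) (Fin 3) ℝ := Matrix.of ![x.ofLp, y.ofLp, l.ofLp] with hM
  have h1 : M.transpose * M = 1 := by
    ext i j
    have := h (stdVec i) (stdVec j)
    rw [Matrix.mul_apply, Fin.sum_univ_three]
    simp only [stdVec, EuclideanSpace.inner_single_right, one_mul, conj_trivial,
      PiLp.single_apply] at this
    simpa [hM, Matrix.one_apply, eq_comm] using this
  have h2 : M * M.transpose = 1 := mul_eq_one_comm.1 h1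
  have key : ∀ i j, M i 0 * M j 0 + M i 1 * M j 1 + M i 2 * M j 2 = if i = j then 1 else 0 := by
    intro i j
    have := congrFun (congrFun h2 i) j
    rwa [Matrix.mul_apply, Fin.sum_univ_three, Matrix.one_apply] at this
  constructor <;> rw [inner_E3]
  exacts [key 0 0, key 1 1, key 2 2, key 0 1, key 0 2, key 1 2]

/-- A frame has orientation `1` or `-1`, so on a connected set a continuous frame keeps its
orientation. -/
theorem IsFrame.triple_sq {x y l : E3} (h : IsFrame x y l) :
    cross x y = (inner ℝ l (cross x y) : ℝ) • l ∧ (inner ℝ l (cross x y) : ℝ) ^ 2 = 1 := by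
  have e := h.expand (cross x y)
  rw [inner_cross_left, inner_cross_right, zero_smul, zero_smul, zero_add, zero_add] at e
  refine ⟨e, ?_⟩
  have e2 := inner_cross_cross x y
  rw [h.xx, h.yy, h.xy] at e2
  nth_rw 1 [e] at e2
  rw [real_inner_smul_left] at e2
  linarith

/-- Bonnet's theorem in principal parameters. -/
theorem exists_surface {e g k₁ k₂ : ℝ × ℝ → ℝ} {V : Set (ℝ × ℝ)} (hV : IsOpen V)
    (se : ContDiffOn ℝ ∞ e V) (sg : ContDiffOn ℝ ∞ g V) (s₁ : ContDiffOn ℝ ∞ k₁ V)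
    (s₂ : ContDiffOn ℝ ∞ k₂ V) (he : ∀ p ∈ V, 0 < e p) (hg : ∀ p ∈ V, 0 < g p)
    (hk : ∀ p ∈ V, k₁ p ≠ k₂ p)
    (c1 : ∀ p ∈ V, dV (fun q => k₁ q * e q) p = dV e p / g p * (k₂ p * g p))
    (c2 : ∀ p ∈ V, dU (fun q => k₂ q * g q) p = dU g p / e p * (k₁ p * e p))
    (c3 : ∀ p ∈ V, dV (fun q => dV e q / g q) p + dU (fun q => dU g q / e q) p =
      -(k₁ p * e p * (k₂ p * g p))) {q : ℝ × ℝ} (hq : q ∈ V) :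
    ∃ r > 0, Metric.ball q r ⊆ V ∧ ∃ z l : ℝ × ℝ → E3,
      HasFrameData z l e g k₁ k₂ (Metric.ball q r) := by
  set P : ℝ × ℝ → ℝ := fun p => k₁ p * e p with hP
  set Q : ℝ × ℝ → ℝ := fun p => k₂ p * g p with hQ
  set R : ℝ × ℝ → ℝ := fun p => dV e p / g p with hR
  set S : ℝ × ℝ → ℝ := fun p => dU g p / e p with hS
  have sP : ContDiffOn ℝ ∞ P V := s₁.mul se
  have sQ : ContDiffOn ℝ ∞ Q V := s₂.mul sg
  have sR : ContDiffOn ℝ ∞ R V := (contDiffOn_dV hV se).div sg fun p hp => (hg p hp).ne'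
  have sS : ContDiffOn ℝ ∞ S V := (contDiffOn_dU hV sg).div se fun p hp => (he p hp).ne'
  -- `wU`, `wV` are the angular velocities of the frame in its own coordinates. The structure
  -- equations become `X_u = X (wU × ·)`, `X_v = X (wV × ·)`, and their flatness is Codazzi and
  -- Gauss.
  set wU : ℝ × ℝ → E3 := fun p => (0 : ℝ) • stdVec 0 + (-P p) • stdVec 1 + (-R p) • stdVec 2
    with hwU
  set wV : ℝ × ℝ → E3 := fun p => Q p • stdVec 0 + (0 : ℝ) • stdVec 1 + S p • stdVec 2 with hwV
  have dwU : ∀ p ∈ V, HasD wU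
      ((0 : ℝ) • stdVec 0 + (-dU P p) • stdVec 1 + (-dU R p) • stdVec 2)
      ((0 : ℝ) • stdVec 0 + (-dV P p) • stdVec 1 + (-dV R p) • stdVec 2) p := fun p hp => by
    refine ((((hasD_const (0 : ℝ) p).smul (hasD_const (stdVec 0) p)).add
      ((hasD_of_smooth hV sP hp).neg.smul (hasD_const (stdVec 1) p))).add
      ((hasD_of_smooth hV sR hp).neg.smul (hasD_const (stdVec 2) p))).eq ?_ ?_ <;> simp
  have dwV : ∀ p ∈ V, HasD wV
      (dU Q p • stdVec 0 + (0 : ℝ) • stdVec 1 + dU S p • stdVec 2)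
      (dV Q p • stdVec 0 + (0 : ℝ) • stdVec 1 + dV S p • stdVec 2) p := fun p hp => by
    refine ((((hasD_of_smooth hV sQ hp).smul (hasD_const (stdVec 0) p)).add
      ((hasD_const (0 : ℝ) p).smul (hasD_const (stdVec 1) p))).add
      ((hasD_of_smooth hV sS hp).smul (hasD_const (stdVec 2) p))).eq ?_ ?_ <;> simp
  have swU : ContDiffOn ℝ ∞ wU V := (contDiffOn_const.add (sP.neg.smul contDiffOn_const)).add
    (sR.neg.smul contDiffOn_const)
  have swV : ContDiffOn ℝ ∞ wV V := ((sQ.smul contDiffOn_const).add contDiffOn_const).add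
    (sS.smul contDiffOn_const)
  obtain ⟨r, hr, hrV, X, hX0, hX, sX⟩ := exists_parallel (a := fun p => crossL (wU p))
    (b := fun p => crossL (wV p)) hV (crossL.contDiff.comp_contDiffOn swU)
    (crossL.contDiff.comp_contDiffOn swV) (fun p hp => by
      rw [((dwV p hp).clm crossL).dU_eq, ((dwU p hp).clm crossL).dV_eq]
      exact crossL_flat (c1 p hp) (c2 p hp) (c3 p hp)) hq
  set B := Metric.ball q r with hB
  have oB : IsOpen B := Metric.isOpen_ball
  have cB : Convex ℝ B := convex_ball q r
  have hqB : q ∈ B := Metric.mem_ball_self hr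
  set x : ℝ × ℝ → E3 := fun p => X p (stdVec 0) with hx
  set y : ℝ × ℝ → E3 := fun p => X p (stdVec 1) with hy
  set l : ℝ × ℝ → E3 := fun p => X p (stdVec 2) with hl
  have dx : ∀ p ∈ B, HasD x (-R p • y p + P p • l p) (S p • y p) p := fun p hp => by
    refine ((hX p hp).clm (ContinuousLinearMap.apply ℝ E3 (stdVec 0))).eq ?_ ?_
    · change X p (cross ((0 : ℝ) • stdVec 0 + (-P p) • stdVec 1 + (-R p) • stdVec 2)
        (stdVec 0)) = _
      rw [(cross_stdVec _ _ _).1]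
      simp only [map_add, map_smul, neg_neg, hy, hl]
    · change X p (cross (Q p • stdVec 0 + (0 : ℝ) • stdVec 1 + S p • stdVec 2)
        (stdVec 0)) = _
      rw [(cross_stdVec _ _ _).1]
      simp only [map_smul, neg_zero, zero_smul, add_zero, hy]
  have dy : ∀ p ∈ B, HasD y (R p • x p) (-S p • x p + Q p • l p) p := fun p hp => by
    refine ((hX p hp).clm (ContinuousLinearMap.apply ℝ E3 (stdVec 1))).eq ?_ ?_
    · change X p (cross ((0 : ℝ) • stdVec 0 + (-P p) • stdVec 1 + (-R p) • stdVec 2)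
        (stdVec 1)) = _
      rw [(cross_stdVec _ _ _).2.1]
      simp only [map_smul, neg_neg, zero_smul, add_zero, hx]
    · change X p (cross (Q p • stdVec 0 + (0 : ℝ) • stdVec 1 + S p • stdVec 2)
        (stdVec 1)) = _
      rw [(cross_stdVec _ _ _).2.1]
      simp only [map_add, map_smul, hx, hl]
  have dl : ∀ p ∈ B, HasD l (-P p • x p) (-Q p • y p) p := fun p hp => by
    refine ((hX p hp).clm (ContinuousLinearMap.apply ℝ E3 (stdVec 2))).eq ?_ ?_
    · change X p (cross ((0 : ℝ) • stdVec 0 + (-P p) • stdVec 1 + (-R p) • stdVec 2)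
        (stdVec 2)) = _
      rw [(cross_stdVec _ _ _).2.2]
      simp only [map_smul, neg_zero, zero_smul, add_zero, hx]
    · change X p (cross (Q p • stdVec 0 + (0 : ℝ) • stdVec 1 + S p • stdVec 2)
        (stdVec 2)) = _
      rw [(cross_stdVec _ _ _).2.2]
      simp only [map_smul, zero_smul, zero_add, hy]
  have sx : ContDiffOn ℝ ∞ x B := sX.clm_apply contDiffOn_const
  have sy : ContDiffOn ℝ ∞ y B := sX.clm_apply contDiffOn_const
  have sl : ContDiffOn ℝ ∞ l B := sX.clm_apply contDiffOn_const
  have hframe : ∀ p ∈ B, IsFrame (x p) (y p) (l p) := fun p hp => isFrame_of_parseval fun v w => by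
    -- The frame equations are skew-symmetric, so the Parseval sum for fixed `v`, `w` is constant at
    -- once, whereas the derivatives of the Gram matrix entries involve one another. At `q` the
    -- frame is the standard basis.
    have hd : ∀ p ∈ B, HasD (fun p => (inner ℝ (x p) v * inner ℝ (x p) w +
        inner ℝ (y p) v * inner ℝ (y p) w + inner ℝ (l p) v * inner ℝ (l p) w : ℝ)) 0 0 p := by
      intro p hp
      have i := fun (a : E3) => (dx p hp).inner (hasD_const a p)
      have j := fun (a : E3) => (dy p hp).inner (hasD_const a p)
      have k := fun (a : E3) => (dl p hp).inner (hasD_const a p)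
      refine ((((i v).mul (i w)).add ((j v).mul (j w))).add ((k v).mul (k w))).eq ?_ ?_ <;>
      · simp only [inner_zero_right, zero_add, inner_add_left, real_inner_smul_left]
        ring
    rw [eq_of_hasD_zero oB cB.isPreconnected hd hp hqB]
    simp [hx, hy, hl, hX0, stdVec, inner_E3]
  have horient : ∀ p ∈ B, l p = cross (x p) (y p) := by
    -- The orientation is continuous with values `±1`, and it equals `1` at `q`.
    have hcont : ContinuousOn (fun p => (inner ℝ (l p) (cross (x p) (y p)) : ℝ)) B :=
      sl.continuousOn.inner (contDiffOn_cross sx sy).continuousOn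
    rcases cB.isPreconnected.eq_one_or_eq_neg_one_of_sq_eq hcont
      (fun p hp => (hframe p hp).triple_sq.2) with h1 | h1
    · intro p hp
      have h2 : (inner ℝ (l p) (cross (x p) (y p)) : ℝ) = 1 := h1 hp
      rw [(hframe p hp).triple_sq.1, h2, one_smul]
    · have h2 : (inner ℝ (l q) (cross (x q) (y q)) : ℝ) = -1 := h1 hqB
      simp [hx, hy, hl, hX0, stdVec, inner_E3, cross] at h2
      norm_num at h2
  have de := fun p hp => hasD_of_smooth hV se (hrV hp : p ∈ V)
  have dg := fun p hp => hasD_of_smooth hV sg (hrV hp : p ∈ V)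
  -- The form `e x du + g y dv` is closed: both mixed derivatives equal `e_v x + g_u y`.
  obtain ⟨z, hz⟩ := exists_hasD_of_closed oB cB ((se.mono hrV).smul sx) ((sg.mono hrV).smul sy)
    (fun p hp => by
      have e0 := (he p (hrV hp)).ne'
      have g0 := (hg p (hrV hp)).ne'
      refine ((de p hp).smul (dx p hp)).dV_eq.trans
        (Eq.trans ?_ ((dg p hp).smul (dy p hp)).dU_eq.symm)
      rw [smul_smul, smul_smul, hS, hR, mul_div_cancel₀ _ e0, mul_div_cancel₀ _ g0, add_comm])
  refine ⟨r, hr, hrV, z, l, IsMovingFrame.hasFrameData (x := x) (y := y)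
    ⟨hframe, horient, fun p hp => he p (hrV hp), fun p hp => hg p (hrV hp), hz, dl,
      fun p hp => hk p (hrV hp)⟩ oB ?_⟩
  exact contDiffOn_of_hasD oB hz ((se.mono hrV).smul sx) ((sg.mono hrV).smul sy)

/-! ### Surfaces with a given geometric function -/

/-- Every solution of the PDE of a basic class is the geometric function of a surface. -/
theorem exists_surface_of_PDE {C : BasicClass} (hC : C.Admissible) {V : Set (ℝ × ℝ)}
    {lam : ℝ × ℝ → ℝ} (hV : IsOpen V) (hl : ContDiffOn ℝ ∞ lam V) (hm : Set.MapsTo lam V C.range)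
    (hpde : ∀ x ∈ V, C.PDE lam x) {q : ℝ × ℝ} (hq : q ∈ V) :
    ∃ (V₀ : Set (ℝ × ℝ)) (w : ℝ × ℝ → E3), V₀ ⊆ V ∧
      IsBasicPatch C (C.constA (lam q)) (C.constB (lam q)) lam w V₀ q := by
  -- Restricting the values to an interval inside the range makes all integrals from `lam q`
  -- meaningful.
  obtain ⟨r, hr, hJ⟩ := Metric.isOpen_iff.1 C.isOpen_range _ (hm hq)
  set J := Metric.ball (lam q) r
  have oJ : IsOpen J := Metric.isOpen_ball
  have cJ : J.OrdConnected := (convex_ball (lam q) r).ordConnected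
  have h₀ : lam q ∈ J := Metric.mem_ball_self hr
  have hpair : IsWeingartenPair C.nu₁ C.nu₂ J := (C.isWeingartenPair hC).mono hJ
  set V₁ := V ∩ lam ⁻¹' J with hV₁
  have oV₁ : IsOpen V₁ := hl.continuousOn.isOpen_inter_preimage hV oJ
  have hl₁ : ContDiffOn ℝ ∞ lam V₁ := hl.mono Set.inter_subset_left
  have hm₁ : Set.MapsTo lam V₁ J := fun p hp => hp.2
  have hA := C.constA_ne hC (hm hq)
  have hB := C.constB_ne hC (hm hq)
  -- For the lengths prescribed by naturality the Codazzi equations are automatic and the PDE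
  -- supplies the Gauss equation.
  obtain ⟨ρ, hρ, hsub, w, l, hw⟩ := exists_surface (k₁ := fun p => C.nu₁ (lam p))
    (k₂ := fun p => C.nu₂ (lam p)) oV₁
    (smooth_natLen_f hpair oJ cJ h₀ hl₁ hm₁ (C.constA (lam q)))
    (smooth_natLen_g hpair oJ cJ h₀ hl₁ hm₁ (C.constB (lam q)))
    (hpair.smooth_f.comp hl₁ hm₁) (hpair.smooth_g.comp hl₁ hm₁)
    (fun p _ => natLen_pos _ _ hA _ _) (fun p _ => natLen_pos _ _ hB _ _)
    (fun p hp => (hpair.lt _ (hm₁ hp)).ne')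
    (fun p hp => natural_codazzi_one hpair oJ cJ h₀ hB oV₁ hl₁ hm₁ hp)
    (fun p hp => natural_codazzi_two hpair oJ cJ h₀ hA oV₁ hl₁ hm₁ hp)
    (fun p hp => (gauss_iff_naturalPDE hpair oJ cJ h₀ hA hB oV₁ hl₁ hm₁ hp).2
      ((C.naturalPDE_iff hC hV hl hm hp.1 ((cJ.uIcc_subset h₀ hp.2).trans hJ)).2
        (hpde p hp.1))) ⟨hq, h₀⟩
  refine ⟨Metric.ball q ρ, w, fun p hp => (hsub hp).1, ?_⟩
  exact
    { toIsPrincipalSurface := hw.toIsPrincipalSurface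
      nu_one := hw.nu₁_eq
      nu_two := hw.nu₂_eq
      constE := fun p hp => eq_natLen_iff.2 (hw.lenU_eq p hp)
      constG := fun p hp => eq_natLen_iff.2 (hw.lenV_eq p hp)
      connected := (convex_ball q ρ).isPreconnected
      base := Metric.mem_ball_self hρ
      relation := fun p hp => by
        have ht := hm (hsub hp).1
        obtain ⟨e1, e2, e3⟩ := hw.relation hp (C.nu_lt hC ht)
        rw [e1, e2, e3]
        exact C.relation_nu hC ht
      smooth_lam := hl.mono fun p hp => (hsub hp).1
      mapsTo_lam := fun p hp => hm (hsub hp).1 }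

/-! ### Uniqueness -/

theorem det_stdBasis (x y l : E3) :
    (EuclideanSpace.basisFun (Fin 3) ℝ).toBasis.det ![x, y, l] = inner ℝ l (cross x y) := by
  rw [Module.Basis.det_apply, Matrix.det_fin_three, inner_E3]
  simp [Module.Basis.toMatrix_apply, cross]
  ring

/-- The triple product of a frame with `l = x × y` is `1`, and a linear map multiplies triple
products by its determinant. -/
theorem det_eq_one_of_frames {x y l x' y' l' : E3} (h : IsFrame x y l) (h' : IsFrame x' y' l')
    (hl : l = cross x y) (hl' : l' = cross x' y') (R : E3 →ₗ[ℝ] E3) (hx : R x = x')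
    (hy : R y = y') (hR : R l = l') : LinearMap.det R = 1 := by
  have h1 := (EuclideanSpace.basisFun (Fin 3) ℝ).toBasis.det_comp R ![x, y, l]
  have h2 : (R ∘ ![x, y, l]) = ![x', y', l'] := by
    funext i; fin_cases i <;> simp [hx, hy, hR]
  rw [h2, det_stdBasis, det_stdBasis, ← hl, ← hl', h.ll, h'.ll, mul_one] at h1
  exact h1.symm

/-- Surfaces with the same principal curvatures and the same first fundamental form are
congruent. -/
theorem IsPrincipalSurface.congruent {z₁ z₂ : ℝ × ℝ → E3} {V : Set (ℝ × ℝ)}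
    (h₁ : IsPrincipalSurface z₁ V) (h₂ : IsPrincipalSurface z₂ V) (hc : IsPreconnected V)
    (hE : ∀ p ∈ V, lenU z₁ p = lenU z₂ p) (hG : ∀ p ∈ V, lenV z₁ p = lenV z₂ p)
    (hL : ∀ p ∈ V, coefL z₁ p / coefE z₁ p = coefL z₂ p / coefE z₂ p)
    (hN : ∀ p ∈ V, coefN z₁ p / coefG z₁ p = coefN z₂ p / coefG z₂ p) {q : ℝ × ℝ} (hq : q ∈ V) :
    ∃ (R : E3 ≃ₗᵢ[ℝ] E3) (τ : E3), LinearMap.det (R.toLinearEquiv : E3 →ₗ[ℝ] E3) = 1 ∧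
      ∀ x ∈ V, z₂ x = R (z₁ x) + τ := by
  have hV := h₁.isOpen
  have f₁ := h₁.isFrame hq
  have f₂ := h₂.isFrame hq
  set R : E3 ≃ₗᵢ[ℝ] E3 := f₁.basis.equiv f₂.basis (Equiv.refl _) with hR
  have hRx : R (unitU z₁ q) = unitU z₂ q := by
    have := f₁.basis.equiv_apply_basis f₂.basis (Equiv.refl _) 0
    simpa [f₁.basis_coe, f₂.basis_coe] using this
  have hRy : R (unitV z₁ q) = unitV z₂ q := by
    have := f₁.basis.equiv_apply_basis f₂.basis (Equiv.refl _) 1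
    simpa [f₁.basis_coe, f₂.basis_coe] using this
  have hRl : R (normal z₁ q) = normal z₂ q := by
    have := f₁.basis.equiv_apply_basis f₂.basis (Equiv.refl _) 2
    simpa [f₁.basis_coe, f₂.basis_coe] using this
  -- The left side is the isometry carrying the first frame at `p` to the second, applied to `v`. It
  -- is constant because both frames obey the same skew-symmetric structure equations.
  have hconst : ∀ v : E3, ∀ p ∈ V, (inner ℝ (unitU z₁ p) v : ℝ) • unitU z₂ p +
      (inner ℝ (unitV z₁ p) v : ℝ) • unitV z₂ p + (inner ℝ (normal z₁ p) v : ℝ) • normal z₂ p =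
      R v := by
    intro v p hp
    have hd : ∀ p ∈ V, HasD (fun p => (inner ℝ (unitU z₁ p) v : ℝ) • unitU z₂ p +
        (inner ℝ (unitV z₁ p) v : ℝ) • unitV z₂ p +
        (inner ℝ (normal z₁ p) v : ℝ) • normal z₂ p) 0 0 p := by
      intro p hp
      obtain ⟨a1, a2, a3⟩ := h₁.structure_equations hp
      obtain ⟨b1, b2, b3⟩ := h₂.structure_equations hp
      rw [h₁.coefL_div_lenU hp] at a1 a3
      rw [h₁.coefN_div_lenV hp] at a2 a3
      rw [h₂.coefL_div_lenU hp] at b1 b3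
      rw [h₂.coefN_div_lenV hp] at b2 b3
      rw [dV_congr hV hE hp, dU_congr hV hG hp, hE p hp, hG p hp, hL p hp] at a1
      rw [dV_congr hV hE hp, dU_congr hV hG hp, hE p hp, hG p hp, hN p hp] at a2
      rw [hE p hp, hG p hp, hL p hp, hN p hp] at a3
      refine ((((a1.inner (hasD_const v p)).smul b1).add
        ((a2.inner (hasD_const v p)).smul b2)).add
        ((a3.inner (hasD_const v p)).smul b3)).eq ?_ ?_ <;>
      · simp only [inner_zero_right, zero_add, inner_add_left, real_inner_smul_left]
        module
    rw [eq_of_hasD_zero hV hc hd hp hq]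
    conv_rhs => rw [f₁.expand v]
    rw [map_add, map_add, map_smul, map_smul, map_smul, hRx, hRy, hRl]
  have hX : ∀ p ∈ V, R (unitU z₁ p) = unitU z₂ p := fun p hp => by
    have f := h₁.isFrame hp
    rw [← hconst _ p hp, f.xx, real_inner_comm, f.xy, real_inner_comm, f.xl]
    simp
  have hY : ∀ p ∈ V, R (unitV z₁ p) = unitV z₂ p := fun p hp => by
    have f := h₁.isFrame hp
    rw [← hconst _ p hp, f.yy, f.xy, real_inner_comm, f.yl]
    simp
  have hd : ∀ p ∈ V, HasD (fun p => z₂ p - R (z₁ p)) 0 0 p := by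
    intro p hp
    have d1 := (hasD_of_smooth hV h₁.smooth hp).clm
      (R.toContinuousLinearEquiv : E3 →L[ℝ] E3)
    refine ((hasD_of_smooth hV h₂.smooth hp).sub d1).eq ?_ ?_
    · rw [h₁.dU_eq hp, h₂.dU_eq hp, hE p hp, map_smul, ← hX p hp]
      exact sub_self _
    · rw [h₁.dV_eq hp, h₂.dV_eq hp, hG p hp, map_smul, ← hY p hp]
      exact sub_self _
  refine ⟨R, z₂ q - R (z₁ q), det_eq_one_of_frames f₁ f₂ (h₁.normal_eq hq) (h₂.normal_eq hq) _
    hRx hRy hRl, fun p hp => ?_⟩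
  have := eq_of_hasD_zero hV hc hd hp hq
  rw [← this]; abel

theorem IsBasicPatch.unique {C : BasicClass} {a b : ℝ} {lam : ℝ × ℝ → ℝ} {w₁ w₂ : ℝ × ℝ → E3}
    {V : Set (ℝ × ℝ)} {q : ℝ × ℝ} (h₁ : IsBasicPatch C a b lam w₁ V q)
    (h₂ : IsBasicPatch C a b lam w₂ V q) :
    ∃ (R : E3 ≃ₗᵢ[ℝ] E3) (τ : E3), LinearMap.det (R.toLinearEquiv : E3 →ₗ[ℝ] E3) = 1 ∧
      ∀ x ∈ V, w₂ x = R (w₁ x) + τ :=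
  h₁.toIsPrincipalSurface.congruent h₂.toIsPrincipalSurface h₁.connected
    (fun p hp => (eq_natLen_iff.1 (h₁.constE p hp)).trans (eq_natLen_iff.1 (h₂.constE p hp)).symm)
    (fun p hp => (eq_natLen_iff.1 (h₁.constG p hp)).trans (eq_natLen_iff.1 (h₂.constG p hp)).symm)
    (fun p hp => (h₁.nu_one p hp).trans (h₂.nu_one p hp).symm)
    (fun p hp => (h₁.nu_two p hp).trans (h₂.nu_two p hp).symm) h₁.base

/-! ### Linear relations between the curvatures -/

/-- The surface `z` has principal curvatures `n₁ > n₂` over `D`, subject to a linear relation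
between `K`, `H` and `H'`. -/
structure IsLinearSurface (α β γ δ : ℝ) (z : ℝ × ℝ → E3) (D : Set (ℝ × ℝ))
    (n₁ n₂ : ℝ × ℝ → ℝ) : Prop extends IsPrincipalSurface z D where
  nu₁_eq : ∀ x ∈ D, coefL z x / coefE z x = n₁ x
  nu₂_eq : ∀ x ∈ D, coefN z x / coefG z x = n₂ x
  lt : ∀ x ∈ D, n₂ x < n₁ x
  rel : ∀ x ∈ D, δ * (n₁ x * n₂ x) = α * ((n₁ x + n₂ x) / 2) + β * ((n₁ x - n₂ x) / 2) + γ

/-- Near `p`, a homothetic image of some parallel surface of `z` belongs to a basic class. -/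
def HasBasicPatch (z : ℝ × ℝ → E3) (D : Set (ℝ × ℝ)) (p : ℝ × ℝ) : Prop :=
  ∃ (C : BasicClass) (d c : ℝ), C.Admissible ∧ 0 < c ∧ HasPatch C d c z D p

theorem HasBasicPatch.of_reparam {z : ℝ × ℝ → E3} {D V₀ : Set (ℝ × ℝ)} {φ₀ : ℝ × ℝ → ℝ × ℝ}
    {p₀ : ℝ × ℝ} (h₀ : IsReparam φ₀ V₀ D) (h : HasBasicPatch (z ∘ φ₀) V₀ p₀) :
    HasBasicPatch z D (φ₀ p₀) := by
  obtain ⟨C, d, c, hC, hc, h⟩ := h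
  exact ⟨C, d, c, hC, hc, h.of_reparam h₀⟩

theorem HasBasicPatch.mono {z : ℝ × ℝ → E3} {D V₀ : Set (ℝ × ℝ)} {p : ℝ × ℝ} (hV : IsOpen V₀)
    (hs : V₀ ⊆ D) (h : HasBasicPatch z V₀ p) : HasBasicPatch z D p := by
  obtain ⟨C, d, c, hC, hc, h⟩ := h
  exact ⟨C, d, c, hC, hc, h.mono hV hs⟩

theorem exists_sign {x : ℝ} (hx : x ≠ 0) : ∃ σ : ℝ, σ ^ 2 = 1 ∧ 0 < σ * x := by
  rcases lt_or_gt_of_ne hx with h | h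
  · exact ⟨-1, by norm_num, by linarith⟩
  · exact ⟨1, by norm_num, by linarith⟩

theorem sign_unique {s x : ℝ} (hs : s ^ 2 = 1) {t : ℝ} (ht : t ^ 2 = 1)
    (h1 : 0 < s * x) (h2 : 0 < t * x) : s = t := by
  rcases sq_eq_one_iff.1 hs with rfl | rfl <;>
    rcases sq_eq_one_iff.1 ht with rfl | rfl <;> first | rfl | linarith

namespace IsLinearSurface

variable {α β γ δ : ℝ} {z : ℝ × ℝ → E3} {D : Set (ℝ × ℝ)} {n₁ n₂ : ℝ × ℝ → ℝ} {p : ℝ × ℝ}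

theorem continuousOn_nu₁ (h : IsLinearSurface α β γ δ z D n₁ n₂) : ContinuousOn n₁ D :=
  h.smooth_nu.1.continuousOn.congr fun x hx => (h.nu₁_eq x hx).symm

theorem continuousOn_nu₂ (h : IsLinearSurface α β γ δ z D n₁ n₂) : ContinuousOn n₂ D :=
  h.smooth_nu.2.continuousOn.congr fun x hx => (h.nu₂_eq x hx).symm

theorem mono (h : IsLinearSurface α β γ δ z D n₁ n₂) {V : Set (ℝ × ℝ)} (hV : IsOpen V)
    (hs : V ⊆ D) : IsLinearSurface α β γ δ z V n₁ n₂ :=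
  ⟨h.toIsPrincipalSurface.mono hV hs, fun x hx => h.nu₁_eq x (hs hx),
    fun x hx => h.nu₂_eq x (hs hx), fun x hx => h.lt x (hs hx), fun x hx => h.rel x (hs hx)⟩

/-- Passing to the parallel surface transforms the linear relation. -/
theorem hasBasicPatch (h : IsLinearSurface α β γ δ z D n₁ n₂) (hp : p ∈ D) {C : BasicClass}
    (hC : C.Admissible) {d c s : ℝ} (hc : 0 < c) (hs : s ^ 2 = 1)
    (hd : 0 < s * ((1 - d * n₁ p) * (1 - d * n₂ p)))
    (himp : ∀ m₁ m₂ : ℝ, m₂ < m₁ → (δ - α * d - γ * d ^ 2) * c ^ 2 * (m₁ * m₂) =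
      s * c * (α + 2 * γ * d) * ((m₁ + m₂) / 2) + s * c * β * ((m₁ - m₂) / 2) + γ →
      C.Relation (m₁ * m₂) ((m₁ + m₂) / 2) ((m₁ - m₂) / 2)) : HasBasicPatch z D p := by
  have hne := right_ne_zero_of_mul hd.ne'
  obtain ⟨σ, hσ, h1⟩ := exists_sign (left_ne_zero_of_mul hne)
  obtain ⟨τ, hτ, h2⟩ := exists_sign (right_ne_zero_of_mul hne)
  -- The sign `s` compares the normal of the parallel surface with `l`; it multiplies the
  -- coefficients of `H` and `H'` in the transformed relation.
  have hst : s = σ * τ := by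
    refine sign_unique hs (by rw [mul_pow, hσ, hτ, one_mul]) hd ?_
    have := mul_pos h1 h2
    linarith
  have oV : IsOpen ((D ∩ (fun x => σ * (1 - d * n₁ x)) ⁻¹' Set.Ioi 0) ∩
      (D ∩ (fun x => τ * (1 - d * n₂ x)) ⁻¹' Set.Ioi 0)) :=
    ((continuousOn_const.mul (continuousOn_const.sub (continuousOn_const.mul
      h.continuousOn_nu₁))).isOpen_inter_preimage h.isOpen isOpen_Ioi).inter
      ((continuousOn_const.mul (continuousOn_const.sub (continuousOn_const.mul
      h.continuousOn_nu₂))).isOpen_inter_preimage h.isOpen isOpen_Ioi)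
  refine HasBasicPatch.mono oV (fun x hx => hx.1.1) ⟨C, d, c, hC, hc, ?_⟩
  have h' := h.mono oV fun x hx => hx.1.1
  refine hasPatch_of_relation hC h'.toIsPrincipalSurface hσ hτ hc h'.nu₁_eq h'.nu₂_eq
    (fun x hx => hx.1.2) (fun x hx => hx.2.2) h'.lt (fun _ => rfl) (fun _ => rfl)
    (fun x hx => ?_) ⟨⟨hp, h1⟩, ⟨hp, h2⟩⟩
  have a1 : 0 < σ * (1 - d * n₁ x) := hx.1.2
  have a2 : 0 < τ * (1 - d * n₂ x) := hx.2.2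
  have r1 := right_ne_zero_of_mul a1.ne'
  have r2 := right_ne_zero_of_mul a2.ne'
  have hlt := sub_pos.2 (h'.lt x hx)
  have hrel := h'.rel x hx
  have hdiff : σ * τ * (n₁ x / (c * (1 - d * n₁ x))) - σ * τ * (n₂ x / (c * (1 - d * n₂ x))) =
      σ * (1 - d * n₁ x) * (τ * (1 - d * n₂ x)) * (n₁ x - n₂ x) /
        (c * (1 - d * n₁ x) ^ 2 * (1 - d * n₂ x) ^ 2) := by
    rw [show n₁ x - n₂ x = n₁ x * (1 - d * n₂ x) - n₂ x * (1 - d * n₁ x) by ring]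
    generalize 1 - d * n₁ x = r at *
    generalize 1 - d * n₂ x = t at *
    field_simp
  refine himp _ _ (sub_pos.1 ?_) ?_
  · rw [hdiff]; positivity
  · subst hst
    have hσ' : σ * σ = 1 := by rw [← sq, hσ]
    have hτ' : τ * τ = 1 := by rw [← sq, hτ]
    have e1 : (σ * τ * (n₁ x / (c * (1 - d * n₁ x)))) * (σ * τ * (n₂ x / (c * (1 - d * n₂ x)))) *
        c ^ 2 = n₁ x * n₂ x / ((1 - d * n₁ x) * (1 - d * n₂ x)) := by
      rw [show n₁ x * n₂ x / ((1 - d * n₁ x) * (1 - d * n₂ x)) =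
        (σ * σ) * (τ * τ) * (n₁ x * n₂ x / ((1 - d * n₁ x) * (1 - d * n₂ x))) by
          rw [hσ', hτ']; ring]
      field_simp
    have e2 : ∀ k r : ℝ, r ≠ 0 → σ * τ * c * (σ * τ * (k / (c * r))) = k / r := by
      intro k r hr
      rw [show k / r = (σ * σ) * (τ * τ) * (k / r) by rw [hσ', hτ']; ring]
      field_simp
    have e3 : σ * τ * c * (α + 2 * γ * d) * ((σ * τ * (n₁ x / (c * (1 - d * n₁ x))) +
        σ * τ * (n₂ x / (c * (1 - d * n₂ x)))) / 2) + σ * τ * c * β *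
        ((σ * τ * (n₁ x / (c * (1 - d * n₁ x))) - σ * τ * (n₂ x / (c * (1 - d * n₂ x)))) / 2) =
        (α + 2 * γ * d) * ((n₁ x / (1 - d * n₁ x) + n₂ x / (1 - d * n₂ x)) / 2) +
          β * ((n₁ x / (1 - d * n₁ x) - n₂ x / (1 - d * n₂ x)) / 2) := by
      rw [← e2 _ _ r1, ← e2 _ _ r2]; ring
    rw [e3, mul_assoc, mul_comm (c ^ 2), e1, ← sub_eq_zero]
    -- The transformed relation is the given one divided by `(1 - d n₁)(1 - d n₂)`.
    have : (δ - α * d - γ * d ^ 2) * (n₁ x * n₂ x / ((1 - d * n₁ x) * (1 - d * n₂ x))) -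
        ((α + 2 * γ * d) * ((n₁ x / (1 - d * n₁ x) + n₂ x / (1 - d * n₂ x)) / 2) +
          β * ((n₁ x / (1 - d * n₁ x) - n₂ x / (1 - d * n₂ x)) / 2) + γ) =
        (δ * (n₁ x * n₂ x) - (α * ((n₁ x + n₂ x) / 2) + β * ((n₁ x - n₂ x) / 2) + γ)) /
          ((1 - d * n₁ x) * (1 - d * n₂ x)) := by
      field_simp
      ring
    rw [this, hrel, sub_self, zero_div]

/-- Interchanging the parameters reverses the normal: `H` changes sign while `K` and `H'` do not, so
only `α` is negated. -/
theorem exists_neg (h : IsLinearSurface α β γ δ z D n₁ n₂) (hp : p ∈ D) :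
    ∃ (V : Set (ℝ × ℝ)) (φ : ℝ × ℝ → ℝ × ℝ) (q : ℝ × ℝ), IsReparam φ V D ∧ q ∈ V ∧ φ q = p ∧
      IsLinearSurface (-α) β γ δ (z ∘ φ) V (fun x => -n₂ (φ x)) fun x => -n₁ (φ x) := by
  obtain ⟨V, φ, q, r, hq, e, P, hn⟩ := h.exists_swap hp
  refine ⟨V, φ, q, r, hq, e, P, fun x hx => ?_, fun x hx => ?_, fun x hx => ?_, fun x hx => ?_⟩
  · rw [(hn x hx).1, h.nu₂_eq _ (r.mapsTo hx)]
  · rw [(hn x hx).2, h.nu₁_eq _ (r.mapsTo hx)]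
  · exact neg_lt_neg (h.lt _ (r.mapsTo hx))
  · have := h.rel _ (r.mapsTo hx)
    linear_combination this

/-- Distances which are roots of a quadratic equation are never focal. -/
theorem not_focal (h : IsLinearSurface α β γ δ z D n₁ n₂) (hp : p ∈ D)
    (hne : α ^ 2 - β ^ 2 + 4 * γ * δ ≠ 0) {d : ℝ} (hd : δ = α * d + γ * d ^ 2) :
    (1 - d * n₁ p) * (1 - d * n₂ p) ≠ 0 := by
  have hlt := (sub_pos.2 (h.lt p hp)).ne'
  have hrel := h.rel p hp
  intro h0
  apply hne
  subst hd
  rcases mul_eq_zero.1 h0 with h0 | h0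
  -- With `A = α + 2γd`, the excluded quantity is `A² - β²` for a root `d`. At a focal point the
  -- relation would force `A = -β` or `A = β`.
  · have : (n₁ p - n₂ p) * (α + 2 * γ * d + β) = 0 := by
      linear_combination -2 * hrel - 2 * (α * n₂ p + γ * d * n₂ p + γ) * h0
    have := (mul_eq_zero.1 this).resolve_left hlt
    linear_combination (α + 2 * γ * d - β) * this
  · have : (n₁ p - n₂ p) * (α + 2 * γ * d - β) = 0 := by
      linear_combination 2 * hrel + 2 * (α * n₁ p + γ * d * n₁ p + γ) * h0
    have := (mul_eq_zero.1 this).resolve_left hlt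
    linear_combination (α + 2 * γ * d + β) * this

/-- At a root the coefficient of `K` vanishes and the relation reads `H = -(β/A) H' - s γ/(A c)`.
The sign hypothesis makes the constant term positive, and the choice of `c` normalizes it to `1`, or
to `1/2` if `β = 0`. -/
theorem hasBasicPatch_of_root_of_pos (h : IsLinearSurface α β γ δ z D n₁ n₂) (hp : p ∈ D)
    (hne : α ^ 2 - β ^ 2 + 4 * γ * δ ≠ 0) {d s : ℝ} (hd : δ = α * d + γ * d ^ 2)
    (hs : s ^ 2 = 1) (hr : 0 < s * ((1 - d * n₁ p) * (1 - d * n₂ p)))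
    (hA : s * γ * (α + 2 * γ * d) < 0) : HasBasicPatch z D p := by
  set A := α + 2 * γ * d with hAdef
  have hA0 : A ≠ 0 := right_ne_zero_of_mul hA.ne
  have hAβ : A ^ 2 ≠ β ^ 2 := fun e => hne (by rw [hd]; rw [hAdef] at e; linear_combination e)
  have hk : 0 < -(s * γ) / A := by
    rw [show -(s * γ) / A = -(s * γ * A) / A ^ 2 by field_simp]
    exact div_pos (neg_pos.2 hA) (by positivity)
  have key : ∀ c : ℝ, 0 < c → ∀ m₁ m₂ : ℝ, (δ - α * d - γ * d ^ 2) * c ^ 2 * (m₁ * m₂) =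
      s * c * A * ((m₁ + m₂) / 2) + s * c * β * ((m₁ - m₂) / 2) + γ →
      (m₁ + m₂) / 2 = -β / A * ((m₁ - m₂) / 2) + -(s * γ) / A / c := by
    intro c hc m₁ m₂ e
    rw [show δ - α * d - γ * d ^ 2 = 0 by rw [hd]; ring] at e
    field_simp
    linear_combination -2 * s * e - (c * A * (m₁ + m₂) + c * β * (m₁ - m₂)) * hs
  by_cases hβ : β = 0
  · refine h.hasBasicPatch hp (C := .c2) trivial (c := 2 * (-(s * γ) / A)) (by positivity) hs hr
      fun m₁ m₂ _ e => ?_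
    have := key _ (by positivity) m₁ m₂ e
    rw [hβ, neg_zero, zero_div, zero_mul, zero_add] at this
    refine this.trans ?_
    generalize -(s * γ) / A = k at hk
    field_simp
  have hb : -β / A ≠ 0 := div_ne_zero (neg_ne_zero.2 hβ) hA0
  have hb1 : (-β / A) ^ 2 ≠ 1 := by
    rw [div_pow, neg_sq, Ne, div_eq_one_iff_eq (pow_ne_zero 2 hA0)]
    exact hAβ.symm
  have fin : ∀ m₁ m₂ : ℝ, (δ - α * d - γ * d ^ 2) * (-(s * γ) / A) ^ 2 * (m₁ * m₂) =
      s * (-(s * γ) / A) * A * ((m₁ + m₂) / 2) + s * (-(s * γ) / A) * β * ((m₁ - m₂) / 2) + γ →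
      (m₁ + m₂) / 2 = -β / A * ((m₁ - m₂) / 2) + 1 := fun m₁ m₂ e => by
    rw [key _ hk m₁ m₂ e, div_self hk.ne']
  rcases lt_or_gt_of_ne hb1 with hlt | hgt
  · exact h.hasBasicPatch hp (C := .c7 (-β / A)) ⟨hlt, hb⟩ hk hs hr fun m₁ m₂ _ e => fin m₁ m₂ e
  · exact h.hasBasicPatch hp (C := .c6 (-β / A)) hgt hk hs hr fun m₁ m₂ _ e => fin m₁ m₂ e

theorem hasBasicPatch_of_root (h : IsLinearSurface α β γ δ z D n₁ n₂) (hp : p ∈ D)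
    (hne : α ^ 2 - β ^ 2 + 4 * γ * δ ≠ 0) {d : ℝ} (hd : δ = α * d + γ * d ^ 2) :
    HasBasicPatch z D p := by
  obtain ⟨s, hs, hr⟩ := exists_sign (h.not_focal hp hne hd)
  have hs0 : s ≠ 0 := left_ne_zero_of_mul hr.ne'
  set A := α + 2 * γ * d with hAdef
  have hAβ : A ^ 2 ≠ β ^ 2 := fun e => hne (by rw [hd]; rw [hAdef] at e; linear_combination e)
  have hd0 : δ - α * d - γ * d ^ 2 = 0 := by rw [hd]; ring
  by_cases hA0 : A = 0
  · have hβ : β ≠ 0 := fun e => hAβ (by rw [hA0, e])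
    by_cases hγ : γ = 0
    -- The transformed relation would be `β H' = 0`, impossible without umbilics. The class named is
    -- therefore immaterial.
    · refine h.hasBasicPatch hp (C := .c1) trivial one_pos hs hr fun m₁ m₂ hm e => ?_
      rw [hd0, ← hAdef, hA0, hγ] at e
      have : s * β * (m₁ - m₂) = 0 := by linear_combination -2 * e
      exact absurd this (mul_ne_zero (mul_ne_zero hs0 hβ) (sub_pos.2 hm).ne')
    -- The relation is `s c β H' + γ = 0`, so this homothety factor makes `H' = 1`.
    · have hk : 0 < |γ / β| := abs_pos.2 (div_ne_zero hγ hβ)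
      refine h.hasBasicPatch hp (C := .c3) trivial hk hs hr fun m₁ m₂ hm e => ?_
      rw [hd0, ← hAdef, hA0] at e
      have e1 : γ / β = -(s * |γ / β| * ((m₁ - m₂) / 2)) := by
        rw [div_eq_iff hβ]; linear_combination -e
      have hsabs : |s| = 1 := (pow_eq_one_iff_of_nonneg (abs_nonneg s) two_ne_zero).1
        (by rw [sq_abs, hs])
      have e2 := congrArg abs e1
      rw [abs_neg, abs_mul, abs_mul, hsabs, abs_abs, one_mul,
        abs_of_pos (half_pos (sub_pos.2 hm))] at e2
      exact (mul_left_cancel₀ hk.ne' (by rw [mul_one]; exact e2)).symm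
  rcases lt_trichotomy (s * γ * A) 0 with hlt | h0 | hgt
  · exact h.hasBasicPatch_of_root_of_pos hp hne hd hs hr hlt
  · have hγ : γ = 0 := (mul_eq_zero.1 ((mul_eq_zero.1 h0).resolve_right hA0)).resolve_left hs0
    have key : ∀ m₁ m₂ : ℝ, (δ - α * d - γ * d ^ 2) * 1 ^ 2 * (m₁ * m₂) =
        s * 1 * A * ((m₁ + m₂) / 2) + s * 1 * β * ((m₁ - m₂) / 2) + γ →
        (m₁ + m₂) / 2 = -β / A * ((m₁ - m₂) / 2) := by
      intro m₁ m₂ e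
      rw [hd0, hγ] at e
      field_simp
      linear_combination -2 * s * e - (A * (m₁ + m₂) + β * (m₁ - m₂)) * hs
    by_cases hβ : β = 0
    · refine h.hasBasicPatch hp (C := .c1) trivial one_pos hs hr fun m₁ m₂ _ e => ?_
      refine (key m₁ m₂ e).trans ?_
      rw [hβ, neg_zero, zero_div, zero_mul]
    have hb : -β / A ≠ 0 := div_ne_zero (neg_ne_zero.2 hβ) hA0
    have hb1 : (-β / A) ^ 2 ≠ 1 := by
      rw [div_pow, neg_sq, Ne, div_eq_one_iff_eq (pow_ne_zero 2 hA0)]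
      exact hAβ.symm
    rcases lt_or_gt_of_ne hb1 with hlt | hgt
    · exact h.hasBasicPatch hp (C := .c5 (-β / A)) ⟨hlt, hb⟩ one_pos hs hr
        fun m₁ m₂ _ e => key m₁ m₂ e
    · exact h.hasBasicPatch hp (C := .c4 (-β / A)) hgt one_pos hs hr
        fun m₁ m₂ _ e => key m₁ m₂ e
  -- Reversing the orientation replaces `α`, `d` by their negatives, hence `A` by `-A`, without
  -- changing `s`; the sign condition is then met.
  · obtain ⟨V, φ, q, r, hq, rfl, h'⟩ := h.exists_neg hp
    refine HasBasicPatch.of_reparam r (h'.hasBasicPatch_of_root_of_pos hq (by rwa [neg_sq])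
      (d := -d) (by rw [hd]; ring) hs ?_ ?_)
    · rw [show (1 - -d * -n₂ (φ q)) * (1 - -d * -n₁ (φ q)) =
        (1 - d * n₁ (φ q)) * (1 - d * n₂ (φ q)) by ring]
      exact hr
    · rw [hAdef] at hgt
      linarith

/-- The equation `γ d² + α d = δ` has discriminant `α² + 4γδ`, so a real root exists except when `α
= γ = 0` and `δ ≠ 0`. Then `δ K = β H'` is preserved by parallel surfaces up to the sign of `β`, and
class 9 is reached. -/
theorem hasBasicPatch_of_discrim_nonneg (h : IsLinearSurface α β γ δ z D n₁ n₂) (hp : p ∈ D)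
    (hne : α ^ 2 - β ^ 2 + 4 * γ * δ ≠ 0) (hΔ : 0 ≤ α ^ 2 + 4 * γ * δ) :
    HasBasicPatch z D p := by
  by_cases hγ : γ = 0
  · by_cases hα : α = 0
    · by_cases hδ : δ = 0
      · exact h.hasBasicPatch_of_root hp hne (d := 0) (by rw [hδ]; ring)
      subst hγ hα
      have hβ : β ≠ 0 := fun e => hne (by rw [e]; ring)
      have hrel := h.rel p hp
      have hlt := h.lt p hp
      rcases lt_or_gt_of_ne (div_ne_zero hβ hδ) with hk | hk
      · have hK : n₁ p * n₂ p = β / δ * ((n₁ p - n₂ p) / 2) := by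
          field_simp; linear_combination 2 * hrel
        have hK0 : n₁ p * n₂ p < 0 := by
          rw [hK]; exact mul_neg_of_neg_of_pos hk (half_pos (sub_pos.2 hlt))
        have hn1 : 0 < n₁ p := by
          by_contra hcon
          rw [not_lt] at hcon
          exact absurd (mul_nonneg_of_nonpos_of_nonpos hcon (hlt.le.trans hcon)) (not_le.2 hK0)
        have hn2 : n₂ p < 0 := (pos_iff_neg_of_mul_neg hK0).1 hn1
        -- Here `K < 0`, so `n₂ < 0 < n₁`. The distance `2 / n₁(p)` makes `1 - d n₁ = -1` and `1 - d
        -- n₂ > 0` at `p`; the reversed normal changes the sign of `β`.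
        refine h.hasBasicPatch hp (C := .c9) trivial (d := 2 / n₁ p) (c := -(β / δ) / 2) (s := -1)
          (by linarith) (by norm_num) ?_ fun m₁ m₂ _ e => ?_
        · rw [div_mul_cancel₀ _ hn1.ne']
          have : 2 / n₁ p * n₂ p < 0 := mul_neg_of_pos_of_neg (by positivity) hn2
          linarith
        · change m₁ * m₂ = 2 * ((m₁ - m₂) / 2)
          have e1 : δ * (β / δ) = β := mul_div_cancel₀ _ hδ
          have hb : (β / δ) * β ≠ 0 := mul_ne_zero hk.ne hβ
          refine mul_left_cancel₀ hb ?_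
          linear_combination 4 * e + (-(β / δ) * (m₁ * m₂)) * e1
      · refine h.hasBasicPatch hp (C := .c9) trivial (d := 0) (c := β / δ / 2) (s := 1)
          (by linarith) (by norm_num) (by norm_num) fun m₁ m₂ _ e => ?_
        change m₁ * m₂ = 2 * ((m₁ - m₂) / 2)
        have e1 : δ * (β / δ) = β := mul_div_cancel₀ _ hδ
        have hb : (β / δ) * β ≠ 0 := mul_ne_zero hk.ne' hβ
        refine mul_left_cancel₀ hb ?_
        linear_combination 4 * e + (-(β / δ) * (m₁ * m₂)) * e1
    · exact h.hasBasicPatch_of_root hp hne (d := δ / α) (by rw [hγ]; field_simp; ring)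
  · refine h.hasBasicPatch_of_root hp hne
      (d := (-α + Real.sqrt (α ^ 2 + 4 * γ * δ)) / (2 * γ)) ?_
    have := Real.sq_sqrt hΔ
    generalize Real.sqrt (α ^ 2 + 4 * γ * δ) = r at this
    field_simp
    linear_combination -this

/-- No distance removes `K`, but `d = -α/(2γ)` removes `H`. What remains is `δ' K = s β H' + γ` with
`γ/δ' < 0`, which is class 8 or 10. -/
theorem hasBasicPatch_of_discrim_neg (h : IsLinearSurface α β γ δ z D n₁ n₂) (hp : p ∈ D)
    (hΔ : α ^ 2 + 4 * γ * δ < 0)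
    (hd : (1 - -α / (2 * γ) * n₁ p) * (1 - -α / (2 * γ) * n₂ p) ≠ 0) : HasBasicPatch z D p := by
  obtain ⟨s, hs, hr⟩ := exists_sign hd
  have hγ : γ ≠ 0 := by rintro rfl; nlinarith [sq_nonneg α]
  have hδ : δ - α * (-α / (2 * γ)) - γ * (-α / (2 * γ)) ^ 2 = (α ^ 2 + 4 * γ * δ) / (4 * γ) := by
    field_simp; ring
  have hA : α + 2 * γ * (-α / (2 * γ)) = 0 := by field_simp; ring
  set δ' := (α ^ 2 + 4 * γ * δ) / (4 * γ) with hδ'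
  have hδ0 : δ' ≠ 0 := div_ne_zero hΔ.ne (by positivity)
  have hk : γ / δ' < 0 := by
    rw [hδ', show γ / ((α ^ 2 + 4 * γ * δ) / (4 * γ)) = 4 * γ ^ 2 / (α ^ 2 + 4 * γ * δ) by
      field_simp]
    exact div_neg_of_pos_of_neg (by positivity) hΔ
  by_cases hβ : β = 0
  -- The relation `δ' c² K = γ` becomes `K = -1` for this `c`.
  · have hc : 0 < Real.sqrt (-(γ / δ')) := Real.sqrt_pos.2 (neg_pos.2 hk)
    refine h.hasBasicPatch hp (C := .c8) trivial hc hs hr fun m₁ m₂ _ e => ?_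
    rw [hδ, hA, hβ, Real.sq_sqrt (neg_pos.2 hk).le] at e
    have e1 : δ' * (γ / δ') = γ := mul_div_cancel₀ _ hδ0
    refine mul_left_cancel₀ hγ ?_
    linear_combination -e - (m₁ * m₂) * e1
  · have hs0 : s ≠ 0 := left_ne_zero_of_mul hr.ne'
    refine h.hasBasicPatch hp (C := .c10 (s * β / δ') (γ / δ'))
      ⟨div_ne_zero (mul_ne_zero hs0 hβ) hδ0, hk⟩ one_pos hs hr fun m₁ m₂ _ e => ?_
    rw [hδ, hA] at e
    change m₁ * m₂ = s * β / δ' * ((m₁ - m₂) / 2) + γ / δ'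
    field_simp
    linear_combination 2 * e

/-- Where a parallel surface is focal, both principal curvatures are constant. -/
theorem hasBasicPatch_of_focal (h : IsLinearSurface α β γ δ z D n₁ n₂) (hp : p ∈ D)
    (hΔ : α ^ 2 + 4 * γ * δ < 0)
    (hf : ∀ x ∈ D, (1 - -α / (2 * γ) * n₁ x) * (1 - -α / (2 * γ) * n₂ x) = 0) :
    HasBasicPatch z D p := by
  have hγ : γ ≠ 0 := by rintro rfl; nlinarith [sq_nonneg α]
  have red : ∀ n : ℝ, 1 - -α / (2 * γ) * n = (2 * γ + α * n) / (2 * γ) := fun n => by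
    field_simp; ring
  have hf' : ∀ x ∈ D, (2 * γ + α * n₁ x) * (2 * γ + α * n₂ x) = 0 := fun x hx => by
    have := hf x hx
    rw [red, red, div_mul_div_comm, div_eq_zero_iff] at this
    exact this.resolve_right (by positivity)
  -- Constant mean curvature is itself a linear relation, with `β = δ = 0` and discriminant `1`, so
  -- the previous cases apply with a different distance.
  suffices H : ∃ V ⊆ D, IsOpen V ∧ p ∈ V ∧ ∃ k : ℝ, ∀ x ∈ V, n₁ x + n₂ x = k by
    obtain ⟨V, sV, oV, pV, k, hk⟩ := H
    have h' : IsLinearSurface 1 0 (-(k / 2)) 0 z V n₁ n₂ :=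
      ⟨h.toIsPrincipalSurface.mono oV sV, fun x hx => h.nu₁_eq x (sV hx),
        fun x hx => h.nu₂_eq x (sV hx), fun x hx => h.lt x (sV hx), fun x hx => by
          rw [hk x hx]; ring⟩
    exact HasBasicPatch.mono oV sV
      (h'.hasBasicPatch_of_discrim_nonneg pV (by norm_num) (by norm_num))
  have hα : α ≠ 0 := fun e => by
    have := hf' p hp
    rw [e, zero_mul, zero_mul, add_zero] at this
    exact hγ (by simpa using this)
  -- One curvature is `-2γ/α`, and the relation then determines the other. The sign of `β'` records
  -- which of the two is focal, and the negative discriminant keeps the denominator from vanishing.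
  have const : ∀ β' n k : ℝ, (β' = β ∨ β' = -β) → 2 * γ + α * n = 0 →
      δ * (n * k) = α * ((n + k) / 2) + β' * ((n - k) / 2) + γ →
      n + k = -2 * γ / α - 2 * γ * β' / (α * β' - (α ^ 2 + 4 * γ * δ)) := by
    intro β' n k hβ' h0 e
    have e1 : k * (α * β' - (α ^ 2 + 4 * γ * δ)) = -2 * γ * β' := by
      linear_combination 2 * α * e + (β' + α - 2 * δ * k) * h0
    have e2 : α * β' - (α ^ 2 + 4 * γ * δ) ≠ 0 := fun e0 => by
      rw [e0, mul_zero] at e1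
      have : β' = 0 := by
        rcases mul_eq_zero.1 e1.symm with h | h
        · exact absurd h (mul_ne_zero (by norm_num) hγ)
        · exact h
      rw [this, mul_zero, zero_sub, neg_eq_zero] at e0
      exact hΔ.ne e0
    rw [show k = -2 * γ * β' / (α * β' - (α ^ 2 + 4 * γ * δ)) by rw [eq_div_iff e2, e1],
      show n = -2 * γ / α by rw [eq_div_iff hα]; linear_combination h0]
    ring
  have hsub := (sub_pos.2 (h.lt p hp)).ne'
  rcases mul_eq_zero.1 (hf' p hp) with h0 | h0
  -- Without umbilics only one factor vanishes at `p`, so near `p` it is always the same one.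
  · have h1 : 2 * γ + α * n₂ p ≠ 0 := fun e => mul_ne_zero hα hsub (by linear_combination h0 - e)
    refine ⟨D ∩ (fun x => 2 * γ + α * n₂ x) ⁻¹' {0}ᶜ, Set.inter_subset_left,
      (continuousOn_const.add (continuousOn_const.mul h.continuousOn_nu₂)).isOpen_inter_preimage
        h.isOpen isOpen_compl_singleton, ⟨hp, h1⟩,
      -2 * γ / α - 2 * γ * β / (α * β - (α ^ 2 + 4 * γ * δ)), fun x hx => ?_⟩
    exact const β _ _ (Or.inl rfl) ((mul_eq_zero.1 (hf' x hx.1)).resolve_right hx.2)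
      (h.rel x hx.1)
  · have h1 : 2 * γ + α * n₁ p ≠ 0 := fun e => mul_ne_zero hα hsub (by linear_combination e - h0)
    refine ⟨D ∩ (fun x => 2 * γ + α * n₁ x) ⁻¹' {0}ᶜ, Set.inter_subset_left,
      (continuousOn_const.add (continuousOn_const.mul h.continuousOn_nu₁)).isOpen_inter_preimage
        h.isOpen isOpen_compl_singleton, ⟨hp, h1⟩,
      -2 * γ / α - 2 * γ * -β / (α * -β - (α ^ 2 + 4 * γ * δ)), fun x hx => ?_⟩
    rw [add_comm]
    exact const (-β) _ _ (Or.inr rfl) ((mul_eq_zero.1 (hf' x hx.1)).resolve_left hx.2)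
      (by linear_combination h.rel x hx.1)

end IsLinearSurface

theorem IsPrincipalSurface.exists_isLinearSurface {α β γ δ : ℝ} {z : ℝ × ℝ → E3}
    {D : Set (ℝ × ℝ)} (h : IsPrincipalSurface z D)
    (hrel : ∀ p ∈ D, δ * curvK z p = α * curvH z p + β * curvH' z p + γ) {p : ℝ × ℝ} (hp : p ∈ D) :
    ∃ (V : Set (ℝ × ℝ)) (φ : ℝ × ℝ → ℝ × ℝ) (q : ℝ × ℝ), IsReparam φ V D ∧ q ∈ V ∧ φ q = p ∧
      ∃ n₁ n₂ : ℝ × ℝ → ℝ, IsLinearSurface α β γ δ (z ∘ φ) V n₁ n₂ ∧ ∀ x ∈ V, ∀ d : ℝ,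
        (1 - d * n₁ x) * (1 - d * n₂ x) = 1 - 2 * d * curvH z (φ x) + d ^ 2 * curvK z (φ x) := by
  obtain ⟨V, φ, q, r, hq, e, P, n₁, n₂, hn⟩ := h.exists_ordered hp
  refine ⟨V, φ, q, r, hq, e, n₁, n₂, ⟨P, fun x hx => (hn x hx).1, fun x hx => (hn x hx).2.1,
    fun x hx => (hn x hx).2.2.1, fun x hx => ?_⟩, fun x hx d => ?_⟩
  · have := hrel _ (r.mapsTo hx)
    rwa [(hn x hx).2.2.2.1, (hn x hx).2.2.2.2.1, (hn x hx).2.2.2.2.2] at this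
  · rw [(hn x hx).2.2.2.1, (hn x hx).2.2.2.2.1]; ring

/-- A surface with a linear relation between its curvatures is, locally and up to homothety,
parallel to a surface of a basic class. -/
theorem IsPrincipalSurface.exists_dense_hasBasicPatch {α β γ δ : ℝ} {z : ℝ × ℝ → E3}
    {D : Set (ℝ × ℝ)} (h : IsPrincipalSurface z D) (hne : α ^ 2 - β ^ 2 + 4 * γ * δ ≠ 0)
    (hrel : ∀ p ∈ D, δ * curvK z p = α * curvH z p + β * curvH' z p + γ) :
    ∃ D' : Set (ℝ × ℝ), IsOpen D' ∧ D' ⊆ D ∧ D ⊆ closure D' ∧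
      (0 ≤ α ^ 2 + 4 * γ * δ ∨ α = 0 → D' = D) ∧ ∀ p ∈ D', HasBasicPatch z D p := by
  rcases le_or_gt 0 (α ^ 2 + 4 * γ * δ) with hΔ | hΔ
  · refine ⟨D, h.isOpen, subset_rfl, subset_closure, fun _ => rfl, fun p hp => ?_⟩
    obtain ⟨V, φ, q, r, hq, rfl, n₁, n₂, hL, -⟩ := h.exists_isLinearSurface hrel hp
    exact HasBasicPatch.of_reparam r (hL.hasBasicPatch_of_discrim_nonneg hq hne hΔ)
  set d := -α / (2 * γ) with hd
  -- This is `(1 - d n₁)(1 - d n₂)` written without an order of the principal curvatures, hence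
  -- defined on all of `D`.
  set F : ℝ × ℝ → ℝ := fun x => 1 - 2 * d * curvH z x + d ^ 2 * curvK z x with hF
  have cF : ContinuousOn F D := by
    have c1 := h.smooth_nu.1.continuousOn
    have c2 := h.smooth_nu.2.continuousOn
    have cK : ContinuousOn (curvK z) D := (c1.mul c2).congr fun x hx => h.curvK_eq hx
    have cH : ContinuousOn (curvH z) D :=
      ((c1.add c2).div_const 2).congr fun x hx => h.curvH_eq hx
    exact (continuousOn_const.sub (continuousOn_const.mul cH)).add (continuousOn_const.mul cK)
  have oD₁ : IsOpen (D ∩ F ⁻¹' {0}ᶜ) := cF.isOpen_inter_preimage h.isOpen isOpen_compl_singleton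
  set D₁ := D ∩ F ⁻¹' {0}ᶜ with hD₁
  -- An open subset together with the interior of its complement is dense; the points left out form
  -- the boundary of the non-focal set in `D`.
  refine ⟨D₁ ∪ interior (D \ D₁), oD₁.union isOpen_interior,
    Set.union_subset Set.inter_subset_left (interior_subset.trans Set.sdiff_subset),
    fun x hx => ?_, fun hα => ?_, fun p hp => ?_⟩
  · by_cases hc : x ∈ closure D₁
    · exact closure_mono Set.subset_union_left hc
    · refine subset_closure (Or.inr ?_)
      refine mem_interior.2 ⟨D ∩ (closure D₁)ᶜ, fun y hy => ⟨hy.1, fun h1 => hy.2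
        (subset_closure h1)⟩, h.isOpen.inter isClosed_closure.isOpen_compl, hx, hc⟩
  -- For `α = 0` the distance is zero and there are no focal points.
  · have hα0 : α = 0 := hα.resolve_left (not_le.2 hΔ)
    have : D₁ = D := Set.inter_eq_left.2 fun x _ => by
      simp [hF, hd, hα0]
    rw [this, Set.sdiff_self, interior_empty, Set.union_empty]
  · rcases hp with hp | hp
    · obtain ⟨V, φ, q, r, hq, rfl, n₁, n₂, hL, hn⟩ := h.exists_isLinearSurface hrel hp.1
      refine HasBasicPatch.of_reparam r (hL.hasBasicPatch_of_discrim_neg hq hΔ ?_)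
      rw [hn q hq]
      exact hp.2
    · have sW : interior (D \ D₁) ⊆ D := interior_subset.trans Set.sdiff_subset
      obtain ⟨V, φ, q, r, hq, rfl, n₁, n₂, hL, hn⟩ :=
        (h.mono isOpen_interior sW).exists_isLinearSurface (fun x hx => hrel x (sW hx)) hp
      refine HasBasicPatch.mono isOpen_interior sW
        (HasBasicPatch.of_reparam r (hL.hasBasicPatch_of_focal hq hΔ fun x hx => ?_))
      rw [hn x hx]
      by_contra hcon
      have := interior_subset (r.mapsTo hx)
      exact this.2 ⟨this.1, hcon⟩

end LinearWeingarten

end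

/-! ### Assembly of the theorem. -/

open LinearWeingarten in
theorem theoremA :
    -- normalizing constants, depending only on the class and on the base value
    ∃ a b : BasicClass → ℝ → ℝ,
      (∀ C : BasicClass, C.Admissible → ∀ t₀ ∈ C.range, a C t₀ ≠ 0 ∧ b C t₀ ≠ 0) ∧
      -- the natural PDE of each basic class is the listed one
      (∀ C : BasicClass, C.Admissible → IsWeingartenPair C.nu₁ C.nu₂ C.range ∧
        ∀ t₀ ∈ C.range, ∀ (V : Set (ℝ × ℝ)) (lam : ℝ × ℝ → ℝ), IsOpen V →
          ContDiffOn ℝ ∞ lam V → Set.MapsTo lam V C.range →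
          ∀ p ∈ V, Set.uIcc t₀ (lam p) ⊆ C.range →
            (NaturalPDE C.nu₁ C.nu₂ (a C t₀) (b C t₀) t₀ lam p ↔ C.PDE lam p)) ∧
      -- every surface of a basic class yields, near each point, a solution of the PDE
      (∀ C : BasicClass, C.Admissible → ∀ (z : ℝ × ℝ → E3) (D : Set (ℝ × ℝ)),
        IsPrincipalSurface z D →
        (∀ p ∈ D, C.Relation (curvK z p) (curvH z p) (curvH' z p)) →
        ∀ p ∈ D, ∃ (V : Set (ℝ × ℝ)) (q : ℝ × ℝ) (φ : ℝ × ℝ → ℝ × ℝ) (lam : ℝ × ℝ → ℝ),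
          IsReparam φ V D ∧ φ q = p ∧
          IsBasicPatch C (a C (lam q)) (b C (lam q)) lam (z ∘ φ) V q ∧
          ∀ x ∈ V, C.PDE lam x) ∧
      -- every solution of the PDE comes, near each point, from a surface of the basic class
      (∀ C : BasicClass, C.Admissible → ∀ (V : Set (ℝ × ℝ)) (lam : ℝ × ℝ → ℝ), IsOpen V →
        ContDiffOn ℝ ∞ lam V → Set.MapsTo lam V C.range → (∀ x ∈ V, C.PDE lam x) →
        ∀ q ∈ V, ∃ (V₀ : Set (ℝ × ℝ)) (w : ℝ × ℝ → E3), V₀ ⊆ V ∧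
          IsBasicPatch C (a C (lam q)) (b C (lam q)) lam w V₀ q) ∧
      -- and the surface is unique up to a proper motion
      (∀ C : BasicClass, C.Admissible → ∀ (V : Set (ℝ × ℝ)) (lam : ℝ × ℝ → ℝ) (q : ℝ × ℝ)
        (w₁ w₂ : ℝ × ℝ → E3),
        IsBasicPatch C (a C (lam q)) (b C (lam q)) lam w₁ V q →
        IsBasicPatch C (a C (lam q)) (b C (lam q)) lam w₂ V q →
        ∃ (R : E3 ≃ₗᵢ[ℝ] E3) (τ : E3), LinearMap.det (R.toLinearEquiv : E3 →ₗ[ℝ] E3) = 1 ∧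
          ∀ x ∈ V, w₂ x = R (w₁ x) + τ) ∧
      -- every surface with a linear relation between its curvatures is locally, up to similarity,
      -- parallel to a surface of a basic class and has the same natural principal parameters
      -- and the same natural PDE
      (∀ α β γ δ : ℝ, α ^ 2 - β ^ 2 + 4 * γ * δ ≠ 0 →
        ∀ (z : ℝ × ℝ → E3) (D : Set (ℝ × ℝ)), IsPrincipalSurface z D →
        (∀ p ∈ D, δ * curvK z p = α * curvH z p + β * curvH' z p + γ) →
        ∃ D' : Set (ℝ × ℝ), IsOpen D' ∧ D' ⊆ D ∧ D ⊆ closure D' ∧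
          (0 ≤ α ^ 2 + 4 * γ * δ ∨ α = 0 → D' = D) ∧
          ∀ p ∈ D', ∃ (V : Set (ℝ × ℝ)) (q : ℝ × ℝ) (φ : ℝ × ℝ → ℝ × ℝ),
            IsReparam φ V D ∧ φ q = p ∧
            ∃ (C : BasicClass) (d c : ℝ) (lam : ℝ × ℝ → ℝ), C.Admissible ∧ 0 < c ∧
              -- the homothetic image of a parallel surface lies in the basic class
              IsBasicPatch C (a C (lam q)) (b C (lam q)) lam
                (fun x => c • parallel d (z ∘ φ) x) V q ∧
              (∀ x ∈ V, C.PDE lam x) ∧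
              -- the given surface itself is described by the same PDE
              ∃ (I : Set ℝ) (f g : ℝ → ℝ) (a' b' : ℝ), IsOpen I ∧ I.OrdConnected ∧
                I ⊆ C.range ∧ Set.MapsTo lam V I ∧ IsWeingartenPair f g I ∧
                a' ≠ 0 ∧ b' ≠ 0 ∧
                IsNaturalPatch f g a' b' (lam q) lam (z ∘ φ) V ∧
                ∀ (V' : Set (ℝ × ℝ)) (μ : ℝ × ℝ → ℝ), IsOpen V' → ContDiffOn ℝ ∞ μ V' →
                  Set.MapsTo μ V' I → ∀ x ∈ V',
                    (NaturalPDE f g a' b' (lam q) μ x ↔ C.PDE μ x)) := by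
  refine ⟨BasicClass.constA, BasicClass.constB,
    fun C hC t₀ h₀ => ⟨C.constA_ne hC h₀, C.constB_ne hC h₀⟩,
    fun C hC => ⟨C.isWeingartenPair hC, fun t₀ _ V lam hV hl hm p hp h =>
      C.naturalPDE_iff hC hV hl hm hp h⟩,
    fun C hC z D h hrel p hp => exists_basicPatch hC h hrel hp,
    fun C hC V lam hV hl hm hpde q hq => exists_surface_of_PDE hC hV hl hm hpde hq,
    fun C _ V lam q w₁ w₂ h₁ h₂ => h₁.unique h₂, fun α β γ δ hne z D h hrel => ?_⟩
  obtain ⟨D', o, s, dense, eq, hD'⟩ := h.exists_dense_hasBasicPatch hne hrel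
  refine ⟨D', o, s, dense, eq, fun p hp => ?_⟩
  obtain ⟨C, d, c, hC, hc, V, q, φ, hφ, e, lam, h1, h2, h3⟩ := hD' p hp
  exact ⟨V, q, φ, hφ, e, C, d, c, lam, hC, hc, h1, h2, h3⟩
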